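/- \textbf{Setting.} Let $\mathcal X$ be a finite set; functions and signed measures on $\mathcal X$ are identified with vectors in $\mathbb R^{\mathcal X}$, and $\mathcal P(\mathcal X)$ is the set of probability vectors. Let $\varepsilon>0$, let $c:\mathcal X\times\mathcal X\to[0,\infty)$ be symmetric and such that $k_c=\exp(-c/\varepsilon)$ is a positive definite universal kernel (its reproducing kernel Hilbert space $\mathcal H_c$ is dense in $\mathbb R^{\mathcal X}$), and let $V:\mathcal X\to\mathbb R$, $E(\mu)=\langle\mu,V\rangle$. For $\mu,\nu\in\mathcal P(\mathcal X)$ let $$\mathrm{OT}_\varepsilon(\mu,\nu)=\min_{\pi\in\Pi(\mu,\nu)}\langle \pi,c\rangle+\varepsilon\,\mathrm{KL}(\pi\,|\,\mu\otimes\nu),\qquad S_\varepsilon(\mu,\nu)=\mathrm{OT}_\varepsilon(\mu,\nu)-\tfrac12\mathrm{OT}_\varepsilon(\mu,\mu)-\tfrac12\mathrm{OT}_\varepsilon(\nu,\nu),$$ where $\Pi(\mu,\nu)$ is the set of couplings. Let $T_\varepsilon(f,\mu)(y)=-\varepsilon\log\sum_x e^{(f(x)-c(x,y))/\varepsilon}\mu(x)$,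 let $(f_{\mu,\nu},g_{\mu,\nu})$ be the solution of $f=T_\varepsilon(g,\nu)$, $g=T_\varepsilon(f,\mu)$ with $\langle\mu,f\rangle=\langle\nu,g\rangle$, and let $f_\mu=f_{\mu,\mu}$. Put $k_\mu(x,y)=\exp((f_\mu(x)+f_\mu(y)-c(x,y))/\varepsilon)$, $H_\mu[\sigma](y)=\sum_x k_\mu(x,y)\sigma(x)$, $K_\mu[\phi]=H_\mu[\phi\mu]$, $B(\mu)=\exp(-f_\mu/\varepsilon)\in\mathcal H_c$, and, for $\sigma$ of zero total mass, $\mathbf g_\mu(\sigma,\sigma)=\frac\varepsilon2\langle\sigma,(\mathrm{Id}-K_\mu^2)^{-1}H_\mu[\sigma]\rangle$, the inverse being taken on functions modulo constants. Let $$\mathsf d_S(\mu,\nu)^2=\inf\int_0^1\mathbf g_{\mu_t}(\dot\mu_t,\dot\mu_t)\,dt$$ over paths $(\mu_t)_{t\in[0,1]}$ in $\mathcal P(\mathcal X)$ from $\mu$ to $\nu$ with $(B(\mu_t))_t\in H^1([0,1];\mathcal H_c)$. A \emph{Sinkhorn potential flow} of $V$ starting at $\bar\mu_0$ is a curve $(\mu_t)_{t\ge0}\in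 \mathrm{AC}^2_{\rm loc}([0,\infty);(\mathcal P(\mathcal X),\mathsf d_S))$ with $\mu_0=\bar\mu_0$ such that for a.e. $t$ there are a function $p_t\le0$ with $p_t=0$ on $\operatorname{supp}\mu_t$ and a constant $C_t$ with $$\tfrac\varepsilon2(\mathrm{Id}-K_{\mu_t}^2)^{-1}H_{\mu_t}[\dot\mu_t]+V+p_t=C_t .$$ Its image $(B(\mu_t))_{t\ge0}$ is called a Sinkhorn potential flow starting at $B(\bar\mu_0)$. \textbf{Theorem.} Let $\bar\mu_0\in\mathcal P(\mathcal X)$. (1) For every $\tau>0$ there is a sequence $(\mu^\tau_k)_{k\ge0}$ in $\mathcal P(\mathcal X)$ with $\mu_0^\tau=\bar\mu_0$ and $$\mu^\tau_{k+1}\in\operatorname*{arg\,min}_{\mu\in\mathcal P(\mathcal X)}\;E(\mu)+\frac1{2\tau}S_\varepsilon(\mu,\mu_k^\tau)\qquad(k\ge0).\tag{SJKO}$$ For every such sequence, with $b_k^\tau=B(\mu_k^\tau)$, there is a piecewise geodesic interpolation $(\hat b^\tau_t)_{t\ge0}$ of $(b_k^\tau)_k$: its restriction to each $[k\tau,(k+1)\tau]$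 is the image under $B$ of a constant-speed geodesic for $\mathsf d_S$ from $\mu^\tau_k$ to $\mu^\tau_{k+1}$. (2) There is a unique Sinkhorn potential flow $(b_t)_{t\ge0}$ of $V$ starting at $B(\bar\mu_0)$. (3) For any choice, for every $\tau>0$, of a sequence $(\mu_k^\tau)_k$ as in (1), let $\bar b^\tau_t=b^\tau_k$ for $t\in[k\tau,(k+1)\tau)$, and let $\hat b^\tau$ be any piecewise geodesic interpolation of $(b_k^\tau)_k$. Then for every $T>0$, as $\tau\to0$, both $\bar b^\tau$ and $\hat b^\tau$ converge to $b$ uniformly on $[0,T]$ for $\|\cdot\|_{\mathcal H_c}$. -/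

import Mathlib

open Set Filter Topology MeasureTheory

/-! The state space is a finite type `X`. Functions on `X` and signed measures on `X` are both
elements of `X → ℝ` (a measure is given by its weights), and `𝒫(X)` is `stdSimplex ℝ X`. -/

namespace SinkhornFlow

noncomputable section

/-- The Gibbs kernel `k_c = exp (-c / ε)`. -/
def gibbsKernel {X : Type*} (ε : ℝ) (c : X → X → ℝ) (x y : X) : ℝ :=
  Real.exp (-c x y / ε)

/-- Positive definite kernel: symmetric, and all its finite quadratic forms are nonnegative. -/
def IsPDKernel {X : Type*} (k : X → X → ℝ) : Prop :=
  (∀ x y, k x y = k y x) ∧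
    ∀ (n : ℕ) (x : Fin n → X) (a : Fin n → ℝ), 0 ≤ ∑ i, ∑ j, a i * a j * k (x i) (x j)

/-- The real reproducing kernel Hilbert space `H` of functions on `X` has reproducing kernel `k`. -/
def HasReproducingKernel {X : Type*} (H : Type*) [NormedAddCommGroup H] [InnerProductSpace ℝ H]
    [CompleteSpace H] [RKHS ℝ H X ℝ] (k : X → X → ℝ) : Prop :=
  ∀ x y, RKHS.kernel H x y 1 = k x y

/-- Universality of the kernel of `H`: the functions of `H` are dense among all (continuous)
functions on the finite space `X`, for the topology of uniform convergence. -/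
def IsUniversal {X : Type*} (H : Type*) [NormedAddCommGroup H] [InnerProductSpace ℝ H]
    [RKHS ℝ H X ℝ] : Prop :=
  DenseRange (fun (h : H) (x : X) => h x)

section Transport

variable {X : Type*} [Fintype X]

/-- The couplings `Π(μ, ν)` of two probability vectors. -/
def couplings (μ ν : X → ℝ) : Set (X → X → ℝ) :=
  {π | (∀ x y, 0 ≤ π x y) ∧ (∀ x, ∑ y, π x y = μ x) ∧ (∀ y, ∑ x, π x y = ν y)}

/-- `KL(π | μ ⊗ ν)` for a coupling `π` of `μ` and `ν`. A coupling is always absolutely continuous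
with respect to `μ ⊗ ν`, so the value `+∞` does not occur; terms with `π x y = 0` vanish. -/
def klCoupling (π : X → X → ℝ) (μ ν : X → ℝ) : ℝ :=
  ∑ x, ∑ y, π x y * Real.log (π x y / (μ x * ν y))

/-- The entropic optimal transport cost `OT_ε(μ, ν)`. -/
def entropicOT (ε : ℝ) (c : X → X → ℝ) (μ ν : X → ℝ) : ℝ :=
  sInf ((fun π : X → X → ℝ => (∑ x, ∑ y, c x y * π x y) + ε * klCoupling π μ ν) ''
    couplings μ ν)

/-- The Sinkhorn divergence `S_ε(μ, ν)`. -/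
def sinkhornDivergence (ε : ℝ) (c : X → X → ℝ) (μ ν : X → ℝ) : ℝ :=
  entropicOT ε c μ ν - entropicOT ε c μ μ / 2 - entropicOT ε c ν ν / 2

/-- The potential energy `E(μ) = ⟨μ, V⟩`. -/
def potentialEnergy (V μ : X → ℝ) : ℝ := ∑ x, μ x * V x

/-- `(μ k)` is a sequence of iterates of the Sinkhorn-JKO scheme with step `τ` started at `μ₀`. -/
def IsSJKO (ε : ℝ) (c : X → X → ℝ) (V : X → ℝ) (τ : ℝ) (μ₀ : X → ℝ) (μ : ℕ → X → ℝ) : Prop :=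
  μ 0 = μ₀ ∧ ∀ k, μ (k + 1) ∈ stdSimplex ℝ X ∧
    IsMinOn (fun ρ => potentialEnergy V ρ + 1 / (2 * τ) * sinkhornDivergence ε c ρ (μ k))
      (stdSimplex ℝ X) (μ (k + 1))

/-- The Sinkhorn mapping `T_ε(f, μ)`. -/
def sinkhornMap (ε : ℝ) (c : X → X → ℝ) (f μ : X → ℝ) (y : X) : ℝ :=
  -ε * Real.log (∑ x, Real.exp ((f x - c x y) / ε) * μ x)

/-- `(f, g)` solves the Schrödinger system for `(μ, ν)`, with the normalization
`⟨μ, f⟩ = ⟨ν, g⟩`. -/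
structure IsSchrodingerPair (ε : ℝ) (c : X → X → ℝ) (μ ν f g : X → ℝ) : Prop where
  fst_eq : f = sinkhornMap ε c g ν
  snd_eq : g = sinkhornMap ε c f μ
  normalized : ∑ x, μ x * f x = ∑ x, ν x * g x

/-- The Schrödinger potential `f_{μ,ν}`: the first component of the (unique) normalized solution
of the Schrödinger system. -/
def schrodingerPotential (ε : ℝ) (c : X → X → ℝ) (μ ν : X → ℝ) : X → ℝ :=
  Classical.epsilon fun f => ∃ g, IsSchrodingerPair ε c μ ν f g

/-- The self-transport potential `f_μ = f_{μ,μ}`. -/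
def selfPotential (ε : ℝ) (c : X → X → ℝ) (μ : X → ℝ) : X → ℝ :=
  schrodingerPotential ε c μ μ

/-- The self-transport kernel `k_μ = exp ((f_μ ⊕ f_μ - c) / ε)`. -/
def selfKernel (ε : ℝ) (c : X → X → ℝ) (μ : X → ℝ) (x y : X) : ℝ :=
  Real.exp ((selfPotential ε c μ x + selfPotential ε c μ y - c x y) / ε)

/-- The operator `H_μ`, acting on signed measures. -/
def opH (ε : ℝ) (c : X → X → ℝ) (μ σ : X → ℝ) (y : X) : ℝ :=
  ∑ x, selfKernel ε c μ x y * σ x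

/-- The operator `K_μ[φ] = H_μ[φ μ]`, acting on functions. -/
def opK (ε : ℝ) (c : X → X → ℝ) (μ φ : X → ℝ) : X → ℝ :=
  opH ε c μ (fun x => φ x * μ x)

/-- A representative of `(Id - K_μ²)⁻¹[ψ]`, where the inverse is taken on functions modulo
constants: a function `φ` with `φ - K_μ² φ = ψ` up to an additive constant. Such a `φ` exists and
is unique up to an additive constant, and it is only used up to such a constant below. -/
def resolvent (ε : ℝ) (c : X → X → ℝ) (μ ψ : X → ℝ) : X → ℝ :=
  Classical.epsilon fun φ => ∃ C : ℝ, ∀ x, φ x - opK ε c μ (opK ε c μ φ) x = ψ x + C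

/-- The metric tensor `g_μ(σ₁, σ₂) = (ε / 2) ⟨σ₁, (Id - K_μ²)⁻¹ H_μ[σ₂]⟩`
(for `σ₁` of zero total mass). -/
def metricTensor (ε : ℝ) (c : X → X → ℝ) (μ σ₁ σ₂ : X → ℝ) : ℝ :=
  ε / 2 * ∑ x, σ₁ x * resolvent ε c μ (opH ε c μ σ₂) x

/-- The set `P μ` of admissible pressures: `p ≤ 0`, and `p = 0` on the support of `μ`. -/
def pressures (μ : X → ℝ) : Set (X → ℝ) :=
  {p | (∀ x, p x ≤ 0) ∧ ∀ x, μ x ≠ 0 → p x = 0}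

end Transport

section Curves

/-- The Sobolev space `H¹([0,1]; E)`, for (continuous) curves restricted to `[0,1]`: the curve is
the indefinite integral of a square-integrable function. -/
def IsH1UnitInterval {E : Type*} [NormedAddCommGroup E] [NormedSpace ℝ E] (b : ℝ → E) : Prop :=
  ∃ v : ℝ → E, MemLp v 2 (volume.restrict (Icc 0 1)) ∧
    ∀ t ∈ Icc (0 : ℝ) 1, b t = b 0 + ∫ s in (0 : ℝ)..t, v s

/-- `AC²_loc([0, ∞); (Y, d))`. -/
def IsLocallyAC2 {Y : Type*} (d : Y → Y → ℝ) (y : ℝ → Y) : Prop :=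
  ∀ T : ℝ, 0 < T → ∃ m : ℝ → ℝ, MemLp m 2 (volume.restrict (Icc 0 T)) ∧
    ∀ s t : ℝ, 0 ≤ s → s ≤ t → t ≤ T → d (y s) (y t) ≤ ∫ r in s..t, m r

/-- On `[t₀, t₁]` the curve `y` is a constant-speed geodesic for the distance `d`. -/
def IsConstSpeedGeodesic {Y : Type*} (d : Y → Y → ℝ) (y : ℝ → Y) (t₀ t₁ : ℝ) : Prop :=
  ∀ s ∈ Icc t₀ t₁, ∀ t ∈ Icc t₀ t₁, d (y s) (y t) = |t - s| / (t₁ - t₀) * d (y t₀) (y t₁)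

end Curves

section Embedding

variable {X : Type*} [Fintype X] (H : Type*) [NormedAddCommGroup H] [InnerProductSpace ℝ H]
  [CompleteSpace H] [RKHS ℝ H X ℝ]

/-- The operator `H_c[σ] = ∑ x, σ x • k_c(x, ·)`, from signed measures to the RKHS of `k_c`. -/
def kernelMean (σ : X → ℝ) : H := ∑ x, σ x • RKHS.kerFun H x (1 : ℝ)

/-- The embedding `B(μ) = H_c[exp (f_μ / ε) μ] = exp (-f_μ / ε)` (see `embB_apply`). -/
def embB (ε : ℝ) (c : X → X → ℝ) (μ : X → ℝ) : H :=
  kernelMean H (fun x => Real.exp (selfPotential ε c μ x / ε) * μ x)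

/-- As a function on `X`, `B(μ)` is `exp (-f_μ / ε)`. -/
theorem embB_apply {ε : ℝ} (hε : 0 < ε) {c : X → X → ℝ} (hc : ∀ x y, c x y = c y x)
    (hk : HasReproducingKernel H (gibbsKernel ε c)) {μ : X → ℝ} (hμ : μ ∈ stdSimplex ℝ X)
    (hf : selfPotential ε c μ = sinkhornMap ε c (selfPotential ε c μ) μ) (y : X) :
    embB H ε c μ y = Real.exp (-selfPotential ε c μ y / ε) := by
  have h1 : embB H ε c μ y =
      ∑ x, Real.exp ((selfPotential ε c μ x - c x y) / ε) * μ x := by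
    have h2 : ∀ h : H, h y = inner ℝ (RKHS.kerFun H y (1 : ℝ)) h := by
      intro h
      simp
    rw [h2, embB, kernelMean, inner_sum]
    refine Finset.sum_congr rfl fun x _ => ?_
    rw [inner_smul_right, ← h2, RKHS.kerFun_apply, hk, gibbsKernel, sub_div, Real.exp_sub,
      neg_div, Real.exp_neg, hc y x]
    ring
  have hpos : 0 < ∑ x, Real.exp ((selfPotential ε c μ x - c x y) / ε) * μ x := by
    obtain ⟨x, hx⟩ : ∃ x, 0 < μ x := by
      by_contra! hcon
      have := Finset.sum_nonpos fun x (_ : x ∈ Finset.univ) => hcon x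
      linarith [hμ.2]
    exact Finset.sum_pos' (fun x _ => mul_nonneg (Real.exp_pos _).le (hμ.1 x))
      ⟨x, Finset.mem_univ _, mul_pos (Real.exp_pos _) hx⟩
  have h3 := congrFun hf y
  rw [sinkhornMap] at h3
  rw [h1, h3, neg_mul, neg_neg, mul_div_cancel_left₀ _ hε.ne', Real.exp_log hpos]

/-- Paths in `𝒫(X)` from `μ` to `ν`, parametrized by `[0,1]`, whose embedding is of class `H¹`. -/
def IsAdmissiblePath (ε : ℝ) (c : X → X → ℝ) (μ ν : X → ℝ) (γ : ℝ → X → ℝ) : Prop :=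
  (∀ t ∈ Icc (0 : ℝ) 1, γ t ∈ stdSimplex ℝ X) ∧ γ 0 = μ ∧ γ 1 = ν ∧
    IsH1UnitInterval (fun t => embB H ε c (γ t))

/-- The Riemannian distance `d_S`. -/
def dS (ε : ℝ) (c : X → X → ℝ) (μ ν : X → ℝ) : ℝ :=
  Real.sqrt (sInf ((fun γ : ℝ → X → ℝ =>
    ∫ t in (0 : ℝ)..1, metricTensor ε c (γ t) (deriv γ t) (deriv γ t)) ''
      {γ | IsAdmissiblePath H ε c μ ν γ}))

/-- `(μ t)`, `t ≥ 0`, is a Sinkhorn potential flow of `V` in `𝒫(X)`, starting from `μ₀`. -/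
structure IsSinkhornFlow (ε : ℝ) (c : X → X → ℝ) (V μ₀ : X → ℝ) (μ : ℝ → X → ℝ) : Prop where
  mem_simplex : ∀ t, 0 ≤ t → μ t ∈ stdSimplex ℝ X
  initial : μ 0 = μ₀
  ac : IsLocallyAC2 (dS H ε c) μ
  inclusion : ∀ᵐ t ∂(volume.restrict (Ici (0 : ℝ))), ∃ μ' : X → ℝ, HasDerivAt μ μ' t ∧
    ∃ p ∈ pressures (μ t), ∃ C : ℝ, ∀ x,
      ε / 2 * resolvent ε c (μ t) (opH ε c (μ t) μ') x + V x + p x = C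

/-- `(b t)`, `t ≥ 0`, is a Sinkhorn potential flow of `V` in the embedded space, starting from
`b₀`: it is the image under `B` of a Sinkhorn potential flow in `𝒫(X)`. -/
def IsEmbeddedSinkhornFlow (ε : ℝ) (c : X → X → ℝ) (V : X → ℝ) (b₀ : H) (b : ℝ → H) : Prop :=
  ∃ (μ₀ : X → ℝ) (μ : ℝ → X → ℝ), μ₀ ∈ stdSimplex ℝ X ∧ embB H ε c μ₀ = b₀ ∧
    IsSinkhornFlow H ε c V μ₀ μ ∧ ∀ t, 0 ≤ t → b t = embB H ε c (μ t)

/-- Piecewise constant interpolation: the value on `[k τ, (k + 1) τ)` is `B(μ k)`. -/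
def constInterp (ε : ℝ) (c : X → X → ℝ) (τ : ℝ) (μ : ℕ → X → ℝ) (t : ℝ) : H :=
  embB H ε c (μ ⌊t / τ⌋₊)

/-- `b` is a piecewise geodesic interpolation of `(B(μ k))` with step `τ`: it is the image under
`B` of a curve `γ` in `𝒫(X)` with `γ (k τ) = μ k` which on every `[k τ, (k + 1) τ]` is a
constant-speed geodesic for `d_S`. -/
def IsGeodesicInterp (ε : ℝ) (c : X → X → ℝ) (τ : ℝ) (μ : ℕ → X → ℝ) (b : ℝ → H) : Prop :=
  ∃ γ : ℝ → X → ℝ, (∀ t, 0 ≤ t → γ t ∈ stdSimplex ℝ X ∧ b t = embB H ε c (γ t)) ∧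
    ∀ k : ℕ, γ (k * τ) = μ k ∧ IsConstSpeedGeodesic (dS H ε c) γ (k * τ) ((k + 1) * τ)

end Embedding

end

end SinkhornFlow

/-!
The embedding `B` maps the simplex homeomorphically onto the part `embSet` of the unit sphere of the
Hilbert space `H` on which the weights are nonnegative: since the kernel is universal and `X` is
finite, every `h : H` is the kernel mean of a unique signed measure `weights h`, the vector
`b = B(μ)` is the kernel mean of its weights, and `μ = b * weights b` (`unembed`). So `‖b‖ = 1` says
that `μ` has mass one, and the cone over `embSet` is a convex cone.

In these coordinates the flow becomes linear up to a normal cone. If `ψ` denotes the potential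
`(Id - K_μ²)⁻¹ H_μ[μ']` of the velocity of `μ`, then `b (Id - K_μ) ψ = b'`
(`resolvent_opH_unembedDeriv`), and applying `b (Id - K_μ)` to the flow equation turns it into
`⟪b', b - z⟫ ≤ a(b, z)` for all `z` in `embSet`, where `a` is the skew-symmetric form `skewForm`: the
difference of the multiplication by `V` and its adjoint. The pressure is the multiplier of the
constraint that the weights be nonnegative (`inner_le_of_pressure`, `exists_pressure_of_inner_le`).
Because `a` is skew, the distance in `H` between two solutions does not increase, whence uniqueness
(`IsSinkhornFlow.embB_eq`).

A step of the scheme is an implicit Euler step for the same inequality. An expansion of the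
Schrödinger potentials around the diagonal shows that the iterates satisfy
`‖x (k + 1) - z‖² ≤ ‖x k - z‖² + 2 τ a(x k, z) + C τ²` (`exists_isStepEVI_of_isSJKO`). Again since `a`
is skew, two sequences with this property and commensurable steps stay `O(√τ)`-close on bounded time
intervals; the interpolations along dyadic steps therefore form a Cauchy sequence, whose limit
satisfies the continuous evolution variational inequality (`exists_isEVICurve`), is Lipschitz, and is
the flow (`IsEVICurve.isSinkhornFlow`). The same comparison, between the flow and an arbitrary
sequence of iterates, gives the uniform convergence (`IsEVICurve.norm_sub_interp_le`).

The metric tensor in the embedded coordinates is `embCost`. It is continuous and comparable to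
`‖v‖²`, because `Id - K_μ` is invertible on functions of zero mean and `embSet` is compact. Hence
`d_S` is a length distance that is equivalent to the distance of `H` (`dS_eq_lengthDist`,
`exists_dS_bounds`). Geodesics are limits along an ultrafilter of almost minimizing paths, whose
speed is almost constant (`IsLengthCost.exists_geodesic`), and piecewise geodesic interpolations have
the same limit as piecewise constant ones since a step of the scheme moves by `O(τ)`.
-/

namespace SinkhornFlow

/-! ### Schrödinger systems -/

section Schrodinger

variable {X : Type*} [Fintype X] {ε : ℝ} {c : X → X → ℝ}

theorem exists_pos_of_mem_stdSimplex {μ : X → ℝ} (hμ : μ ∈ stdSimplex ℝ X) : ∃ x, 0 < μ x := by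
  by_contra! hcon
  have := Finset.sum_nonpos fun x (_ : x ∈ Finset.univ) => hcon x
  linarith [hμ.2]

theorem sum_exp_mul_pos (h : X → ℝ) {μ : X → ℝ} (hμ : μ ∈ stdSimplex ℝ X) :
    0 < ∑ x, Real.exp (h x) * μ x := by
  obtain ⟨x, hx⟩ := exists_pos_of_mem_stdSimplex hμ
  exact Finset.sum_pos' (fun x _ => mul_nonneg (Real.exp_pos _).le (hμ.1 x))
    ⟨x, Finset.mem_univ _, mul_pos (Real.exp_pos _) hx⟩

theorem eq_neg_mul_log_iff (hε : 0 < ε) {a S : ℝ} (hS : 0 < S) :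
    a = -ε * Real.log S ↔ Real.exp (a / ε) * S = 1 := by
  constructor
  · rintro rfl
    rw [neg_mul, neg_div, mul_div_cancel_left₀ _ hε.ne', Real.exp_neg, Real.exp_log hS,
      inv_mul_cancel₀ hS.ne']
  · intro h
    have : S = Real.exp (-(a / ε)) := by
      rw [Real.exp_neg]; exact (eq_inv_of_mul_eq_one_right h)
    rw [this, Real.log_exp]
    field_simp

/-- The equation `f = T_ε(g, ν)` says that `exp ((f ⊕ g - c) / ε)` is a Markov density with
respect to `ν`. -/
theorem eq_sinkhornMap_iff (hε : 0 < ε) (hc : ∀ x y, c x y = c y x) {f g ν : X → ℝ}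
    (hν : ν ∈ stdSimplex ℝ X) :
    f = sinkhornMap ε c g ν ↔ ∀ x, ∑ y, Real.exp ((f x + g y - c x y) / ε) * ν y = 1 := by
  rw [funext_iff]
  refine forall_congr' fun x => ?_
  rw [sinkhornMap, eq_neg_mul_log_iff hε (sum_exp_mul_pos (fun y => (g y - c y x) / ε) hν),
    Finset.mul_sum]
  refine Eq.congr (Finset.sum_congr rfl fun y _ => ?_) rfl
  rw [← mul_assoc, ← Real.exp_add, hc x y]
  ring_nf

theorem sinkhornMap_le_add (hε : 0 < ε) {f f' μ : X → ℝ} (hμ : μ ∈ stdSimplex ℝ X) {M : ℝ}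
    (h : ∀ x, f x ≤ f' x + M) (y : X) :
    sinkhornMap ε c f' μ y ≤ sinkhornMap ε c f μ y + M := by
  have key : ∑ x, Real.exp ((f x - c x y) / ε) * μ x
      ≤ Real.exp (M / ε) * ∑ x, Real.exp ((f' x - c x y) / ε) * μ x := by
    rw [Finset.mul_sum]
    refine Finset.sum_le_sum fun x _ => ?_
    rw [← mul_assoc, ← Real.exp_add]
    refine mul_le_mul_of_nonneg_right (Real.exp_le_exp.2 ?_) (hμ.1 x)
    rw [← add_div]
    gcongr
    linarith [h x]
  have h1 := Real.log_le_log (sum_exp_mul_pos _ hμ) key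
  rw [Real.log_mul (Real.exp_pos _).ne' (sum_exp_mul_pos _ hμ).ne', Real.log_exp] at h1
  have h2 := mul_le_mul_of_nonneg_left h1 hε.le
  rw [mul_add, mul_div_cancel₀ _ hε.ne'] at h2
  simp only [sinkhornMap]
  linarith

theorem sinkhornMap_lt_add (hε : 0 < ε) {f f' μ : X → ℝ} (hμ : μ ∈ stdSimplex ℝ X) {M : ℝ}
    (h : ∀ x, f x ≤ f' x + M) (h' : ∃ x, 0 < μ x ∧ f x < f' x + M) (y : X) :
    sinkhornMap ε c f' μ y < sinkhornMap ε c f μ y + M := by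
  have key : ∑ x, Real.exp ((f x - c x y) / ε) * μ x
      < Real.exp (M / ε) * ∑ x, Real.exp ((f' x - c x y) / ε) * μ x := by
    rw [Finset.mul_sum]
    obtain ⟨z, hz, hz'⟩ := h'
    refine Finset.sum_lt_sum (fun x _ => ?_) ⟨z, Finset.mem_univ z, ?_⟩
    · rw [← mul_assoc, ← Real.exp_add]
      refine mul_le_mul_of_nonneg_right (Real.exp_le_exp.2 ?_) (hμ.1 x)
      rw [← add_div]
      gcongr
      linarith [h x]
    · rw [← mul_assoc, ← Real.exp_add]
      refine mul_lt_mul_of_pos_right (Real.exp_lt_exp.2 ?_) hz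
      rw [← add_div]
      gcongr
      linarith
  have h1 := Real.log_lt_log (sum_exp_mul_pos _ hμ) key
  rw [Real.log_mul (Real.exp_pos _).ne' (sum_exp_mul_pos _ hμ).ne', Real.log_exp] at h1
  have h2 := mul_lt_mul_of_pos_left h1 hε
  rw [mul_add, mul_div_cancel₀ _ hε.ne'] at h2
  simp only [sinkhornMap]
  linarith

theorem sinkhornMap_sub_const (hε : 0 < ε) {f μ : X → ℝ} (hμ : μ ∈ stdSimplex ℝ X) (κ : ℝ) (y : X) :
    sinkhornMap ε c (fun x => f x - κ) μ y = sinkhornMap ε c f μ y + κ := by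
  have h1 := sinkhornMap_le_add (c := c) hε hμ (f := f) (f' := fun x => f x - κ) (M := κ)
    (fun x => by simp) y
  have h2 := sinkhornMap_le_add (c := c) hε hμ (f' := f) (f := fun x => f x - κ) (M := -κ)
    (fun x => by simp [sub_eq_add_neg]) y
  linarith

/-- The oscillation of a function on a finite nonempty type. -/
noncomputable def osc [Nonempty X] (h : X → ℝ) : ℝ :=
  Finset.univ.sup' Finset.univ_nonempty h - Finset.univ.inf' Finset.univ_nonempty h

theorem sub_le_osc [Nonempty X] (h : X → ℝ) (x y : X) : h x - h y ≤ osc h := by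
  have h1 := Finset.le_sup' h (Finset.mem_univ x)
  have h2 := Finset.inf'_le h (Finset.mem_univ y)
  unfold osc
  linarith

theorem exists_osc_eq [Nonempty X] (h : X → ℝ) : ∃ x y, osc h = h x - h y := by
  obtain ⟨x, -, hx⟩ := Finset.exists_mem_eq_sup' Finset.univ_nonempty h
  obtain ⟨y, -, hy⟩ := Finset.exists_mem_eq_inf' Finset.univ_nonempty h
  exact ⟨x, y, by rw [osc, hx, hy]⟩

theorem continuous_osc [Nonempty X] : Continuous (osc : (X → ℝ) → ℝ) := by
  unfold osc
  refine Continuous.sub ?_ ?_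
  · exact Continuous.finset_sup'_apply _ fun i _ => continuous_apply i
  · exact Continuous.finset_inf'_apply _ fun i _ => continuous_apply i

/-- The Sinkhorn mapping does not expand the oscillation of a difference of potentials. -/
theorem osc_sinkhornMap_sub_le [Nonempty X] (hε : 0 < ε) {μ : X → ℝ} (hμ : μ ∈ stdSimplex ℝ X)
    (f f' : X → ℝ) :
    osc (sinkhornMap ε c f μ - sinkhornMap ε c f' μ) ≤ osc (f - f') := by
  obtain ⟨x, y, hxy⟩ := exists_osc_eq (sinkhornMap ε c f μ - sinkhornMap ε c f' μ)
  obtain ⟨a, b, hab⟩ := exists_osc_eq (f - f')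
  have h1 := sinkhornMap_le_add (c := c) hε hμ (f := f) (f' := f') (M := f a - f' a)
    (fun z => by
      have := sub_le_osc (f - f') z b; simp only [hab, Pi.sub_apply] at this; linarith) y
  have h2 := sinkhornMap_le_add (c := c) hε hμ (f := f') (f' := f) (M := -(f b - f' b))
    (fun z => by
      have := sub_le_osc (f - f') a z; simp only [hab, Pi.sub_apply] at this; linarith) x
  rw [hxy, hab]
  simp only [Pi.sub_apply]
  linarith

/-- The Sinkhorn map strictly decreases the oscillation of differences, because it averages with
weights that are positive on the support of `μ`. -/
theorem osc_sinkhornMap_sub_lt [Nonempty X] (hε : 0 < ε) {μ : X → ℝ} (hμ : μ ∈ stdSimplex ℝ X)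
    {f f' : X → ℝ} (h : 0 < osc (f - f')) :
    osc (sinkhornMap ε c f μ - sinkhornMap ε c f' μ) < osc (f - f') := by
  obtain ⟨x, y, hxy⟩ := exists_osc_eq (sinkhornMap ε c f μ - sinkhornMap ε c f' μ)
  obtain ⟨a, b, hab⟩ := exists_osc_eq (f - f')
  have ha : ∀ z, f z ≤ f' z + (f a - f' a) := fun z => by
      have := sub_le_osc (f - f') z b; simp only [hab, Pi.sub_apply] at this; linarith
  have hb : ∀ z, f' z ≤ f z + -(f b - f' b) := fun z => by
      have := sub_le_osc (f - f') a z; simp only [hab, Pi.sub_apply] at this; linarith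
  have h1 := sinkhornMap_le_add (c := c) hε hμ ha y
  have h2 := sinkhornMap_le_add (c := c) hε hμ hb x
  rw [hxy, hab]
  rw [hab] at h
  simp only [Pi.sub_apply] at h ⊢
  by_cases hs : ∃ z, 0 < μ z ∧ f z < f' z + (f a - f' a)
  · have := sinkhornMap_lt_add (c := c) hε hμ ha hs y
    linarith
  · obtain ⟨z, hz⟩ := exists_pos_of_mem_stdSimplex hμ
    have := sinkhornMap_lt_add (c := c) hε hμ hb ⟨z, hz, by
      push Not at hs
      have := hs z hz
      linarith⟩ x
    linarith

theorem continuous_sinkhornMap {μ : X → ℝ} (hμ : μ ∈ stdSimplex ℝ X) :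
    Continuous fun f => sinkhornMap ε c f μ := by
  refine continuous_pi fun y => ?_
  unfold sinkhornMap
  refine continuous_const.mul (Continuous.log ?_ fun f => (sum_exp_mul_pos _ hμ).ne')
  fun_prop

/-- An upper bound for the cost. -/
theorem exists_cost_bound (c : X → X → ℝ) : ∃ M : ℝ, 0 < M ∧ ∀ x y, |c x y| ≤ M := by
  obtain ⟨M, hM⟩ := (Set.finite_range fun p : X × X => |c p.1 p.2|).bddAbove
  refine ⟨max M 1, by positivity, fun x y => le_max_of_le_left (hM ⟨(x, y), rfl⟩)⟩

/-- Whatever the potential, the oscillation of its image under the Sinkhorn mapping is bounded by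
that of the cost: this compactness yields fixed points and uniform bounds. -/
theorem sinkhornMap_sub_le (hε : 0 < ε) {M : ℝ} (hM : ∀ x y, |c x y| ≤ M) {f μ : X → ℝ}
    (hμ : μ ∈ stdSimplex ℝ X) (y y' : X) :
    sinkhornMap ε c f μ y ≤ sinkhornMap ε c f μ y' + 2 * M := by
  have h := sinkhornMap_le_add (c := fun _ _ => 0) (f := fun x => f x - c x y')
    (f' := fun x => f x - c x y) (M := 2 * M) hε hμ
    (fun x => by have := abs_le.1 (hM x y); have := abs_le.1 (hM x y'); linarith) y
  simpa [sinkhornMap] using h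

/-- Existence for the Schrödinger system: the composition of the two Sinkhorn maps strictly
decreases the oscillation of differences and, up to constants, maps a compact set into itself. -/
theorem exists_isSchrodingerPair (hε : 0 < ε) (hc : ∀ x y, c x y = c y x) {μ ν : X → ℝ}
    (hμ : μ ∈ stdSimplex ℝ X) (hν : ν ∈ stdSimplex ℝ X) :
    ∃ f g, IsSchrodingerPair ε c μ ν f g := by
  obtain ⟨x₀, -⟩ := exists_pos_of_mem_stdSimplex hμ
  have : Nonempty X := ⟨x₀⟩
  obtain ⟨M, hM0, hM⟩ := exists_cost_bound c
  set Φ : (X → ℝ) → (X → ℝ) := fun f => sinkhornMap ε c (sinkhornMap ε c f μ) ν with hΦ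
  have hΦc : Continuous Φ := (continuous_sinkhornMap hν).comp (continuous_sinkhornMap hμ)
  set K : Set (X → ℝ) := Set.Icc (fun _ => -(2 * M)) (fun _ => 2 * M) with hK
  have hKc : IsCompact K := isCompact_Icc
  have hKne : K.Nonempty := ⟨fun _ => 0, fun x => by simp; positivity, fun x => by simp; positivity⟩
  obtain ⟨f, hfK, hf⟩ := hKc.exists_isMinOn hKne
    (f := fun f => osc (Φ f - f)) (continuous_osc.comp (hΦc.sub continuous_id)).continuousOn
  have hshift : ∀ (f : X → ℝ) (κ : ℝ), Φ (fun x => f x - κ) = fun x => Φ f x - κ := by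
    intro f κ
    funext x
    have : sinkhornMap ε c (fun x => f x - κ) μ = fun y => sinkhornMap ε c f μ y - (-κ) := by
      funext y; rw [sinkhornMap_sub_const hε hμ]; ring
    simp only [hΦ, this]
    rw [sinkhornMap_sub_const hε hν]; ring
  have hosc : osc (Φ f - f) ≤ 0 := by
    by_contra! hpos
    set f' : X → ℝ := fun x => Φ f x - Φ f x₀ with hf'
    have hf'K : f' ∈ K := by
      constructor
      · intro x
        have := sinkhornMap_sub_le hε hM hν (f := sinkhornMap ε c f μ) x₀ x
        simp only [hf', hΦ]; linarith
      · intro x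
        have := sinkhornMap_sub_le hε hM hν (f := sinkhornMap ε c f μ) x x₀
        simp only [hf', hΦ]; linarith
    have h1 : osc (Φ f - f) ≤ osc (Φ f' - f') := hf hf'K
    have h2 : Φ f' - f' = Φ (Φ f) - Φ f := by
      rw [hf', hshift]; funext x; simp
    rw [h2] at h1
    have h3 : osc (Φ (Φ f) - Φ f) < osc (Φ f - f) :=
      (osc_sinkhornMap_sub_le hε hν _ _).trans_lt (osc_sinkhornMap_sub_lt hε hμ hpos)
    linarith
  obtain ⟨κ, hκ⟩ : ∃ κ, ∀ x, Φ f x = f x + κ := by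
    refine ⟨Φ f x₀ - f x₀, fun x => ?_⟩
    have h1 := sub_le_osc (Φ f - f) x x₀
    have h2 := sub_le_osc (Φ f - f) x₀ x
    simp only [Pi.sub_apply] at h1 h2
    linarith
  set g := sinkhornMap ε c f μ with hg
  have hg1 := (eq_sinkhornMap_iff hε hc hμ).1 hg
  have hf1 := (eq_sinkhornMap_iff (f := Φ f) (g := g) hε hc hν).1 rfl
  have hκ0 : κ = 0 := by
    have e1 : ∑ y, ∑ x, Real.exp ((g y + f x - c y x) / ε) * μ x * ν y = 1 := by
      simp_rw [← Finset.sum_mul, hg1, one_mul, hν.2]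
    have e2 : ∑ x, ∑ y, Real.exp ((Φ f x + g y - c x y) / ε) * ν y * μ x = 1 := by
      simp_rw [← Finset.sum_mul, hf1, one_mul, hμ.2]
    have e3 : ∑ x, ∑ y, Real.exp ((Φ f x + g y - c x y) / ε) * ν y * μ x
        = Real.exp (κ / ε) * ∑ y, ∑ x, Real.exp ((g y + f x - c y x) / ε) * μ x * ν y := by
      rw [Finset.sum_comm, Finset.mul_sum]
      refine Finset.sum_congr rfl fun y _ => ?_
      rw [Finset.mul_sum]
      refine Finset.sum_congr rfl fun x _ => ?_
      rw [hκ, hc y x, show (f x + κ + g y - c x y) / ε = κ / ε + (g y + f x - c x y) / ε by ring,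
        Real.exp_add]
      ring
    rw [e1, e2, mul_one] at e3
    have := Real.exp_eq_one_iff _ |>.1 e3.symm
    field_simp at this
    simpa using this
  have hfix : f = sinkhornMap ε c g ν := by
    funext x
    have := hκ x
    rw [hκ0, add_zero] at this
    exact this.symm
  set κ' : ℝ := (∑ x, μ x * f x - ∑ x, ν x * g x) / 2 with hκ'
  refine ⟨fun x => f x - κ', fun x => g x - (-κ'), ?_, ?_, ?_⟩
  · funext x
    rw [sinkhornMap_sub_const hε hν, ← hfix]
    ring
  · funext x
    rw [sinkhornMap_sub_const hε hμ, ← hg]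
    ring
  · simp only [mul_sub, Finset.sum_sub_distrib, ← Finset.sum_mul, hμ.2, hν.2]
    rw [hκ']
    ring

theorem IsSchrodingerPair.swap {μ ν f g : X → ℝ} (h : IsSchrodingerPair ε c μ ν f g) :
    IsSchrodingerPair ε c ν μ g f :=
  ⟨h.snd_eq, h.fst_eq, h.normalized.symm⟩

theorem IsSchrodingerPair.unique (hε : 0 < ε) {μ ν f g f' g' : X → ℝ}
    (hμ : μ ∈ stdSimplex ℝ X) (hν : ν ∈ stdSimplex ℝ X)
    (h : IsSchrodingerPair ε c μ ν f g) (h' : IsSchrodingerPair ε c μ ν f' g') :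
    f = f' ∧ g = g' := by
  obtain ⟨x₀, -⟩ := exists_pos_of_mem_stdSimplex hμ
  have : Nonempty X := ⟨x₀⟩
  have hosc : osc (f - f') ≤ 0 := by
    by_contra! hpos
    have h1 := osc_sinkhornMap_sub_lt (c := c) hε hμ hpos
    have h2 := osc_sinkhornMap_sub_le (c := c) hε hν (sinkhornMap ε c f μ) (sinkhornMap ε c f' μ)
    rw [← h.snd_eq, ← h'.snd_eq, ← h.fst_eq, ← h'.fst_eq] at h2
    rw [← h.snd_eq, ← h'.snd_eq] at h1
    linarith
  obtain ⟨κ, hκ⟩ : ∃ κ, ∀ x, f' x = f x - κ := by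
    refine ⟨f x₀ - f' x₀, fun x => ?_⟩
    have h1 := sub_le_osc (f - f') x x₀
    have h2 := sub_le_osc (f - f') x₀ x
    simp only [Pi.sub_apply] at h1 h2
    linarith
  have hg : ∀ x, g' x = g x + κ := by
    intro x
    rw [h'.snd_eq, funext hκ, sinkhornMap_sub_const hε hμ, ← h.snd_eq]
  have h1 := h'.normalized
  simp only [hκ, hg, mul_sub, mul_add, Finset.sum_sub_distrib, Finset.sum_add_distrib,
    ← Finset.sum_mul, hμ.2, hν.2] at h1
  have hκ0 : κ = 0 := by linarith [h.normalized]
  exact ⟨funext fun x => by rw [hκ, hκ0, sub_zero], funext fun x => by rw [hg, hκ0, add_zero]⟩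

/-- The second component of the normalized solution of the Schrödinger system for `(μ, ν)` is the
potential of `(ν, μ)`. -/
theorem isSchrodingerPair_schrodingerPotential (hε : 0 < ε) (hc : ∀ x y, c x y = c y x)
    {μ ν : X → ℝ} (hμ : μ ∈ stdSimplex ℝ X) (hν : ν ∈ stdSimplex ℝ X) :
    IsSchrodingerPair ε c μ ν (schrodingerPotential ε c μ ν) (schrodingerPotential ε c ν μ) := by
  obtain ⟨g, hg⟩ : ∃ g, IsSchrodingerPair ε c μ ν (schrodingerPotential ε c μ ν) g :=
    Classical.epsilon_spec (exists_isSchrodingerPair hε hc hμ hν)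
  obtain ⟨f, hf⟩ : ∃ f, IsSchrodingerPair ε c ν μ (schrodingerPotential ε c ν μ) f :=
    Classical.epsilon_spec (exists_isSchrodingerPair hε hc hν hμ)
  rw [← (hg.unique hε hμ hν hf.swap).2]
  exact hg

theorem IsSchrodingerPair.eq_schrodingerPotential (hε : 0 < ε) (hc : ∀ x y, c x y = c y x)
    {μ ν f g : X → ℝ} (hμ : μ ∈ stdSimplex ℝ X) (hν : ν ∈ stdSimplex ℝ X)
    (h : IsSchrodingerPair ε c μ ν f g) : schrodingerPotential ε c μ ν = f :=
  ((isSchrodingerPair_schrodingerPotential hε hc hμ hν).unique hε hμ hν h).1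

theorem selfPotential_eq (hε : 0 < ε) (hc : ∀ x y, c x y = c y x) {μ : X → ℝ}
    (hμ : μ ∈ stdSimplex ℝ X) :
    selfPotential ε c μ = sinkhornMap ε c (selfPotential ε c μ) μ :=
  (isSchrodingerPair_schrodingerPotential hε hc hμ hμ).fst_eq

/-- A fixed point of the Sinkhorn mapping is automatically normalized, so it is the self-transport
potential. -/
theorem eq_selfPotential (hε : 0 < ε) (hc : ∀ x y, c x y = c y x) {μ f : X → ℝ}
    (hμ : μ ∈ stdSimplex ℝ X) (hf : f = sinkhornMap ε c f μ) : selfPotential ε c μ = f :=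
  IsSchrodingerPair.eq_schrodingerPotential hε hc hμ hμ ⟨hf, hf, rfl⟩

theorem IsSchrodingerPair.abs_le (hε : 0 < ε) (hc : ∀ x y, c x y = c y x) {M : ℝ}
    (hM : ∀ x y, |c x y| ≤ M) {μ ν f g : X → ℝ} (hμ : μ ∈ stdSimplex ℝ X)
    (hν : ν ∈ stdSimplex ℝ X) (h : IsSchrodingerPair ε c μ ν f g) (x : X) : |f x| ≤ 4 * M := by
  have hf : ∀ y y', f y ≤ f y' + 2 * M := fun y y' => by
    have := sinkhornMap_sub_le hε hM hν (f := g) y y'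
    rwa [← h.fst_eq] at this
  -- `f ⊕ g` is bounded above and below since `exp ((f ⊕ g - c) / ε)` has average one
  have hfg1 := (eq_sinkhornMap_iff hε hc hν).1 h.fst_eq x
  have hg : ∀ y y', g y ≤ g y' + 2 * M := fun y y' => by
    have := sinkhornMap_sub_le hε hM hμ (f := f) y y'
    rwa [← h.snd_eq] at this
  have up : ∃ y, f x + g y - c x y ≤ 0 := by
    by_contra! hcon
    have : ∑ y, Real.exp ((f x + g y - c x y) / ε) * ν y > ∑ y, ν y := by
      obtain ⟨y, hy⟩ := exists_pos_of_mem_stdSimplex hν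
      refine Finset.sum_lt_sum (fun z _ => ?_) ⟨y, Finset.mem_univ y, ?_⟩
      · exact le_mul_of_one_le_left (hν.1 z) (Real.one_le_exp (div_pos (hcon z) hε).le)
      · exact lt_mul_of_one_lt_left hy (Real.one_lt_exp_iff.2 (div_pos (hcon y) hε))
    rw [hfg1, hν.2] at this
    exact lt_irrefl _ this
  have lo : ∃ y, 0 ≤ f x + g y - c x y := by
    by_contra! hcon
    have : ∑ y, Real.exp ((f x + g y - c x y) / ε) * ν y < ∑ y, ν y := by
      obtain ⟨y, hy⟩ := exists_pos_of_mem_stdSimplex hν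
      refine Finset.sum_lt_sum (fun z _ => ?_) ⟨y, Finset.mem_univ y, ?_⟩
      · exact mul_le_of_le_one_left (hν.1 z)
          (Real.exp_le_one_iff.2 (div_neg_of_neg_of_pos (hcon z) hε).le)
      · exact mul_lt_of_lt_one_left hy (Real.exp_lt_one_iff.2 (div_neg_of_neg_of_pos (hcon y) hε))
    rw [hfg1, hν.2] at this
    exact lt_irrefl _ this
  obtain ⟨y, hy⟩ := up
  obtain ⟨y', hy'⟩ := lo
  have hc1 := _root_.abs_le.1 (hM x y)
  have hc2 := _root_.abs_le.1 (hM x y')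
  have m1 : ∑ z, μ z * f z ≤ f x + 2 * M := by
    calc ∑ z, μ z * f z ≤ ∑ z, μ z * (f x + 2 * M) :=
          Finset.sum_le_sum fun z _ => mul_le_mul_of_nonneg_left (hf z x) (hμ.1 z)
      _ = _ := by rw [← Finset.sum_mul, hμ.2, one_mul]
  have m2 : f x - 2 * M ≤ ∑ z, μ z * f z := by
    calc f x - 2 * M = ∑ z, μ z * (f x - 2 * M) := by rw [← Finset.sum_mul, hμ.2, one_mul]
      _ ≤ _ := Finset.sum_le_sum fun z _ =>
        mul_le_mul_of_nonneg_left (by linarith [hf x z]) (hμ.1 z)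
  have m3 : ∑ z, ν z * g z ≤ g y + 2 * M := by
    calc ∑ z, ν z * g z ≤ ∑ z, ν z * (g y + 2 * M) :=
          Finset.sum_le_sum fun z _ => mul_le_mul_of_nonneg_left (hg z y) (hν.1 z)
      _ = _ := by rw [← Finset.sum_mul, hν.2, one_mul]
  have m4 : g y' - 2 * M ≤ ∑ z, ν z * g z := by
    calc g y' - 2 * M = ∑ z, ν z * (g y' - 2 * M) := by rw [← Finset.sum_mul, hν.2, one_mul]
      _ ≤ _ := Finset.sum_le_sum fun z _ =>
        mul_le_mul_of_nonneg_left (by linarith [hg y' z]) (hν.1 z)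
  have := h.normalized
  rw [_root_.abs_le]
  constructor <;> linarith

/-- The normalized Schrödinger potentials depend continuously on the marginals. -/
theorem continuousOn_schrodingerPotential (hε : 0 < ε) (hc : ∀ x y, c x y = c y x) :
    ContinuousOn (fun p : (X → ℝ) × (X → ℝ) => schrodingerPotential ε c p.1 p.2)
      (stdSimplex ℝ X ×ˢ stdSimplex ℝ X) := by
  obtain ⟨M, hM0, hM⟩ := exists_cost_bound c
  set K : Set (X → ℝ) := Set.Icc (fun _ => -(4 * M)) (fun _ => 4 * M) with hK
  have hKc : IsCompact K := isCompact_Icc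
  have hmem : ∀ μ ν : X → ℝ, μ ∈ stdSimplex ℝ X → ν ∈ stdSimplex ℝ X →
      schrodingerPotential ε c μ ν ∈ K := by
    intro μ ν hμ hν
    have := fun x => _root_.abs_le.1
      ((isSchrodingerPair_schrodingerPotential hε hc hμ hν).abs_le hε hc hM hμ hν x)
    exact ⟨fun x => (this x).1, fun x => (this x).2⟩
  rintro ⟨μ, ν⟩ ⟨hμ, hν⟩
  simp only at hμ hν
  rw [ContinuousWithinAt, tendsto_iff_seq_tendsto]
  intro u hu
  refine tendsto_of_subseq_tendsto fun ns hns => ?_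
  have hu' := hu.comp hns
  have hu1 : Tendsto (fun n => u (ns n)) atTop (𝓝 (μ, ν)) := hu'.mono_right nhdsWithin_le_nhds
  have hu2 : ∀ᶠ n in atTop, u (ns n) ∈ stdSimplex ℝ X ×ˢ stdSimplex ℝ X :=
    hu'.eventually self_mem_nhdsWithin
  obtain ⟨N, hN⟩ := eventually_atTop.1 hu2
  obtain ⟨⟨f, g⟩, -, φ, hφ, hlim⟩ := (hKc.prod hKc).tendsto_subseq
    (x := fun n => (schrodingerPotential ε c (u (ns (n + N))).1 (u (ns (n + N))).2,
      schrodingerPotential ε c (u (ns (n + N))).2 (u (ns (n + N))).1))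
    (fun n => ⟨hmem _ _ (hN _ (by lia)).1 (hN _ (by lia)).2,
      hmem _ _ (hN _ (by lia)).2 (hN _ (by lia)).1⟩)
  refine ⟨fun n => φ n + N, ?_⟩
  have hu3 : Tendsto (fun n => u (ns (φ n + N))) atTop (𝓝 (μ, ν)) :=
    hu1.comp ((tendsto_add_atTop_nat N).comp hφ.tendsto_atTop)
  have hμl : ∀ x, Tendsto (fun n => (u (ns (φ n + N))).1 x) atTop (𝓝 (μ x)) := fun x =>
    ((continuous_apply x).comp continuous_fst).continuousAt.tendsto.comp hu3
  have hνl : ∀ x, Tendsto (fun n => (u (ns (φ n + N))).2 x) atTop (𝓝 (ν x)) := fun x =>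
    ((continuous_apply x).comp continuous_snd).continuousAt.tendsto.comp hu3
  have hfl : ∀ x, Tendsto (fun n => schrodingerPotential ε c (u (ns (φ n + N))).1
      (u (ns (φ n + N))).2 x) atTop (𝓝 (f x)) := fun x =>
    ((continuous_apply x).comp continuous_fst).continuousAt.tendsto.comp hlim
  have hgl : ∀ x, Tendsto (fun n => schrodingerPotential ε c (u (ns (φ n + N))).2
      (u (ns (φ n + N))).1 x) atTop (𝓝 (g x)) := fun x =>
    ((continuous_apply x).comp continuous_snd).continuousAt.tendsto.comp hlim
  have hpair : IsSchrodingerPair ε c μ ν f g := by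
    have hp := fun n => isSchrodingerPair_schrodingerPotential hε hc
      (hN (φ n + N) (by lia)).1 (hN (φ n + N) (by lia)).2
    refine ⟨(eq_sinkhornMap_iff hε hc hν).2 fun x => ?_,
      (eq_sinkhornMap_iff hε hc hμ).2 fun x => ?_, ?_⟩
    · refine tendsto_nhds_unique (tendsto_finsetSum _ fun y _ =>
        ((Real.continuous_exp.tendsto _).comp
        (((hfl x).add (hgl y)).sub_const (c x y) |>.div_const ε)).mul (hνl y)) ?_
      exact tendsto_const_nhds.congr fun n =>
        ((eq_sinkhornMap_iff hε hc (hN (φ n + N) (by lia)).2).1 (hp n).fst_eq x).symm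
    · refine tendsto_nhds_unique (tendsto_finsetSum _ fun y _ =>
        ((Real.continuous_exp.tendsto _).comp
        (((hgl x).add (hfl y)).sub_const (c x y) |>.div_const ε)).mul (hμl y)) ?_
      exact tendsto_const_nhds.congr fun n =>
        ((eq_sinkhornMap_iff hε hc (hN (φ n + N) (by lia)).1).1 (hp n).snd_eq x).symm
    · refine tendsto_nhds_unique (tendsto_finsetSum _ fun y _ => (hμl y).mul (hfl y)) ?_
      exact (tendsto_finsetSum _ fun y _ => (hνl y).mul (hgl y)).congr fun n =>
        (hp n).normalized.symm
  simp only [Function.comp]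
  rw [hpair.eq_schrodingerPotential hε hc hμ hν]
  exact (continuous_fst.continuousAt.tendsto.comp hlim)

end Schrodinger

/-! ### Duality for entropic optimal transport and the Sinkhorn divergence -/

section Duality

variable {X : Type*} [Fintype X] {ε : ℝ} {c : X → X → ℝ}

/-- The Fenchel–Young inequality for the entropy. -/
theorem le_mul_log_div {a b : ℝ} (ha : 0 ≤ a) (hb : 0 ≤ b) (hab : b = 0 → a = 0) (t : ℝ) :
    a * t + a - b * Real.exp t ≤ a * Real.log (a / b) := by
  rcases ha.eq_or_lt with rfl | ha
  · simpa using mul_nonneg hb (Real.exp_pos t).le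
  have hb' : 0 < b := lt_of_le_of_ne hb fun h => ha.ne' (hab h.symm)
  have h1 := Real.log_le_sub_one_of_pos (x := b * Real.exp t / a) (by positivity)
  rw [Real.log_div (by positivity) ha.ne', Real.log_mul hb'.ne' (Real.exp_pos t).ne',
    Real.log_exp] at h1
  rw [Real.log_div ha.ne' hb'.ne']
  have h2 := mul_le_mul_of_nonneg_left h1 ha.le
  have h3 : a * (b * Real.exp t / a - 1) = b * Real.exp t - a := by field_simp
  rw [h3] at h2
  linarith

theorem eq_zero_of_mem_couplings {μ ν : X → ℝ} {π : X → X → ℝ} (hπ : π ∈ couplings μ ν) {x y : X}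
    (h : μ x * ν y = 0) : π x y = 0 := by
  rcases mul_eq_zero.1 h with h | h
  · have := hπ.2.1 x
    rw [h, Finset.sum_eq_zero_iff_of_nonneg fun y _ => hπ.1 x y] at this
    exact this y (Finset.mem_univ y)
  · have := hπ.2.2 y
    rw [h, Finset.sum_eq_zero_iff_of_nonneg fun x _ => hπ.1 x y] at this
    exact this x (Finset.mem_univ x)

/-- The objective of entropic optimal transport. -/
noncomputable def transportCost (ε : ℝ) (c : X → X → ℝ) (μ ν : X → ℝ) (π : X → X → ℝ) : ℝ :=
  (∑ x, ∑ y, c x y * π x y) + ε * klCoupling π μ ν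

theorem sum_coupling_mul_add {μ ν : X → ℝ} {π : X → X → ℝ} (hπ : π ∈ couplings μ ν)
    (f g : X → ℝ) :
    ∑ x, ∑ y, π x y * (f x + g y) = ∑ x, μ x * f x + ∑ y, ν y * g y := by
  simp_rw [mul_add, Finset.sum_add_distrib]
  congr 1
  · exact Finset.sum_congr rfl fun x _ => by rw [← Finset.sum_mul, hπ.2.1]
  · rw [Finset.sum_comm]
    exact Finset.sum_congr rfl fun x _ => by rw [← Finset.sum_mul, hπ.2.2]

/-- Weak duality. -/
theorem dual_le_transportCost (hε : 0 < ε) {μ ν : X → ℝ} (hμ : μ ∈ stdSimplex ℝ X)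
    (hν : ν ∈ stdSimplex ℝ X) {π : X → X → ℝ} (hπ : π ∈ couplings μ ν) (f g : X → ℝ) :
    ∑ x, μ x * f x + ∑ y, ν y * g y
      - ε * (∑ x, ∑ y, Real.exp ((f x + g y - c x y) / ε) * (μ x * ν y) - 1)
      ≤ transportCost ε c μ ν π := by
  have hterm : ∀ x y, π x y * (f x + g y) + ε * π x y
      - ε * (Real.exp ((f x + g y - c x y) / ε) * (μ x * ν y))
      ≤ c x y * π x y + ε * (π x y * Real.log (π x y / (μ x * ν y))) := by
    intro x y
    have h := le_mul_log_div (hπ.1 x y) (mul_nonneg (hμ.1 x) (hν.1 y))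
      (eq_zero_of_mem_couplings hπ) ((f x + g y - c x y) / ε)
    have h2 := mul_le_mul_of_nonneg_left h hε.le
    have h3 : ε * (π x y * ((f x + g y - c x y) / ε)) = π x y * (f x + g y) - c x y * π x y := by
      field_simp
    rw [mul_sub, mul_add, h3] at h2
    linarith
  have hsum := Finset.sum_le_sum fun x (_ : x ∈ Finset.univ) =>
    Finset.sum_le_sum fun y (_ : y ∈ Finset.univ) => hterm x y
  simp only [Finset.sum_sub_distrib, Finset.sum_add_distrib, ← Finset.mul_sum] at hsum
  have h1 : ∑ x, ∑ y, π x y = 1 := by simp_rw [hπ.2.1, hμ.2]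
  have h2 := sum_coupling_mul_add hπ f g
  rw [h1, h2] at hsum
  unfold transportCost klCoupling
  linarith

theorem IsSchrodingerPair.coupling (hε : 0 < ε) (hc : ∀ x y, c x y = c y x) {μ ν f g : X → ℝ}
    (hμ : μ ∈ stdSimplex ℝ X) (hν : ν ∈ stdSimplex ℝ X) (h : IsSchrodingerPair ε c μ ν f g) :
    (fun x y => Real.exp ((f x + g y - c x y) / ε) * (μ x * ν y)) ∈ couplings μ ν := by
  refine ⟨fun x y => mul_nonneg (Real.exp_pos _).le (mul_nonneg (hμ.1 x) (hν.1 y)),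
    fun x => ?_, fun y => ?_⟩
  · have := (eq_sinkhornMap_iff hε hc hν).1 h.fst_eq x
    calc _ = ∑ y, Real.exp ((f x + g y - c x y) / ε) * ν y * μ x :=
          Finset.sum_congr rfl fun y _ => by ring
      _ = μ x := by rw [← Finset.sum_mul, this, one_mul]
  · have := (eq_sinkhornMap_iff hε hc hμ).1 h.snd_eq y
    calc _ = ∑ x, Real.exp ((g y + f x - c y x) / ε) * μ x * ν y :=
          Finset.sum_congr rfl fun x _ => by
            show Real.exp ((f x + g y - c x y) / ε) * (μ x * ν y) = _
            rw [hc x y, add_comm (f x)]; ring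
      _ = ν y := by rw [← Finset.sum_mul, this, one_mul]

/-- The coupling of a Schrödinger pair attains equality in weak duality, so it is optimal. -/
theorem IsSchrodingerPair.isLeast (hε : 0 < ε) (hc : ∀ x y, c x y = c y x) {μ ν f g : X → ℝ}
    (hμ : μ ∈ stdSimplex ℝ X) (hν : ν ∈ stdSimplex ℝ X) (h : IsSchrodingerPair ε c μ ν f g) :
    IsLeast (transportCost ε c μ ν '' couplings μ ν) (∑ x, μ x * f x + ∑ y, ν y * g y) := by
  have hπ := h.coupling hε hc hμ hν
  have h1 : ∑ x, ∑ y, Real.exp ((f x + g y - c x y) / ε) * (μ x * ν y) = 1 := by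
    simp_rw [hπ.2.1, hμ.2]
  constructor
  · refine ⟨_, hπ, ?_⟩
    rw [← sum_coupling_mul_add hπ f g, transportCost, klCoupling, Finset.mul_sum,
      ← Finset.sum_add_distrib]
    refine Finset.sum_congr rfl fun x _ => ?_
    rw [Finset.mul_sum, ← Finset.sum_add_distrib]
    refine Finset.sum_congr rfl fun y _ => ?_
    by_cases h0 : μ x * ν y = 0
    · simp [h0]
    · rw [mul_div_cancel_right₀ _ h0, Real.log_exp]
      field_simp
      ring
  · rintro _ ⟨π, hπ', rfl⟩
    have := dual_le_transportCost (c := c) hε hμ hν hπ' f g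
    rw [h1] at this
    linarith

theorem IsSchrodingerPair.entropicOT_eq (hε : 0 < ε) (hc : ∀ x y, c x y = c y x) {μ ν f g : X → ℝ}
    (hμ : μ ∈ stdSimplex ℝ X) (hν : ν ∈ stdSimplex ℝ X) (h : IsSchrodingerPair ε c μ ν f g) :
    entropicOT ε c μ ν = ∑ x, μ x * f x + ∑ y, ν y * g y :=
  (h.isLeast hε hc hμ hν).csInf_eq

/-- Weak duality, for arbitrary potentials: it bounds the transport cost from below by inserting
potentials of another pair of measures. -/
theorem dual_le_entropicOT (hε : 0 < ε) (hc : ∀ x y, c x y = c y x) {μ ν : X → ℝ}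
    (hμ : μ ∈ stdSimplex ℝ X) (hν : ν ∈ stdSimplex ℝ X) (f g : X → ℝ) :
    ∑ x, μ x * f x + ∑ y, ν y * g y
      - ε * (∑ x, ∑ y, Real.exp ((f x + g y - c x y) / ε) * (μ x * ν y) - 1)
      ≤ entropicOT ε c μ ν := by
  have h := isSchrodingerPair_schrodingerPotential hε hc hμ hν
  obtain ⟨π, hπ, hπ'⟩ := (h.isLeast hε hc hμ hν).1
  rw [h.entropicOT_eq hε hc hμ hν, ← hπ']
  exact dual_le_transportCost hε hμ hν hπ f g

theorem entropicOT_eq_schrodingerPotential (hε : 0 < ε) (hc : ∀ x y, c x y = c y x) {μ ν : X → ℝ}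
    (hμ : μ ∈ stdSimplex ℝ X) (hν : ν ∈ stdSimplex ℝ X) :
    entropicOT ε c μ ν =
      ∑ x, μ x * schrodingerPotential ε c μ ν x + ∑ y, ν y * schrodingerPotential ε c ν μ y :=
  (isSchrodingerPair_schrodingerPotential hε hc hμ hν).entropicOT_eq hε hc hμ hν

theorem entropicOT_self (hε : 0 < ε) (hc : ∀ x y, c x y = c y x) {μ : X → ℝ}
    (hμ : μ ∈ stdSimplex ℝ X) :
    entropicOT ε c μ μ = 2 * ∑ x, μ x * selfPotential ε c μ x := by
  rw [entropicOT_eq_schrodingerPotential hε hc hμ hμ, two_mul]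
  rfl

/-- Testing the dual problem with the two self-transport potentials bounds the Sinkhorn divergence
below. -/
theorem le_sinkhornDivergence (hε : 0 < ε) (hc : ∀ x y, c x y = c y x) {μ ν : X → ℝ}
    (hμ : μ ∈ stdSimplex ℝ X) (hν : ν ∈ stdSimplex ℝ X) :
    ε * (1 - ∑ x, ∑ y, Real.exp ((selfPotential ε c μ x + selfPotential ε c ν y - c x y) / ε)
      * (μ x * ν y)) ≤ sinkhornDivergence ε c μ ν := by
  have h := dual_le_entropicOT hε hc hμ hν (selfPotential ε c μ) (selfPotential ε c ν)
  rw [sinkhornDivergence, entropicOT_self hε hc hμ, entropicOT_self hε hc hν]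
  linarith

theorem sinkhornDivergence_self (μ : X → ℝ) : sinkhornDivergence ε c μ μ = 0 := by
  unfold sinkhornDivergence; ring

theorem continuousOn_entropicOT (hε : 0 < ε) (hc : ∀ x y, c x y = c y x) :
    ContinuousOn (fun p : (X → ℝ) × (X → ℝ) => entropicOT ε c p.1 p.2)
      (stdSimplex ℝ X ×ˢ stdSimplex ℝ X) := by
  have h1 := continuousOn_schrodingerPotential hε hc
  have h2 : ContinuousOn (fun p : (X → ℝ) × (X → ℝ) => schrodingerPotential ε c p.2 p.1)
      (stdSimplex ℝ X ×ˢ stdSimplex ℝ X) :=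
    h1.comp continuous_swap.continuousOn fun p hp => ⟨hp.2, hp.1⟩
  rw [continuousOn_pi] at h1 h2
  refine ContinuousOn.congr (f := fun p : (X → ℝ) × (X → ℝ) =>
    ∑ x, p.1 x * schrodingerPotential ε c p.1 p.2 x
      + ∑ y, p.2 y * schrodingerPotential ε c p.2 p.1 y) ?_
    fun p hp => entropicOT_eq_schrodingerPotential hε hc hp.1 hp.2
  refine ContinuousOn.add ?_ ?_
  · exact continuousOn_finsetSum _ fun x _ =>
      ((continuous_apply x).comp continuous_fst).continuousOn.mul (h1 x)
  · exact continuousOn_finsetSum _ fun x _ =>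
      ((continuous_apply x).comp continuous_snd).continuousOn.mul (h2 x)

theorem continuousOn_sinkhornDivergence (hε : 0 < ε) (hc : ∀ x y, c x y = c y x) {ν : X → ℝ}
    (hν : ν ∈ stdSimplex ℝ X) :
    ContinuousOn (fun μ => sinkhornDivergence ε c μ ν) (stdSimplex ℝ X) := by
  have h := continuousOn_entropicOT hε hc
  unfold sinkhornDivergence
  refine (ContinuousOn.sub ?_ ?_).sub continuousOn_const
  · exact h.comp (f := fun μ => (μ, ν)) (by fun_prop) fun μ hμ => ⟨hμ, hν⟩
  · exact (h.comp (f := fun μ => (μ, μ)) (by fun_prop) fun μ hμ => ⟨hμ, hμ⟩).div_const 2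

theorem exists_sjko_step (hε : 0 < ε) (hc : ∀ x y, c x y = c y x) (V : X → ℝ) (τ : ℝ)
    {ν : X → ℝ} (hν : ν ∈ stdSimplex ℝ X) :
    ∃ μ ∈ stdSimplex ℝ X, IsMinOn
      (fun ρ => potentialEnergy V ρ + 1 / (2 * τ) * sinkhornDivergence ε c ρ ν)
      (stdSimplex ℝ X) μ := by
  refine (isCompact_stdSimplex ℝ X).exists_isMinOn ⟨ν, hν⟩ (ContinuousOn.add ?_ ?_)
  · unfold potentialEnergy
    fun_prop
  · exact continuousOn_const.mul (continuousOn_sinkhornDivergence hε hc hν)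

theorem exists_isSJKO (hε : 0 < ε) (hc : ∀ x y, c x y = c y x) (V : X → ℝ) (τ : ℝ)
    {μ₀ : X → ℝ} (hμ₀ : μ₀ ∈ stdSimplex ℝ X) : ∃ μ : ℕ → X → ℝ, IsSJKO ε c V τ μ₀ μ := by
  choose! F hF hF' using fun ν (hν : ν ∈ stdSimplex ℝ X) => exists_sjko_step hε hc V τ hν
  let μ : ℕ → X → ℝ := fun k => F^[k] μ₀
  have hmem : ∀ k, μ k ∈ stdSimplex ℝ X := by
    intro k
    induction k with
    | zero => exact hμ₀
    | succ k ih => simp only [μ, Function.iterate_succ_apply']; exact hF _ ih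
  refine ⟨μ, rfl, fun k => ⟨hmem (k + 1), ?_⟩⟩
  have h : μ (k + 1) = F (μ k) := Function.iterate_succ_apply' F k μ₀
  rw [h]
  exact hF' _ (hmem k)

theorem IsSJKO.mem {V μ₀ : X → ℝ} {τ : ℝ} {μ : ℕ → X → ℝ} (h : IsSJKO ε c V τ μ₀ μ)
    (hμ₀ : μ₀ ∈ stdSimplex ℝ X) : ∀ k, μ k ∈ stdSimplex ℝ X
  | 0 => h.1 ▸ hμ₀
  | k + 1 => (h.2 k).1

/-- The first variation of the Sinkhorn divergence in its first argument is
`f_{μ,ν} - f_μ`; this is the upper bound on the increment along a segment. Here `μ_s` is the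
segment, and `f_{μ_s,ν}` is evaluated at its running point. -/
theorem sinkhornDivergence_segment_le (hε : 0 < ε) (hc : ∀ x y, c x y = c y x) {μ ν μs δ : X → ℝ}
    (hμ : μ ∈ stdSimplex ℝ X) (hν : ν ∈ stdSimplex ℝ X) {s : ℝ} (hμs : μs ∈ stdSimplex ℝ X)
    (hδ : ∀ x, μs x = μ x + s * δ x) :
    sinkhornDivergence ε c μs ν - sinkhornDivergence ε c μ ν ≤
      s * (∑ x, δ x * (schrodingerPotential ε c μs ν x - selfPotential ε c μ x)) +
      s ^ 2 * (ε / 2 * ∑ x, ∑ y, selfKernel ε c μ x y * (δ x * δ y)) := by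
  have hs := isSchrodingerPair_schrodingerPotential hε hc hμs hν
  have hself := selfPotential_eq hε hc hμ
  -- the potentials of `(μs, ν)` are feasible for `(μ, ν)`
  have h1 : ∑ x, ∑ y, Real.exp ((schrodingerPotential ε c μs ν x
      + schrodingerPotential ε c ν μs y - c x y) / ε) * (μ x * ν y) = 1 := by
    rw [← hμ.2]
    refine Finset.sum_congr rfl fun x _ => ?_
    have := (eq_sinkhornMap_iff hε hc hν).1 hs.fst_eq x
    calc _ = ∑ y, Real.exp ((schrodingerPotential ε c μs ν x
          + schrodingerPotential ε c ν μs y - c x y) / ε) * ν y * μ x :=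
          Finset.sum_congr rfl fun y _ => by ring
      _ = μ x := by rw [← Finset.sum_mul, this, one_mul]
  have h2 := dual_le_entropicOT hε hc hμ hν (schrodingerPotential ε c μs ν)
    (schrodingerPotential ε c ν μs)
  rw [h1] at h2
  have h3 := entropicOT_eq_schrodingerPotential hε hc hμs hν
  have h4 := dual_le_entropicOT hε hc hμs hμs (selfPotential ε c μ) (selfPotential ε c μ)
  have hrow : ∀ x, ∑ y, selfKernel ε c μ x y * μ y = 1 := (eq_sinkhornMap_iff hε hc hμ).1 hself
  have hsymm : ∀ x y, selfKernel ε c μ x y = selfKernel ε c μ y x := fun x y => by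
    unfold selfKernel; rw [hc x y, add_comm (selfPotential ε c μ x)]
  have hδ0 : s * ∑ x, δ x = 0 := by
    have : ∑ x, μs x = ∑ x, μ x + s * ∑ x, δ x := by
      rw [Finset.mul_sum, ← Finset.sum_add_distrib]
      exact Finset.sum_congr rfl fun x _ => hδ x
    rw [hμs.2, hμ.2] at this
    linarith
  -- the quadratic form of the self-transport kernel has no linear term along the segment
  have h5 : ∑ x, ∑ y, Real.exp ((selfPotential ε c μ x + selfPotential ε c μ y - c x y) / ε)
      * (μs x * μs y) = 1 + s ^ 2 * ∑ x, ∑ y, selfKernel ε c μ x y * (δ x * δ y) := by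
    have e1 : ∀ x, ∑ y, selfKernel ε c μ x y * (μs x * μs y) = μ x + 2 * (s * δ x)
        + ∑ y, s ^ 2 * (selfKernel ε c μ x y * (δ x * δ y))
        + (∑ y, selfKernel ε c μ x y * μ x * (s * δ y) - s * δ x) := by
      intro x
      have : ∀ y, selfKernel ε c μ x y * (μs x * μs y) = (selfKernel ε c μ x y * μ y) * μ x
          + (selfKernel ε c μ x y * μ y) * (s * δ x)
          + s ^ 2 * (selfKernel ε c μ x y * (δ x * δ y))
          + selfKernel ε c μ x y * μ x * (s * δ y) := fun y => by rw [hδ x, hδ y]; ring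
      simp only [this, Finset.sum_add_distrib, ← Finset.sum_mul, hrow]
      ring
    have e2 : ∑ x, ∑ y, selfKernel ε c μ x y * μ x * (s * δ y) = s * ∑ y, δ y := by
      rw [Finset.sum_comm, Finset.mul_sum]
      refine Finset.sum_congr rfl fun y _ => ?_
      rw [← Finset.sum_mul]
      simp_rw [hsymm _ y, hrow, one_mul]
    change ∑ x, ∑ y, selfKernel ε c μ x y * (μs x * μs y) = _
    simp only [e1, Finset.sum_add_distrib, Finset.sum_sub_distrib, e2, ← Finset.mul_sum, hδ0,
      hμ.2]
    ring
  rw [h5] at h4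
  have h6 : ∀ F : X → ℝ, ∑ x, μs x * F x = ∑ x, μ x * F x + s * ∑ x, δ x * F x := fun F => by
    rw [Finset.mul_sum, ← Finset.sum_add_distrib]
    exact Finset.sum_congr rfl fun x _ => by rw [hδ]; ring
  rw [h6] at h3
  rw [h6] at h4
  simp only [sinkhornDivergence, mul_sub, Finset.sum_sub_distrib]
  rw [entropicOT_self hε hc hμ, h3]
  linarith

/-- First-order optimality condition of one step of the scheme. -/
theorem sjko_variational (hε : 0 < ε) (hc : ∀ x y, c x y = c y x) {V : X → ℝ} {τ : ℝ} (hτ : 0 < τ)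
    {μ ν : X → ℝ} (hμ : μ ∈ stdSimplex ℝ X) (hν : ν ∈ stdSimplex ℝ X)
    (hmin : IsMinOn (fun ρ => potentialEnergy V ρ + 1 / (2 * τ) * sinkhornDivergence ε c ρ ν)
      (stdSimplex ℝ X) μ) {ρ : X → ℝ} (hρ : ρ ∈ stdSimplex ℝ X) :
    0 ≤ ∑ x, (ρ x - μ x) *
      (V x + 1 / (2 * τ) * (schrodingerPotential ε c μ ν x - selfPotential ε c μ x)) := by
  set δ : X → ℝ := fun x => ρ x - μ x with hδ
  set μs : ℝ → X → ℝ := fun s x => μ x + s * δ x with hμs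
  have hmem : ∀ s ∈ Icc (0 : ℝ) 1, μs s ∈ stdSimplex ℝ X := by
    intro s hs
    have := (convex_stdSimplex ℝ X) hμ hρ (a := 1 - s) (b := s) (by linarith [hs.2]) hs.1 (by ring)
    convert! this using 1
    funext x
    simp [hμs, hδ]; ring
  set Q : ℝ := ε / 2 * ∑ x, ∑ y, selfKernel ε c μ x y * (δ x * δ y) with hQ
  have hineq : ∀ s ∈ Ioc (0 : ℝ) 1, 0 ≤ ∑ x, δ x *
      (V x + 1 / (2 * τ) * (schrodingerPotential ε c (μs s) ν x - selfPotential ε c μ x))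
        + 1 / (2 * τ) * (s * Q) := by
    intro s hs
    have h1 := hmin (hmem s ⟨hs.1.le, hs.2⟩)
    simp only [Set.mem_ofPred_eq] at h1
    have h2 := sinkhornDivergence_segment_le hε hc hμ hν (hmem s ⟨hs.1.le, hs.2⟩) (δ := δ) (s := s)
      fun x => rfl
    have h3 : potentialEnergy V (μs s) = potentialEnergy V μ + s * ∑ x, δ x * V x := by
      unfold potentialEnergy
      rw [Finset.mul_sum, ← Finset.sum_add_distrib]
      exact Finset.sum_congr rfl fun x _ => by simp only [hμs]; ring
    rw [h3] at h1
    have h4 : (0 : ℝ) < 1 / (2 * τ) := by positivity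
    have h5 := mul_le_mul_of_nonneg_left h2 h4.le
    rw [← hQ] at h5
    set A := ∑ x, δ x * V x with hA
    set B := ∑ x, δ x * (schrodingerPotential ε c (μs s) ν x - selfPotential ε c μ x) with hB
    have h6 : 0 ≤ s * (A + 1 / (2 * τ) * B + 1 / (2 * τ) * (s * Q)) := by
      nlinarith
    have h7 := nonneg_of_mul_nonneg_right h6 hs.1
    have h8 : A + 1 / (2 * τ) * B = ∑ x, δ x *
        (V x + 1 / (2 * τ) * (schrodingerPotential ε c (μs s) ν x - selfPotential ε c μ x)) := by
      rw [hA, hB, Finset.mul_sum, ← Finset.sum_add_distrib]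
      exact Finset.sum_congr rfl fun x _ => by ring
    rwa [h8] at h7
  have hcont : Tendsto (fun s => schrodingerPotential ε c (μs s) ν) (𝓝[>] 0)
      (𝓝 (schrodingerPotential ε c μ ν)) := by
    have h1 := (continuousOn_schrodingerPotential hε hc) (μ, ν) ⟨hμ, hν⟩
    refine h1.tendsto.comp (f := fun s => (μs s, ν)) (tendsto_nhdsWithin_iff.2 ⟨?_, ?_⟩)
    · have : Continuous fun s => (μs s, ν) := by
        refine Continuous.prodMk (continuous_pi fun x => ?_) continuous_const
        simp only [hμs]; fun_prop
      have h2 := this.tendsto 0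
      have h3 : μs 0 = μ := by funext x; simp [hμs]
      rw [h3] at h2
      exact h2.mono_left nhdsWithin_le_nhds
    · filter_upwards [Ioc_mem_nhdsGT (zero_lt_one' ℝ)] with s hs
      exact ⟨hmem s ⟨hs.1.le, hs.2⟩, hν⟩
  rw [tendsto_pi_nhds] at hcont
  have hlim : Tendsto (fun s => ∑ x, δ x *
      (V x + 1 / (2 * τ) * (schrodingerPotential ε c (μs s) ν x - selfPotential ε c μ x))
        + 1 / (2 * τ) * (s * Q)) (𝓝[>] 0) (𝓝 (∑ x, δ x *
      (V x + 1 / (2 * τ) * (schrodingerPotential ε c μ ν x - selfPotential ε c μ x))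
        + 1 / (2 * τ) * (0 * Q))) := by
    refine Tendsto.add (tendsto_finsetSum _ fun x _ => ?_) ?_
    · exact (((((hcont x).sub_const _).const_mul _).const_add _).const_mul _)
    · exact ((tendsto_id.mono_left nhdsWithin_le_nhds).mul_const Q).const_mul _
  have := ge_of_tendsto hlim (by
    filter_upwards [Ioc_mem_nhdsGT (zero_lt_one' ℝ)] with s hs using hineq s hs)
  simpa using this

/-- Optimality in complementary form: `V + (f_{μ,ν} - f_μ) / (2 τ)` is minimal on the support
of `μ`. -/
theorem sjko_complementarity (hε : 0 < ε) (hc : ∀ x y, c x y = c y x) {V : X → ℝ} {τ : ℝ}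
    (hτ : 0 < τ) {μ ν : X → ℝ} (hμ : μ ∈ stdSimplex ℝ X) (hν : ν ∈ stdSimplex ℝ X)
    (hmin : IsMinOn (fun ρ => potentialEnergy V ρ + 1 / (2 * τ) * sinkhornDivergence ε c ρ ν)
      (stdSimplex ℝ X) μ) :
    ∃ C : ℝ, (∀ x, C ≤
        V x + 1 / (2 * τ) * (schrodingerPotential ε c μ ν x - selfPotential ε c μ x)) ∧
      ∀ x, μ x ≠ 0 →
        V x + 1 / (2 * τ) * (schrodingerPotential ε c μ ν x - selfPotential ε c μ x) = C := by
  classical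
  set φ : X → ℝ := fun x =>
    V x + 1 / (2 * τ) * (schrodingerPotential ε c μ ν x - selfPotential ε c μ x) with hφ
  set C : ℝ := ∑ x, μ x * φ x with hC
  have hle : ∀ x, C ≤ φ x := by
    intro x
    have := sjko_variational hε hc hτ hμ hν hmin (single_mem_stdSimplex ℝ x)
    simp only [sub_mul, Finset.sum_sub_distrib] at this
    have h2 : ∑ y, (Pi.single x (1 : ℝ) : X → ℝ) y * φ y = φ x := by
      simp [Pi.single_apply]
    rw [h2] at this
    linarith
  refine ⟨C, hle, fun x hx => ?_⟩
  have h0 : ∑ x, μ x * (φ x - C) = 0 := by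
    simp only [mul_sub, Finset.sum_sub_distrib, ← Finset.sum_mul, hμ.2]
    rw [hC]; ring
  rw [Finset.sum_eq_zero_iff_of_nonneg fun x _ =>
    mul_nonneg (hμ.1 x) (sub_nonneg.2 (hle x))] at h0
  have := (mul_eq_zero.1 (h0 x (Finset.mem_univ x))).resolve_left hx
  linarith

end Duality

/-! ### Discrete and continuous evolution variational inequalities -/

section EVI

variable {E : Type*} [NormedAddCommGroup E] [InnerProductSpace ℝ E]

/-- Discrete evolution variational inequality with step `τ` on a set `D`, driven by the bilinear
form `a`, with an error of order `τ²` in each step. -/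
structure IsStepEVI (a : E →L[ℝ] E →L[ℝ] ℝ) (D : Set E) (τ C : ℝ) (x : ℕ → E) : Prop where
  mem : ∀ k, x k ∈ D
  step : ∀ k, ∀ z ∈ D, ‖x (k + 1) - z‖ ^ 2 ≤ ‖x k - z‖ ^ 2 + 2 * τ * a (x k) z + C * τ ^ 2
  dist_le : ∀ k, ‖x (k + 1) - x k‖ ≤ C * τ

/-- Curves on `[0, ∞)` in `D` that satisfy the evolution variational inequality driven by `a`, with
an error that is quadratic in the length of the time interval. -/
structure IsEVICurve (a : E →L[ℝ] E →L[ℝ] ℝ) (D : Set E) (C : ℝ) (b : ℝ → E) : Prop where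
  mem : ∀ t, 0 ≤ t → b t ∈ D
  evi : ∀ s t, 0 ≤ s → s ≤ t → ∀ z ∈ D,
    ‖b t - z‖ ^ 2 ≤ ‖b s - z‖ ^ 2 + 2 * (t - s) * a (b s) z + C * (t - s) ^ 2
  dist_le : ∀ s t, 0 ≤ s → s ≤ t → ‖b t - b s‖ ≤ C * (t - s)

variable {a : E →L[ℝ] E →L[ℝ] ℝ} {D : Set E} {τ C C' : ℝ} {x y : ℕ → E}

theorem IsEVICurve.sample {b : ℝ → E} (hb : IsEVICurve a D C b) (hτ : 0 ≤ τ) :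
    IsStepEVI a D τ C fun k => b (k * τ) := by
  have h : ∀ k : ℕ, ((k + 1 : ℕ) : ℝ) * τ - k * τ = τ := fun k => by push_cast; ring
  have h' : ∀ k : ℕ, (k : ℝ) * τ ≤ ((k + 1 : ℕ) : ℝ) * τ := fun k => by linarith [h k]
  refine ⟨fun k => hb.mem _ (by positivity), fun k z hz => ?_, fun k => ?_⟩
  · have := hb.evi _ _ (by positivity) (h' k) z hz
    rwa [h] at this
  · have := hb.dist_le _ _ (by positivity) (h' k)
    rwa [h] at this

theorem abs_bilin_le (a : E →L[ℝ] E →L[ℝ] ℝ) {u z : E} (hz : ‖z‖ ≤ 1) : |a u z| ≤ ‖a‖ * ‖u‖ := by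
  have h := a.le_opNorm₂ u z
  rw [Real.norm_eq_abs] at h
  exact h.trans (mul_le_of_le_one_right (by positivity) hz)

/-- Since `a` is alternating, two discrete solutions with the same step stay close. -/
theorem IsStepEVI.dist_sq_le (ha : ∀ u, a u u = 0) (hD : ∀ z ∈ D, ‖z‖ ≤ 1) (hτ : 0 ≤ τ)
    (hx : IsStepEVI a D τ C x) (hy : IsStepEVI a D τ C' y) (n : ℕ) :
    ‖x n - y n‖ ^ 2 ≤ ‖x 0 - y 0‖ ^ 2 + n * ((C + C' + 2 * (‖a‖ * C)) * τ ^ 2) := by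
  have hanti : ∀ u v, a u v = -a v u := by
    intro u v
    have := ha (u + v)
    simp only [map_add, _root_.add_apply, ha] at this
    linarith
  induction n with
  | zero => simp
  | succ n ih =>
    have h1 := hx.step n (y n) (hy.mem n)
    have h2 := hy.step n (x (n + 1)) (hx.mem _)
    rw [norm_sub_rev, norm_sub_rev (y n)] at h2
    have h3 : a (y n) (x (n + 1)) + a (x n) (y n) = -a (x (n + 1) - x n) (y n) := by
      rw [hanti (y n), map_sub, _root_.sub_apply]; ring
    have h4 := (abs_le.1 (abs_bilin_le a (u := x (n + 1) - x n) (hD _ (hy.mem n)))).1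
    have h5 := mul_le_mul_of_nonneg_left (hx.dist_le n) (norm_nonneg a)
    have h6 : τ * (a (y n) (x (n + 1)) + a (x n) (y n)) ≤ τ * (‖a‖ * (C * τ)) :=
      mul_le_mul_of_nonneg_left (by rw [h3]; linarith) hτ
    push_cast
    nlinarith

theorem IsStepEVI.norm_add_sub_le (hx : IsStepEVI a D τ C x) (k n : ℕ) :
    ‖x (k + n) - x k‖ ≤ n * (C * τ) := by
  induction n with
  | zero => simp
  | succ n ih =>
    calc ‖x (k + (n + 1)) - x k‖ = ‖(x (k + n + 1) - x (k + n)) + (x (k + n) - x k)‖ := by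
          rw [sub_add_sub_cancel, add_assoc]
      _ ≤ C * τ + n * (C * τ) := (norm_add_le _ _).trans (add_le_add (hx.dist_le _) ih)
      _ = _ := by push_cast; ring

/-- The discrete inequality is stable under grouping `n` steps into one, with an error that remains
quadratic in the total length. -/
theorem IsStepEVI.step_multiple (hD : ∀ z ∈ D, ‖z‖ ≤ 1) (hτ : 0 ≤ τ) (hC : 0 ≤ C)
    (hx : IsStepEVI a D τ C x) (k n : ℕ) {z : E} (hz : z ∈ D) :
    ‖x (k + n) - z‖ ^ 2 ≤ ‖x k - z‖ ^ 2 + 2 * (n * τ) * a (x k) z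
      + (C + 2 * (‖a‖ * C)) * (n * τ) ^ 2 := by
  induction n with
  | zero => simp
  | succ n ih =>
    have h1 := hx.step (k + n) z hz
    have h2 : a (x (k + n)) z = a (x k) z + a (x (k + n) - x k) z := by simp
    have h3 := (abs_le.1 (abs_bilin_le a (u := x (k + n) - x k) (hD _ hz))).2
    have h4 := mul_le_mul_of_nonneg_left (hx.norm_add_sub_le k n) (norm_nonneg a)
    have h5 : τ * a (x (k + n)) z ≤ τ * (a (x k) z + ‖a‖ * (n * (C * τ))) :=
      mul_le_mul_of_nonneg_left (by linarith) hτ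
    have h6 : 0 ≤ ‖a‖ * C * τ ^ 2 := by positivity
    have h7 : 0 ≤ C * τ ^ 2 * n := by positivity
    have h8 : 0 ≤ ‖a‖ * C * τ ^ 2 * n := by positivity
    rw [← add_assoc]
    push_cast
    nlinarith

theorem IsStepEVI.coarsen (hD : ∀ z ∈ D, ‖z‖ ≤ 1) (hτ : 0 ≤ τ) (hC : 0 ≤ C)
    (hx : IsStepEVI a D τ C x) (N : ℕ) :
    IsStepEVI a D (N * τ) (C + 2 * (‖a‖ * C)) fun k => x (N * k) := by
  refine ⟨fun k => hx.mem _, fun k z hz => ?_, fun k => ?_⟩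
  · simpa only [mul_add, mul_one] using hx.step_multiple hD hτ hC (N * k) N hz
  · have h := hx.norm_add_sub_le (N * k) N
    simp only [mul_add, mul_one]
    refine h.trans ?_
    have : 0 ≤ ‖a‖ * C * (N * τ) := by positivity
    linarith

theorem IsStepEVI.norm_sub_le_of_le (hτ : 0 ≤ τ) (hC : 0 ≤ C) (hx : IsStepEVI a D τ C x)
    {m n N : ℕ} (hmn : m ≤ n) (hN : n ≤ m + N) : ‖x n - x m‖ ≤ N * (C * τ) := by
  obtain ⟨j, rfl⟩ := Nat.exists_eq_add_of_le hmn
  refine (hx.norm_add_sub_le m j).trans (mul_le_mul_of_nonneg_right ?_ (by positivity))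
  exact_mod_cast (by lia : j ≤ N)

theorem floor_div_mul_le {t : ℝ} (ht : 0 ≤ t) (hτ : 0 < τ) : (⌊t / τ⌋₊ : ℝ) * τ ≤ t := by
  have := Nat.floor_le (div_nonneg ht hτ.le)
  rwa [le_div_iff₀ hτ] at this

theorem lt_floor_div_mul_add (t : ℝ) (hτ : 0 < τ) : t < (⌊t / τ⌋₊ : ℝ) * τ + τ := by
  have := Nat.lt_floor_add_one (t / τ)
  rw [div_lt_iff₀ hτ] at this
  linarith

/-- Comparison of the piecewise constant interpolations of two discrete solutions whose steps are
`τ` and `τ / N`. -/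
theorem IsStepEVI.interp_refine (ha : ∀ u, a u u = 0) (hD : ∀ z ∈ D, ‖z‖ ≤ 1) (hτ : 0 < τ)
    (hC : 0 ≤ C) {N : ℕ} (hN : 0 < N) (hx : IsStepEVI a D τ C x) (hy : IsStepEVI a D (τ / N) C y)
    (h0 : x 0 = y 0) {t T : ℝ} (ht : 0 ≤ t) (htT : t ≤ T) :
    ‖x ⌊t / τ⌋₊ - y ⌊t / (τ / N)⌋₊‖ ≤ √(T * ((2 * C + 4 * (‖a‖ * C)) * τ)) + C * τ := by
  have hN' : (0 : ℝ) < N := by exact_mod_cast hN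
  have hyc := hy.coarsen hD (by positivity) hC N
  rw [mul_div_cancel₀ _ hN'.ne'] at hyc
  set n := ⌊t / τ⌋₊ with hn
  have h1 := hx.dist_sq_le ha hD hτ.le hyc n
  simp only [mul_zero, h0, sub_self, norm_zero] at h1
  have h2 : ‖x n - y (N * n)‖ ≤ √(T * ((2 * C + 4 * (‖a‖ * C)) * τ)) := by
    refine Real.le_sqrt_of_sq_le (h1.trans ?_)
    have h3 := floor_div_mul_le ht hτ
    have h4 : (n : ℝ) * τ ≤ T := h3.trans htT
    have h5 : 0 ≤ (2 * C + 4 * (‖a‖ * C)) * τ := by positivity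
    nlinarith [mul_le_mul_of_nonneg_right h4 h5]
  have h3 : ‖y ⌊t / (τ / N)⌋₊ - y (N * n)‖ ≤ C * τ := by
    have h4 : t / (τ / N) = N * (t / τ) := by field_simp
    have h5 : N * n ≤ ⌊t / (τ / N)⌋₊ := by
      rw [h4]
      refine Nat.le_floor ?_
      push_cast
      exact mul_le_mul_of_nonneg_left (Nat.floor_le (by positivity)) hN'.le
    have h6 : ⌊t / (τ / N)⌋₊ ≤ N * n + N := by
      rw [h4]
      refine Nat.le_of_lt_succ ((Nat.floor_lt (by positivity)).2 ?_)
      push_cast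
      have := mul_lt_mul_of_pos_left (Nat.lt_floor_add_one (t / τ)) hN'
      linarith
    have h7 := hy.norm_sub_le_of_le (by positivity) hC h5 h6
    calc _ ≤ N * (C * (τ / N)) := h7
      _ = C * τ := by field_simp
  calc ‖x n - y ⌊t / (τ / N)⌋₊‖ = ‖(x n - y (N * n)) - (y ⌊t / (τ / N)⌋₊ - y (N * n))‖ := by
        rw [sub_sub_sub_cancel_right]
    _ ≤ _ := (norm_sub_le _ _).trans (add_le_add h2 h3)

theorem tendsto_floor_div_mul {t : ℝ} (ht : 0 ≤ t) :
    Tendsto (fun τ : ℝ => (⌊t / τ⌋₊ : ℝ) * τ) (𝓝[>] 0) (𝓝 t) := by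
  have h1 : Tendsto (fun τ : ℝ => t - τ) (𝓝[>] 0) (𝓝 t) := by
    have : Tendsto (fun τ : ℝ => t - τ) (𝓝 0) (𝓝 (t - 0)) := tendsto_id.const_sub t
    rw [sub_zero] at this
    exact this.mono_left nhdsWithin_le_nhds
  refine tendsto_of_tendsto_of_tendsto_of_le_of_le' h1 tendsto_const_nhds ?_ ?_
  · filter_upwards [self_mem_nhdsWithin] with τ hτ
    have := lt_floor_div_mul_add t (mem_Ioi.1 hτ)
    linarith
  · filter_upwards [self_mem_nhdsWithin] with τ hτ using floor_div_mul_le ht hτ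

/-- Dyadic discrete solutions with a common starting point are Cauchy, and their limit is a curve
that satisfies the evolution variational inequality. -/
theorem exists_isEVICurve [CompleteSpace E] (ha : ∀ u, a u u = 0) (hDc : IsClosed D)
    (hD : ∀ z ∈ D, ‖z‖ ≤ 1) (hC : 0 ≤ C) {x₀ : E}
    (h : ∀ j : ℕ, ∃ x : ℕ → E, x 0 = x₀ ∧ IsStepEVI a D ((1 / 2) ^ j) C x) :
    ∃ b : ℝ → E, b 0 = x₀ ∧ IsEVICurve a D (C + 2 * (‖a‖ * C)) b := by
  choose x hx0 hx using h
  set σ : ℕ → ℝ := fun j => (1 / 2) ^ j with hσ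
  have hσ0 : ∀ j, 0 < σ j := fun j => by positivity
  have hσl : Tendsto σ atTop (𝓝 0) := tendsto_pow_atTop_nhds_zero_of_lt_one (by norm_num)
    (by norm_num)
  have hσl' : Tendsto σ atTop (𝓝[>] 0) :=
    tendsto_nhdsWithin_iff.2 ⟨hσl, Eventually.of_forall hσ0⟩
  have hconv : ∀ t, 0 ≤ t → ∃ l, Tendsto (fun j => x j ⌊t / σ j⌋₊) atTop (𝓝 l) := by
    intro t ht
    refine cauchySeq_tendsto_of_complete ?_
    refine cauchySeq_of_le_tendsto_0'
      (fun j => √(t * ((2 * C + 4 * (‖a‖ * C)) * σ j)) + C * σ j) (fun n m hnm => ?_) ?_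
    · obtain ⟨i, rfl⟩ := Nat.exists_eq_add_of_le hnm
      have hi : σ (n + i) = σ n / ((2 ^ i : ℕ) : ℝ) := by
        simp [hσ, pow_add, div_eq_mul_inv, mul_comm]
      have hxi := hx (n + i)
      change IsStepEVI a D (σ (n + i)) C _ at hxi
      rw [hi] at hxi
      rw [dist_eq_norm, hi]
      exact (hx n).interp_refine ha hD (hσ0 n) hC (by positivity) hxi (by rw [hx0, hx0]) ht le_rfl
    · have h1 : Tendsto (fun j => √(t * ((2 * C + 4 * (‖a‖ * C)) * σ j)) + C * σ j) atTop
          (𝓝 (√(t * ((2 * C + 4 * (‖a‖ * C)) * 0)) + C * 0)) :=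
        ((Real.continuous_sqrt.tendsto _).comp ((hσl.const_mul _).const_mul _)).add
          (hσl.const_mul _)
      simpa using h1
  choose! b hb using hconv
  refine ⟨b, ?_, fun t ht => ?_, fun s t hs hst z hz => ?_, fun s t hs hst => ?_⟩
  · refine tendsto_nhds_unique (hb 0 le_rfl) ?_
    simp [hx0]
  · exact hDc.mem_of_tendsto (hb t ht) (Eventually.of_forall fun j => (hx j).mem _)
  · have ht := hs.trans hst
    have hlen : Tendsto (fun j => (⌊t / σ j⌋₊ : ℝ) * σ j - (⌊s / σ j⌋₊ : ℝ) * σ j) atTop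
        (𝓝 (t - s)) :=
      ((tendsto_floor_div_mul ht).comp hσl').sub ((tendsto_floor_div_mul hs).comp hσl')
    have hbs := hb s hs
    have hal : Tendsto (fun j => a (x j ⌊s / σ j⌋₊) z) atTop (𝓝 (a (b s) z)) :=
      ((a.flip z).continuous.tendsto (b s)).comp hbs
    refine le_of_tendsto_of_tendsto (((hb t ht).sub_const z).norm.pow 2)
      ((((hbs.sub_const z).norm.pow 2).add ((hlen.const_mul 2).mul hal)).add
        ((hlen.pow 2).const_mul (C + 2 * (‖a‖ * C)))) (Eventually.of_forall fun j => ?_)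
    have hle : ⌊s / σ j⌋₊ ≤ ⌊t / σ j⌋₊ :=
      Nat.floor_le_floor (div_le_div_of_nonneg_right hst (hσ0 j).le)
    obtain ⟨n, hn⟩ := Nat.exists_eq_add_of_le hle
    have := (hx j).step_multiple hD (hσ0 j).le hC ⌊s / σ j⌋₊ n hz
    simp only
    rw [hn]
    push_cast
    rw [add_mul, add_sub_cancel_left]
    exact this
  · have ht := hs.trans hst
    have hlen : Tendsto (fun j => (⌊t / σ j⌋₊ : ℝ) * σ j - (⌊s / σ j⌋₊ : ℝ) * σ j) atTop
        (𝓝 (t - s)) :=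
      ((tendsto_floor_div_mul ht).comp hσl').sub ((tendsto_floor_div_mul hs).comp hσl')
    have hfin : ‖b t - b s‖ ≤ C * (t - s) := by
      refine le_of_tendsto_of_tendsto ((hb t ht).sub (hb s hs)).norm (hlen.const_mul C)
        (Eventually.of_forall fun j => ?_)
      have hle : ⌊s / σ j⌋₊ ≤ ⌊t / σ j⌋₊ :=
        Nat.floor_le_floor (div_le_div_of_nonneg_right hst (hσ0 j).le)
      obtain ⟨n, hn⟩ := Nat.exists_eq_add_of_le hle
      have := (hx j).norm_add_sub_le ⌊s / σ j⌋₊ n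
      simp only
      rw [hn]
      push_cast
      rw [add_mul, add_sub_cancel_left]
      change _ ≤ n * (C * σ j) at this
      linarith
    refine hfin.trans (mul_le_mul_of_nonneg_right ?_ (sub_nonneg.2 hst))
    have : 0 ≤ ‖a‖ * C := by positivity
    linarith

/-- Error estimate between a discrete solution and a curve with the same starting point. -/
theorem IsEVICurve.norm_sub_interp_le {b : ℝ → E} (ha : ∀ u, a u u = 0) (hD : ∀ z ∈ D, ‖z‖ ≤ 1)
    (hτ : 0 < τ) (hC : 0 ≤ C) (hC' : 0 ≤ C') (hx : IsStepEVI a D τ C x) (hb : IsEVICurve a D C' b)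
    (h0 : x 0 = b 0) {t T : ℝ} (ht : 0 ≤ t) (htT : t ≤ T) :
    ‖b t - x ⌊t / τ⌋₊‖ ≤ √(T * ((C + C' + 2 * (‖a‖ * C)) * τ)) + C' * τ := by
  set n := ⌊t / τ⌋₊ with hn
  have h3 := floor_div_mul_le ht hτ
  have h1 := hx.dist_sq_le ha hD hτ.le (hb.sample hτ.le) n
  simp only [Nat.cast_zero, zero_mul, h0, sub_self, norm_zero] at h1
  have h2 : ‖x n - b (n * τ)‖ ≤ √(T * ((C + C' + 2 * (‖a‖ * C)) * τ)) := by
    refine Real.le_sqrt_of_sq_le (h1.trans ?_)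
    have h4 : (n : ℝ) * τ ≤ T := h3.trans htT
    have h5 : 0 ≤ (C + C' + 2 * (‖a‖ * C)) * τ := by positivity
    nlinarith [mul_le_mul_of_nonneg_right h4 h5]
  have h4 : ‖b t - b (n * τ)‖ ≤ C' * τ :=
    (hb.dist_le _ _ (by positivity) h3).trans
      (mul_le_mul_of_nonneg_left (by linarith [lt_floor_div_mul_add t hτ]) hC')
  calc ‖b t - x n‖ = ‖(b t - b (n * τ)) - (x n - b (n * τ))‖ := by
        rw [sub_sub_sub_cancel_right]
    _ ≤ _ := (norm_sub_le _ _).trans (by linarith)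

/-- Differentiating the evolution variational inequality. -/
theorem IsEVICurve.inner_deriv_le {b : ℝ → E} (hb : IsEVICurve a D C b) {t : ℝ} (ht : 0 ≤ t)
    {v : E} (hv : HasDerivAt b v t) {z : E} (hz : z ∈ D) :
    inner ℝ v (b t - z) ≤ a (b t) z := by
  have h1 : HasDerivAt (fun s => ‖b s - z‖ ^ 2) (2 * inner ℝ (b t - z) v) t :=
    (hv.sub_const z).norm_sq
  have h2 : HasDerivAt (fun s => ‖b t - z‖ ^ 2 + 2 * (s - t) * a (b t) z + C * (s - t) ^ 2)
      (2 * a (b t) z) t := by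
    have h3 : HasDerivAt (fun s : ℝ => s - t) 1 t := (hasDerivAt_id t).sub_const t
    convert! (((h3.const_mul 2).mul_const (a (b t) z)).const_add (‖b t - z‖ ^ 2)).add
      ((h3.pow 2).const_mul C) using 1
    simp
  have h3 := (h2.sub h1).hasDerivWithinAt (s := Ioi t)
  rw [hasDerivWithinAt_iff_tendsto_slope' (by simp)] at h3
  have h4 := ge_of_tendsto h3 (b := 0) (by
    filter_upwards [self_mem_nhdsWithin] with s hs
    have := hb.evi t s ht (le_of_lt hs) z hz
    rw [slope_def_field]
    refine div_nonneg ?_ (sub_nonneg.2 (le_of_lt hs))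
    simp only [Pi.sub_apply]
    simp
    linarith)
  rw [real_inner_comm]
  linarith

end EVI

/-! ### Length distances of quadratic costs and their geodesics -/

section Geometry

variable {E : Type*} [NormedAddCommGroup E] [NormedSpace ℝ E]

/-- `b` is a curve of class `H¹` on `[A, B]`, with velocity `v` and with values in `D`. -/
structure IsPathOn (D : Set E) (A B : ℝ) (b v : ℝ → E) : Prop where
  mem : ∀ t ∈ Icc A B, b t ∈ D
  int : IntervalIntegrable v volume A B
  int_sq : IntervalIntegrable (fun t => ‖v t‖ ^ 2) volume A B
  eq_add : ∀ t ∈ Icc A B, b t = b A + ∫ s in A..t, v s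

/-- `G b v` is, for every `b ∈ D`, continuous, quadratic in the velocity `v` and comparable to
`‖v‖²`, and any two points of `D` are joined in `D` by a path whose velocity is controlled by their
distance. -/
structure IsLengthCost (D : Set E) (G : E → E → ℝ) (m M R : ℝ) : Prop where
  m_pos : 0 < m
  M_nonneg : 0 ≤ M
  R_nonneg : 0 ≤ R
  isClosed : IsClosed D
  continuousOn : ContinuousOn (fun p : E × E => G p.1 p.2) (D ×ˢ univ)
  lower : ∀ b ∈ D, ∀ v, m * ‖v‖ ^ 2 ≤ G b v
  upper : ∀ b ∈ D, ∀ v, G b v ≤ M * ‖v‖ ^ 2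
  homog : ∀ (b v : E) (s : ℝ), G b (s • v) = s ^ 2 * G b v
  conn : ∀ x ∈ D, ∀ y ∈ D, ∃ b v, IsPathOn D 0 1 b v ∧ b 0 = x ∧ b 1 = y ∧
    ∀ t ∈ Icc (0 : ℝ) 1, ‖v t‖ ≤ R * ‖x - y‖

/-- The set of energies of paths in `D` from `x` to `y`. -/
def pathEnergies (D : Set E) (G : E → E → ℝ) (x y : E) : Set ℝ :=
  {e | ∃ b v, IsPathOn D 0 1 b v ∧ b 0 = x ∧ b 1 = y ∧ e = ∫ t in (0 : ℝ)..1, G (b t) (v t)}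

/-- The length distance of the cost `G`. -/
noncomputable def lengthDist (D : Set E) (G : E → E → ℝ) (x y : E) : ℝ :=
  Real.sqrt (sInf (pathEnergies D G x y))

variable {D : Set E} {G : E → E → ℝ} {m M R A B C : ℝ} {b v b' v' : ℝ → E} {x y z : E}

theorem IsPathOn.continuousOn (hb : IsPathOn D A B b v) (hAB : A ≤ B) :
    ContinuousOn b (Icc A B) := by
  have h := intervalIntegral.continuousOn_primitive_interval
    ((intervalIntegrable_iff' (by finiteness)).1 hb.int)
  rw [uIcc_of_le hAB] at h
  exact (h.const_add (b A)).congr hb.eq_add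

theorem IsPathOn.sub_eq (hb : IsPathOn D A B b v) {s t : ℝ} (hs : s ∈ Icc A B)
    (ht : t ∈ Icc A B) : b t - b s = ∫ r in s..t, v r := by
  have hAB : A ≤ B := hs.1.trans hs.2
  have hi : ∀ r ∈ Icc A B, IntervalIntegrable v volume A r := fun r hr =>
    hb.int.mono_set (by rw [uIcc_of_le hAB, uIcc_of_le hr.1]; exact Icc_subset_Icc_right hr.2)
  rw [hb.eq_add s hs, hb.eq_add t ht, add_sub_add_left_eq_sub,
    intervalIntegral.integral_interval_sub_left (hi t ht) (hi s hs)]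

theorem uIcc_subset_uIcc_of_mem {s t : ℝ} (hs : s ∈ Icc A B)
    (ht : t ∈ Icc A B) : uIcc s t ⊆ uIcc A B := by
  rw [uIcc_of_le (hs.1.trans hs.2)]
  exact uIcc_subset_Icc hs ht

theorem IsLengthCost.nonneg (hG : IsLengthCost D G m M R) (hx : x ∈ D) (w : E) : 0 ≤ G x w :=
  (mul_nonneg hG.m_pos.le (sq_nonneg _)).trans (hG.lower x hx w)

theorem IsLengthCost.intervalIntegrable (hG : IsLengthCost D G m M R) (hb : IsPathOn D A B b v)
    (hAB : A ≤ B) : IntervalIntegrable (fun t => G (b t) (v t)) volume A B := by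
  classical
  refine (hb.int_sq.const_mul M).mono_fun ?_ ?_
  · rw [uIoc_of_le hAB]
    have h1 : AEStronglyMeasurable b (volume.restrict (Ioc A B)) :=
      ((hb.continuousOn hAB).mono Ioc_subset_Icc_self).aestronglyMeasurable measurableSet_Ioc
    have h2 : AEStronglyMeasurable v (volume.restrict (Ioc A B)) := hb.int.1.aestronglyMeasurable
    let _ : MeasurableSpace (E × E) := borel _
    have : BorelSpace (E × E) := ⟨rfl⟩
    have h3 : AEMeasurable (fun t => (b t, v t)) (volume.restrict (Ioc A B)) :=
      (h1.prodMk h2).aemeasurable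
    have h4 : Measurable ((D ×ˢ univ).piecewise (fun p : E × E => G p.1 p.2) fun _ => 0) :=
      hG.continuousOn.measurable_piecewise continuousOn_const
        (hG.isClosed.prod isClosed_univ).measurableSet
    refine (h4.comp_aemeasurable h3).aestronglyMeasurable.congr ?_
    filter_upwards [ae_restrict_mem measurableSet_Ioc] with t ht
    simp only [Function.comp]
    rw [Set.piecewise_eq_of_mem]
    exact ⟨hb.mem t (Ioc_subset_Icc_self ht), mem_univ _⟩
  · rw [uIoc_of_le hAB]
    filter_upwards [ae_restrict_mem measurableSet_Ioc] with t ht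
    have hm := hb.mem t (Ioc_subset_Icc_self ht)
    rw [Real.norm_of_nonneg (hG.nonneg hm _)]
    exact (hG.upper _ hm _).trans (le_abs_self _)

theorem intervalIntegrable_comp_affine {F : Type*} [NormedAddCommGroup F] {f : ℝ → F}
    (hf : IntervalIntegrable f volume A B) {α β A' B' : ℝ} (hα : α ≠ 0)
    (hA' : α * A' + β ∈ Icc A B) (hB' : α * B' + β ∈ Icc A B) :
    IntervalIntegrable (fun r => f (α * r + β)) volume A' B' := by
  have h1 := (hf.mono_set (uIcc_subset_uIcc_of_mem hA' hB')).comp_add_right β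
  have h2 := h1.comp_mul_left (c := α)
  simpa [mul_div_cancel_left₀ _ hα] using h2

theorem IsPathOn.comp_affine (hb : IsPathOn D A B b v) {α β A' B' : ℝ} (hα : α ≠ 0)
    (hAB' : A' ≤ B') (hmap : ∀ r ∈ Icc A' B', α * r + β ∈ Icc A B) :
    IsPathOn D A' B' (fun r => b (α * r + β)) (fun r => α • v (α * r + β)) := by
  have hA' := hmap A' (left_mem_Icc.2 hAB')
  have hB' := hmap B' (right_mem_Icc.2 hAB')
  refine ⟨fun t ht => hb.mem _ (hmap t ht), (intervalIntegrable_comp_affine hb.int hα hA' hB').smul α,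
    ?_, fun t ht => ?_⟩
  · have := (intervalIntegrable_comp_affine hb.int_sq hα hA' hB').const_mul (‖α‖ ^ 2)
    simpa only [norm_smul, mul_pow] using this
  · rw [intervalIntegral.integral_smul, intervalIntegral.smul_integral_comp_mul_add,
      ← hb.sub_eq hA' (hmap t ht)]
    abel

/-- Quadratic homogeneity determines how the energy changes under affine reparametrizations. -/
theorem IsLengthCost.energy_comp_affine (hG : IsLengthCost D G m M R) (b v : ℝ → E)
    (α β A' B' : ℝ) :
    ∫ r in A'..B', G (b (α * r + β)) (α • v (α * r + β)) =
      α * ∫ t in α * A' + β..α * B' + β, G (b t) (v t) := by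
  simp_rw [hG.homog]
  rw [intervalIntegral.integral_const_mul, ← intervalIntegral.smul_integral_comp_mul_add
    (fun t => G (b t) (v t)), smul_eq_mul]
  ring

theorem concat_integrable {S F : Type*} [NormedAddCommGroup F] [NormedSpace ℝ F]
    {b v b' v' : ℝ → S} (f : S → S → F)
    (hAB : A ≤ B) (hBC : B ≤ C) (h1 : IntervalIntegrable (fun t => f (b t) (v t)) volume A B)
    (h2 : IntervalIntegrable (fun t => f (b' t) (v' t)) volume B C) :
    IntervalIntegrable (fun t => f (if t ≤ B then b t else b' t) (if t ≤ B then v t else v' t))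
      volume A C ∧
    ∫ t in A..C, f (if t ≤ B then b t else b' t) (if t ≤ B then v t else v' t) =
      (∫ t in A..B, f (b t) (v t)) + ∫ t in B..C, f (b' t) (v' t) := by
  have e1 : EqOn (fun t => f (b t) (v t))
      (fun t => f (if t ≤ B then b t else b' t) (if t ≤ B then v t else v' t)) (uIoc A B) := by
    intro t ht
    rw [uIoc_of_le hAB] at ht
    simp [ht.2]
  have e2 : EqOn (fun t => f (b' t) (v' t))
      (fun t => f (if t ≤ B then b t else b' t) (if t ≤ B then v t else v' t)) (uIoc B C) := by
    intro t ht
    rw [uIoc_of_le hBC] at ht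
    simp [not_le.2 ht.1]
  have i1 := h1.congr e1
  have i2 := h2.congr e2
  refine ⟨i1.trans i2, ?_⟩
  rw [← intervalIntegral.integral_add_adjacent_intervals i1 i2,
    intervalIntegral.integral_congr_ae (Eventually.of_forall fun t ht => (e1 ht).symm),
    intervalIntegral.integral_congr_ae (Eventually.of_forall fun t ht => (e2 ht).symm)]

theorem IsPathOn.concat (hb : IsPathOn D A B b v) (hb' : IsPathOn D B C b' v') (hAB : A ≤ B)
    (hBC : B ≤ C) (h : b B = b' B) :
    IsPathOn D A C (fun t => if t ≤ B then b t else b' t)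
      (fun t => if t ≤ B then v t else v' t) := by
  refine ⟨fun t ht => ?_,
    (concat_integrable (b := b) (b' := b') (fun _ w => w) hAB hBC hb.int hb'.int).1,
    (concat_integrable (b := b) (b' := b') (fun _ w => ‖w‖ ^ 2) hAB hBC hb.int_sq hb'.int_sq).1,
    fun t ht => ?_⟩
  · split_ifs with htB
    · exact hb.mem t ⟨ht.1, htB⟩
    · exact hb'.mem t ⟨(not_le.1 htB).le, ht.2⟩
  · simp only [hAB, if_true]
    split_ifs with htB
    · rw [hb.eq_add t ⟨ht.1, htB⟩]
      congr 1
      refine intervalIntegral.integral_congr fun r hr => ?_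
      rw [uIcc_of_le ht.1] at hr
      simp [hr.2.trans htB]
    · have htB' := (not_le.1 htB).le
      have hi : IntervalIntegrable v' volume B t := hb'.int.mono_set (by
        rw [uIcc_of_le hBC, uIcc_of_le htB']; exact Icc_subset_Icc_right ht.2)
      rw [(concat_integrable (b := b) (b' := b') (fun _ w => w) hAB htB' hb.int hi).2,
        hb'.eq_add t ⟨htB', ht.2⟩, ← h,
        hb.eq_add B ⟨hAB, le_rfl⟩, add_assoc]

theorem IsLengthCost.energy_nonneg (hG : IsLengthCost D G m M R) (hb : IsPathOn D A B b v)
    (hAB : A ≤ B) : 0 ≤ ∫ t in A..B, G (b t) (v t) :=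
  intervalIntegral.integral_nonneg hAB fun t ht => hG.nonneg (hb.mem t ht) _

theorem IsLengthCost.pathEnergies_nonneg (hG : IsLengthCost D G m M R) :
    ∀ e ∈ pathEnergies D G x y, 0 ≤ e := by
  rintro e ⟨b, v, hb, -, -, rfl⟩
  exact hG.energy_nonneg hb zero_le_one

theorem lengthDist_nonneg : 0 ≤ lengthDist D G x y := Real.sqrt_nonneg _

theorem IsLengthCost.sq_lengthDist (hG : IsLengthCost D G m M R) :
    lengthDist D G x y ^ 2 = sInf (pathEnergies D G x y) :=
  Real.sq_sqrt (Real.sInf_nonneg hG.pathEnergies_nonneg)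

/-- Reparametrizing a path on `[A, B]` by the unit interval multiplies its energy by `B - A`. -/
theorem IsLengthCost.sq_lengthDist_le (hG : IsLengthCost D G m M R) (hb : IsPathOn D A B b v)
    (hAB : A ≤ B) : lengthDist D G (b A) (b B) ^ 2 ≤ (B - A) * ∫ t in A..B, G (b t) (v t) := by
  rw [hG.sq_lengthDist]
  refine csInf_le ⟨0, fun e he => hG.pathEnergies_nonneg e he⟩ ?_
  rcases hAB.eq_or_lt with rfl | hlt
  · refine ⟨fun _ => b A, fun _ => 0, ⟨fun t _ => hb.mem A ⟨le_rfl, le_rfl⟩, by simp, by simp,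
      by simp⟩, rfl, rfl, ?_⟩
    have h0 : G (b A) 0 = 0 := by simpa using hG.homog (b A) 0 0
    simp [h0]
  · refine ⟨fun r => b ((B - A) * r + A), fun r => (B - A) • v ((B - A) * r + A),
      hb.comp_affine (sub_pos.2 hlt).ne' zero_le_one fun r hr => ⟨?_, ?_⟩, by simp, by simp, ?_⟩
    · nlinarith [mul_nonneg (sub_pos.2 hlt).le hr.1]
    · nlinarith [mul_nonneg (sub_pos.2 hlt).le (sub_nonneg.2 hr.2)]
    · rw [hG.energy_comp_affine]
      simp

theorem IsPathOn.restrict (hb : IsPathOn D A B b v) {s t : ℝ} (hs : A ≤ s) (hst : s ≤ t)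
    (ht : t ≤ B) : IsPathOn D s t b v := by
  have h := hb.comp_affine (α := 1) (β := 0) (A' := s) (B' := t) one_ne_zero hst fun r hr => by
    rw [one_mul, add_zero]
    exact ⟨hs.trans hr.1, hr.2.trans ht⟩
  simpa using h

theorem IsLengthCost.exists_path_energy_lt (hG : IsLengthCost D G m M R) (hx : x ∈ D) (hy : y ∈ D)
    {e : ℝ} (he : lengthDist D G x y ^ 2 < e) :
    ∃ b v, IsPathOn D 0 1 b v ∧ b 0 = x ∧ b 1 = y ∧ ∫ t in (0 : ℝ)..1, G (b t) (v t) < e := by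
  rw [hG.sq_lengthDist] at he
  obtain ⟨b, v, hb, h0, h1, -⟩ := hG.conn x hx y hy
  obtain ⟨_, ⟨b, v, hb, h0, h1, rfl⟩, hlt⟩ := exists_lt_of_csInf_lt
    (⟨_, b, v, hb, h0, h1, rfl⟩ : (pathEnergies D G x y).Nonempty) he
  exact ⟨b, v, hb, h0, h1, hlt⟩

theorem sq_integral_norm_le {F : Type*} [NormedAddCommGroup F] {v : ℝ → F}
    (hv : IntervalIntegrable v volume 0 1)
    (hv2 : IntervalIntegrable (fun t => ‖v t‖ ^ 2) volume 0 1) :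
    (∫ t in (0 : ℝ)..1, ‖v t‖) ^ 2 ≤ ∫ t in (0 : ℝ)..1, ‖v t‖ ^ 2 := by
  set κ := ∫ t in (0 : ℝ)..1, ‖v t‖ with hκ
  have h : ∫ t in (0 : ℝ)..1, (2 * κ * ‖v t‖ - κ ^ 2) ≤ ∫ t in (0 : ℝ)..1, ‖v t‖ ^ 2 :=
    intervalIntegral.integral_mono_on zero_le_one
      ((hv.norm.const_mul _).sub intervalIntegrable_const) hv2 fun t _ => by
        nlinarith [sq_nonneg (‖v t‖ - κ)]
  rw [intervalIntegral.integral_sub (hv.norm.const_mul _) intervalIntegrable_const,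
    intervalIntegral.integral_const_mul, ← hκ] at h
  simp at h
  nlinarith

theorem IsLengthCost.le_lengthDist (hG : IsLengthCost D G m M R) (hx : x ∈ D) (hy : y ∈ D) :
    √m * ‖x - y‖ ≤ lengthDist D G x y := by
  obtain ⟨b, v, hb, h0, h1, -⟩ := hG.conn x hx y hy
  refine Real.le_sqrt_of_sq_le (le_csInf ⟨_, b, v, hb, h0, h1, rfl⟩ ?_)
  rintro _ ⟨b, v, hb, rfl, rfl, rfl⟩
  have e1 : ‖b 0 - b 1‖ ≤ ∫ t in (0 : ℝ)..1, ‖v t‖ := by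
    rw [norm_sub_rev, hb.sub_eq (by simp) (by simp)]
    exact intervalIntegral.norm_integral_le_integral_norm zero_le_one
  have e2 := sq_integral_norm_le hb.int hb.int_sq
  have e3 : m * ∫ t in (0 : ℝ)..1, ‖v t‖ ^ 2 ≤ ∫ t in (0 : ℝ)..1, G (b t) (v t) := by
    rw [← intervalIntegral.integral_const_mul]
    exact intervalIntegral.integral_mono_on zero_le_one (hb.int_sq.const_mul m)
      (hG.intervalIntegrable hb zero_le_one) fun t ht => hG.lower _ (hb.mem t ht) _
  rw [mul_pow, Real.sq_sqrt hG.m_pos.le]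
  refine le_trans (mul_le_mul_of_nonneg_left ?_ hG.m_pos.le) e3
  exact (pow_le_pow_left₀ (norm_nonneg _) e1 2).trans e2

theorem IsLengthCost.lengthDist_le (hG : IsLengthCost D G m M R) (hx : x ∈ D) (hy : y ∈ D) :
    lengthDist D G x y ≤ √M * R * ‖x - y‖ := by
  obtain ⟨b, v, hb, rfl, rfl, hv⟩ := hG.conn x hx y hy
  have h1 := hG.sq_lengthDist_le hb zero_le_one
  have h2 : ∫ t in (0 : ℝ)..1, G (b t) (v t) ≤ ∫ t in (0 : ℝ)..1, M * (R * ‖b 0 - b 1‖) ^ 2 :=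
    intervalIntegral.integral_mono_on zero_le_one (hG.intervalIntegrable hb zero_le_one)
      intervalIntegrable_const fun t ht => (hG.upper _ (hb.mem t ht) _).trans
        (mul_le_mul_of_nonneg_left (pow_le_pow_left₀ (norm_nonneg _) (hv t ht) 2) hG.M_nonneg)
  have hR := hG.R_nonneg
  refine le_of_sq_le_sq (h1.trans ?_) (by positivity)
  rw [mul_assoc, mul_pow, Real.sq_sqrt hG.M_nonneg]
  simpa using h2

theorem IsLengthCost.lengthDist_comm (hG : IsLengthCost D G m M R) :
    lengthDist D G x y = lengthDist D G y x := by
  have key : ∀ x y, pathEnergies D G x y ⊆ pathEnergies D G y x := by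
    rintro x y _ ⟨b, v, hb, rfl, rfl, rfl⟩
    refine ⟨_, _, hb.comp_affine (α := -1) (β := 1) (by norm_num) zero_le_one
      fun r hr => ⟨by linarith [hr.2], by linarith [hr.1]⟩, by simp, by simp, ?_⟩
    rw [hG.energy_comp_affine, intervalIntegral.integral_symm]
    norm_num
  rw [lengthDist, lengthDist, (key x y).antisymm (key y x)]

theorem IsLengthCost.lengthDist_triangle (hG : IsLengthCost D G m M R) (hx : x ∈ D) (hy : y ∈ D)
    (hz : z ∈ D) : lengthDist D G x z ≤ lengthDist D G x y + lengthDist D G y z := by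
  refine le_of_forall_pos_le_add fun δ hδ => ?_
  set d₁ := lengthDist D G x y + δ / 2 with hd₁
  set d₂ := lengthDist D G y z + δ / 2 with hd₂
  have n₁ : 0 ≤ lengthDist D G x y := lengthDist_nonneg
  have n₂ : 0 ≤ lengthDist D G y z := lengthDist_nonneg
  have p₁ : 0 < d₁ := by positivity
  have p₂ : 0 < d₂ := by positivity
  obtain ⟨b₁, v₁, hb₁, rfl, h₁, e₁⟩ := hG.exists_path_energy_lt hx hy
    (e := d₁ ^ 2) (pow_lt_pow_left₀ (by linarith) n₁ two_ne_zero)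
  obtain ⟨b₂, v₂, hb₂, h₂, rfl, e₂⟩ := hG.exists_path_energy_lt hy hz
    (e := d₂ ^ 2) (pow_lt_pow_left₀ (by linarith) n₂ two_ne_zero)
  -- the two paths are run at speeds that make the parameter interval as long as the curve
  have hc₁ := hb₁.comp_affine (α := d₁⁻¹) (β := 0) (by positivity) p₁.le fun r hr =>
    ⟨by simpa using mul_nonneg (inv_pos.2 p₁).le hr.1,
      by rw [add_zero, inv_mul_le_iff₀ p₁]; linarith [hr.2]⟩
  have hc₂ := hb₂.comp_affine (α := d₂⁻¹) (β := -(d₂⁻¹ * d₁)) (A' := d₁) (B' := d₁ + d₂)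
    (by positivity) (by linarith) fun r hr =>
    ⟨by rw [← sub_eq_add_neg, ← mul_sub]; exact mul_nonneg (inv_pos.2 p₂).le (by linarith [hr.1]),
      by rw [← sub_eq_add_neg, ← mul_sub, inv_mul_le_iff₀ p₂]; linarith [hr.2]⟩
  have hp := hc₁.concat hc₂ p₁.le (by linarith) (by
    simp only [add_zero, inv_mul_cancel₀ p₁.ne', add_neg_cancel, h₁, h₂])
  have hE := (concat_integrable G p₁.le (by linarith) (hG.intervalIntegrable hc₁ p₁.le)
    (hG.intervalIntegrable hc₂ (by linarith))).2
  have hmain := hG.sq_lengthDist_le hp (by linarith)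
  rw [hE, hG.energy_comp_affine, hG.energy_comp_affine] at hmain
  have s1 : d₂⁻¹ * d₁ + -(d₂⁻¹ * d₁) = 0 := by ring
  have s2 : d₂⁻¹ * (d₁ + d₂) + -(d₂⁻¹ * d₁) = 1 := by field_simp; ring
  have s3 : d₁⁻¹ * d₁ + 0 = 1 := by field_simp; ring
  simp only [s1, s2, s3, mul_zero, zero_add, p₁.le, if_true, sub_zero,
    not_le.2 (lt_add_of_pos_right d₁ p₂), if_false] at hmain
  have t₁ : d₁⁻¹ * ∫ t in (0 : ℝ)..1, G (b₁ t) (v₁ t) ≤ d₁ := by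
    rw [inv_mul_le_iff₀ p₁]; nlinarith
  have t₂ : d₂⁻¹ * ∫ t in (0 : ℝ)..1, G (b₂ t) (v₂ t) ≤ d₂ := by
    rw [inv_mul_le_iff₀ p₂]; nlinarith
  have : lengthDist D G (b₁ 0) (b₂ 1) ^ 2 ≤ (d₁ + d₂) ^ 2 := by
    refine hmain.trans ?_
    rw [pow_two]
    exact mul_le_mul_of_nonneg_left (add_le_add t₁ t₂) (by positivity)
  have := le_of_sq_le_sq this (by positivity)
  linarith

theorem IsLengthCost.abs_lengthDist_sub_le (hG : IsLengthCost D G m M R) {x' y' : E} (hx : x ∈ D)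
    (hy : y ∈ D) (hx' : x' ∈ D) (hy' : y' ∈ D) :
    |lengthDist D G x y - lengthDist D G x' y'| ≤ √M * R * (‖x - x'‖ + ‖y - y'‖) := by
  have a1 := hG.lengthDist_triangle hx hx' hy
  have a2 := hG.lengthDist_triangle hx' hy' hy
  have a3 := hG.lengthDist_triangle hx' hx hy'
  have a4 := hG.lengthDist_triangle hx hy hy'
  have b1 := hG.lengthDist_le hx hx'
  have b2 := hG.lengthDist_le hy hy'
  rw [hG.lengthDist_comm (x := x') (y := x)] at a3
  rw [hG.lengthDist_comm (x := y') (y := y)] at a2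
  rw [abs_le]
  constructor <;> linarith

/-- The defect in the Cauchy–Schwarz inequality controls how far a path with almost minimal energy
is from having constant speed. -/
theorem IsLengthCost.sq_lengthDist_sub_le (hG : IsLengthCost D G m M R)
    (hb : IsPathOn D 0 1 b v) {s t : ℝ} (hs : 0 ≤ s) (hst : s ≤ t) (ht : t ≤ 1) :
    (lengthDist D G (b s) (b t) - (t - s) * lengthDist D G (b 0) (b 1)) ^ 2 ≤
      (∫ r in (0 : ℝ)..1, G (b r) (v r)) - lengthDist D G (b 0) (b 1) ^ 2 := by
  have hb₁ := hb.restrict le_rfl hs (hst.trans ht)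
  have hb₂ := hb.restrict hs hst ht
  have hb₃ := hb.restrict (hs.trans hst) ht le_rfl
  have q₁ := hG.sq_lengthDist_le hb₁ hs
  have q₂ := hG.sq_lengthDist_le hb₂ hst
  have q₃ := hG.sq_lengthDist_le hb₃ ht
  have q := hG.sq_lengthDist_le hb zero_le_one
  have n₁ := hG.energy_nonneg hb₁ hs
  have n₂ := hG.energy_nonneg hb₂ hst
  have n₃ := hG.energy_nonneg hb₃ ht
  have hsum : ∫ r in (0 : ℝ)..1, G (b r) (v r) = (∫ r in (0 : ℝ)..s, G (b r) (v r))
      + (∫ r in s..t, G (b r) (v r)) + ∫ r in t..1, G (b r) (v r) := by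
    rw [intervalIntegral.integral_add_adjacent_intervals (hG.intervalIntegrable hb₁ hs)
      (hG.intervalIntegrable hb₂ hst), intervalIntegral.integral_add_adjacent_intervals
      ((hG.intervalIntegrable hb₁ hs).trans (hG.intervalIntegrable hb₂ hst))
      (hG.intervalIntegrable hb₃ ht)]
  have m0 := hb.mem 0 ⟨le_rfl, zero_le_one⟩
  have m1 := hb.mem 1 ⟨zero_le_one, le_rfl⟩
  have ms := hb.mem s ⟨hs, hst.trans ht⟩
  have mt := hb.mem t ⟨hs.trans hst, ht⟩
  have tri : lengthDist D G (b 0) (b 1) ≤ lengthDist D G (b 0) (b s)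
      + lengthDist D G (b s) (b t) + lengthDist D G (b t) (b 1) :=
    (hG.lengthDist_triangle m0 mt m1).trans
      (add_le_add_left (hG.lengthDist_triangle m0 ms mt) _)
  have d₁0 : 0 ≤ lengthDist D G (b 0) (b s) := lengthDist_nonneg
  have d₂0 : 0 ≤ lengthDist D G (b s) (b t) := lengthDist_nonneg
  have d₃0 : 0 ≤ lengthDist D G (b t) (b 1) := lengthDist_nonneg
  have d0 : 0 ≤ lengthDist D G (b 0) (b 1) := lengthDist_nonneg
  rw [hsum] at q ⊢
  generalize (∫ r in (0 : ℝ)..s, G (b r) (v r)) = e₁ at *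
  generalize (∫ r in s..t, G (b r) (v r)) = e₂ at *
  generalize (∫ r in t..1, G (b r) (v r)) = e₃ at *
  generalize lengthDist D G (b 0) (b s) = d₁ at *
  generalize lengthDist D G (b s) (b t) = d₂ at *
  generalize lengthDist D G (b t) (b 1) = d₃ at *
  generalize lengthDist D G (b 0) (b 1) = d at *
  have hst' := sub_nonneg.2 hst
  have ht' := sub_nonneg.2 ht
  have hcs : (d₁ + d₃) ^ 2 ≤ (s + (1 - t)) * (e₁ + e₃) := by
    have h1 : (d₁ * d₃) ^ 2 ≤ (s * e₃) * ((1 - t) * e₁) := by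
      have := mul_le_mul q₁ q₃ (sq_nonneg _) (by nlinarith)
      nlinarith
    have h2 : 2 * (d₁ * d₃) ≤ s * e₃ + (1 - t) * e₁ := by
      refine le_of_sq_le_sq ?_ (by positivity)
      nlinarith [sq_nonneg (s * e₃ - (1 - t) * e₁)]
    nlinarith
  set w := t - s with hw
  have hw1 : w ≤ 1 := by linarith
  have hw' : s + (1 - t) = 1 - w := by rw [hw]; ring
  rw [hw'] at hcs
  have gap : 0 ≤ e₁ + e₂ + e₃ - d ^ 2 := by linarith
  rcases le_or_gt d₂ d with hle | hlt
  · have h1 : (d - d₂) ^ 2 ≤ (1 - w) * (e₁ + e₃) :=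
      (pow_le_pow_left₀ (sub_nonneg.2 hle) (by linarith) 2).trans hcs
    have h2 : (d₂ - w * d) ^ 2 ≤ w * (1 - w) * (e₁ + e₂ + e₃ - d ^ 2) := by
      nlinarith [mul_le_mul_of_nonneg_left h1 hst', mul_le_mul_of_nonneg_left q₂ (sub_nonneg.2 hw1)]
    refine h2.trans (mul_le_of_le_one_left gap ?_)
    nlinarith
  · have h1 : d₂ ^ 2 ≤ w * (e₁ + e₂ + e₃) :=
      q₂.trans (mul_le_mul_of_nonneg_left (by linarith) hst')
    have h2 : (d₂ - w * d) ^ 2 ≤ w * (e₁ + e₂ + e₃ - d ^ 2) := by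
      have : w * (d * d) ≤ w * (d * d₂) :=
        mul_le_mul_of_nonneg_left (mul_le_mul_of_nonneg_left hlt.le d0) hst'
      nlinarith [mul_nonneg hst' (mul_nonneg (sub_nonneg.2 hw1) (sq_nonneg d))]
    exact h2.trans (mul_le_of_le_one_left gap hw1)

/-- Existence of constant-speed geodesics: pointwise limits, along an ultrafilter, of a minimizing
sequence of paths. -/
theorem IsLengthCost.exists_geodesic (hG : IsLengthCost D G m M R) (hD : IsCompact D) (hx : x ∈ D)
    (hy : y ∈ D) : ∃ γ : ℝ → E, (∀ t ∈ Icc (0 : ℝ) 1, γ t ∈ D) ∧ γ 0 = x ∧ γ 1 = y ∧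
      ∀ s ∈ Icc (0 : ℝ) 1, ∀ t ∈ Icc (0 : ℝ) 1,
        lengthDist D G (γ s) (γ t) = |t - s| * lengthDist D G x y := by
  choose b v hb h0 h1 he using fun n : ℕ => hG.exists_path_energy_lt hx hy
    (e := lengthDist D G x y ^ 2 + 1 / ((n : ℝ) + 1)) (lt_add_of_pos_right _ (by positivity))
  set U : Ultrafilter ℕ := hyperfilter ℕ
  have hU : (U : Filter ℕ) ≤ atTop := by
    rw [← Nat.cofinite_eq_atTop]; exact hyperfilter_le_cofinite
  have hlim : ∀ t, t ∈ Icc (0 : ℝ) 1 → ∃ l ∈ D, Tendsto (fun n => b n t) U (𝓝 l) := by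
    intro t ht
    obtain ⟨l, hl, hl'⟩ := hD.ultrafilter_le_nhds (U.map fun n => b n t) (by
      rw [le_principal_iff]
      exact show (fun n => b n t) ⁻¹' D ∈ (U : Filter ℕ) from
        Eventually.of_forall fun n => (hb n).mem t ht)
    exact ⟨l, hl, hl'⟩
  choose! γ hγD hγ using hlim
  have hsort : ∀ s ∈ Icc (0 : ℝ) 1, ∀ t ∈ Icc (0 : ℝ) 1, s ≤ t →
      lengthDist D G (γ s) (γ t) = (t - s) * lengthDist D G x y := by
    intro s hs t ht hst
    have l1 : Tendsto (fun n => lengthDist D G (b n s) (b n t)) U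
        (𝓝 (lengthDist D G (γ s) (γ t))) := by
      rw [tendsto_iff_dist_tendsto_zero]
      refine squeeze_zero (g := fun n => √M * R * (‖b n s - γ s‖ + ‖b n t - γ t‖))
        (fun n => dist_nonneg) (fun n => ?_) ?_
      · exact hG.abs_lengthDist_sub_le ((hb n).mem s hs) ((hb n).mem t ht) (hγD s hs) (hγD t ht)
      · have := ((tendsto_iff_norm_sub_tendsto_zero.1 (hγ s hs)).add
          (tendsto_iff_norm_sub_tendsto_zero.1 (hγ t ht))).const_mul (√M * R)
        simpa using this
    have l2 : Tendsto (fun n => (lengthDist D G (b n s) (b n t)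
        - (t - s) * lengthDist D G x y) ^ 2) U (𝓝 0) := by
      refine squeeze_zero (g := fun n : ℕ => 1 / ((n : ℝ) + 1)) (fun n => sq_nonneg _)
        (fun n => ?_) (tendsto_one_div_add_atTop_nhds_zero_nat.mono_left hU)
      have := hG.sq_lengthDist_sub_le (hb n) hs.1 hst ht.2
      rw [h0, h1] at this
      linarith [he n]
    have l3 := tendsto_nhds_unique ((l1.sub_const _).pow 2) l2
    have := pow_eq_zero_iff two_ne_zero |>.1 l3
    linarith
  refine ⟨γ, hγD, ?_, ?_, fun s hs t ht => ?_⟩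
  · refine tendsto_nhds_unique (hγ 0 ⟨le_rfl, zero_le_one⟩) ?_
    simp [h0]
  · refine tendsto_nhds_unique (hγ 1 ⟨zero_le_one, le_rfl⟩) ?_
    simp [h1]
  · rcases le_total s t with hst | hst
    · rw [hsort s hs t ht hst, abs_of_nonneg (sub_nonneg.2 hst)]
    · rw [hG.lengthDist_comm, hsort t ht s hs hst, abs_of_nonpos (sub_nonpos.2 hst), neg_sub]

end Geometry

/-! ### The embedding of measures into the reproducing kernel Hilbert space -/

section Embedded

variable {X : Type*} [Fintype X] {H : Type*} [NormedAddCommGroup H] [InnerProductSpace ℝ H]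
  [CompleteSpace H] [RKHS ℝ H X ℝ] {ε : ℝ} {c : X → X → ℝ}

theorem kernelMean_add (σ₁ σ₂ : X → ℝ) :
    kernelMean H (σ₁ + σ₂) = kernelMean H σ₁ + kernelMean H σ₂ := by
  simp [kernelMean, add_smul, Finset.sum_add_distrib]

theorem kernelMean_smul (r : ℝ) (σ : X → ℝ) : kernelMean H (r • σ) = r • kernelMean H σ := by
  simp [kernelMean, Finset.smul_sum, smul_smul]

/-- The reproducing property, integrated against a signed measure. -/
theorem inner_kernelMean (σ : X → ℝ) (h : H) :
    inner ℝ (kernelMean H σ) h = ∑ x, σ x * h x := by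
  simp [kernelMean, sum_inner, inner_smul_left]

theorem kernelMean_apply (hc : ∀ x y, c x y = c y x)
    (hk : HasReproducingKernel H (gibbsKernel ε c)) (σ : X → ℝ) (y : X) :
    kernelMean H σ y = ∑ x, Real.exp (-c x y / ε) * σ x := by
  have h2 : ∀ h : H, h y = inner ℝ (RKHS.kerFun H y (1 : ℝ)) h := by
    intro h
    simp
  rw [h2, kernelMean, inner_sum]
  refine Finset.sum_congr rfl fun x _ => ?_
  rw [inner_smul_right, ← h2, RKHS.kerFun_apply, hk, gibbsKernel, hc y x]
  ring

variable (H) in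
/-- `kernelMean` as a linear map. -/
noncomputable def kernelMeanLin : (X → ℝ) →ₗ[ℝ] H where
  toFun := kernelMean H
  map_add' := kernelMean_add
  map_smul' := kernelMean_smul

theorem kernelMeanLin_injective (hu : IsUniversal (X := X) H) :
    Function.Injective (kernelMeanLin H : (X → ℝ) →ₗ[ℝ] H) := by
  rw [injective_iff_map_eq_zero]
  intro σ hσ
  have h1 : ∀ h : H, ∑ x, σ x * h x = 0 := fun h => by
    rw [← inner_kernelMean]
    change inner ℝ (kernelMeanLin H σ) h = 0
    rw [hσ, inner_zero_left]
  have h2 : ∀ f : X → ℝ, ∑ x, σ x * f x = 0 := fun f =>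
    hu.induction_on (p := fun f => ∑ x, σ x * f x = 0) f
      (isClosed_eq (by fun_prop) continuous_const) h1
  have h3 := h2 σ
  rw [Finset.sum_eq_zero_iff_of_nonneg fun x _ => mul_self_nonneg _] at h3
  funext x
  exact mul_self_eq_zero.1 (h3 x (Finset.mem_univ x))

theorem kernelMeanLin_surjective : Function.Surjective (kernelMeanLin H : (X → ℝ) →ₗ[ℝ] H) := by
  rw [← LinearMap.range_eq_top, ← Submodule.orthogonal_eq_bot_iff, Submodule.eq_bot_iff]
  intro h hh
  refine DFunLike.ext _ _ fun x => ?_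
  classical
  have h1 : inner ℝ (kernelMeanLin H (Pi.single x (1 : ℝ))) h = 0 :=
    (Submodule.mem_orthogonal _ _).1 hh _ ⟨_, rfl⟩
  change inner ℝ (kernelMean H _) h = 0 at h1
  rw [inner_kernelMean] at h1
  simpa [Pi.single_apply] using h1

theorem finiteDimensional_of_rkhs (X : Type*) [Fintype X] (H : Type*) [NormedAddCommGroup H]
    [InnerProductSpace ℝ H] [CompleteSpace H] [RKHS ℝ H X ℝ] : FiniteDimensional ℝ H :=
  FiniteDimensional.of_surjective (kernelMeanLin H : (X → ℝ) →ₗ[ℝ] H) kernelMeanLin_surjective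

/-- For a universal kernel on a finite set, signed measures are identified with the elements of the
Hilbert space. -/
noncomputable def kernelEquiv (hu : IsUniversal (X := X) H) : (X → ℝ) ≃L[ℝ] H :=
  (LinearEquiv.ofBijective (kernelMeanLin H)
    ⟨kernelMeanLin_injective hu, kernelMeanLin_surjective⟩).toContinuousLinearEquiv

/-- The signed measure `α` whose kernel mean is a given element of the Hilbert space. -/
noncomputable def weights (hu : IsUniversal (X := X) H) : H →L[ℝ] (X → ℝ) :=
  ((kernelEquiv hu).symm : H →L[ℝ] (X → ℝ))

variable (hu : IsUniversal (X := X) H)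

theorem kernelMean_weights (h : H) : kernelMean H (weights hu h) = h :=
  (kernelEquiv hu).apply_symm_apply h

theorem weights_kernelMean (σ : X → ℝ) : weights hu (kernelMean H σ) = σ :=
  (kernelEquiv hu).symm_apply_apply σ

theorem inner_eq_sum_weights (h h' : H) : inner ℝ h h' = ∑ x, weights hu h x * h' x := by
  conv_lhs => rw [← kernelMean_weights hu h]
  exact inner_kernelMean _ _

/-- The image of the simplex under the embedding: the part of the unit sphere on which the weights
are nonnegative. -/
def embSet : Set H := {b | ‖b‖ = 1 ∧ ∀ x, 0 ≤ weights hu b x}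

theorem isClosed_embSet : IsClosed (embSet hu) := by
  have h1 : IsClosed {b : H | ‖b‖ = 1} := isClosed_eq continuous_norm continuous_const
  have h2 : IsClosed {b : H | ∀ x, 0 ≤ weights hu b x} := by
    simp only [Set.ofPred_forall]
    exact isClosed_iInter fun x => isClosed_le continuous_const
      ((continuous_apply x).comp (weights hu).continuous)
  exact h1.inter h2

theorem isCompact_embSet : IsCompact (embSet hu) := by
  have := finiteDimensional_of_rkhs X H
  have := FiniteDimensional.proper ℝ H
  refine Metric.isCompact_of_isClosed_isBounded (isClosed_embSet hu) ?_
  exact isBounded_iff_forall_norm_le.2 ⟨1, fun b hb => hb.1.le⟩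

/-- The inverse of the embedding. -/
noncomputable def unembed (b : H) (x : X) : ℝ := weights hu b x * b x

variable {hu}

theorem apply_pos_of_weights (hc : ∀ x y, c x y = c y x)
    (hk : HasReproducingKernel H (gibbsKernel ε c)) {b : H} (hb : b ≠ 0)
    (hw : ∀ x, 0 ≤ weights hu b x) (y : X) : 0 < b y := by
  rw [← kernelMean_weights hu b, kernelMean_apply hc hk]
  obtain ⟨x, hx⟩ : ∃ x, 0 < weights hu b x := by
    by_contra! hcon
    have : weights hu b = 0 := funext fun x => le_antisymm (hcon x) (hw x)
    refine hb ?_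
    rw [← kernelMean_weights hu b, this]
    simp [kernelMean]
  exact Finset.sum_pos' (fun x _ => mul_nonneg (Real.exp_pos _).le (hw x))
    ⟨x, Finset.mem_univ _, mul_pos (Real.exp_pos _) hx⟩

theorem ne_zero_of_mem_embSet {b : H} (hb : b ∈ embSet hu) : b ≠ 0 := by
  rintro rfl
  simpa using hb.1

theorem apply_pos_of_mem_embSet (hc : ∀ x y, c x y = c y x)
    (hk : HasReproducingKernel H (gibbsKernel ε c)) {b : H} (hb : b ∈ embSet hu) (y : X) :
    0 < b y :=
  apply_pos_of_weights hc hk (ne_zero_of_mem_embSet hb) hb.2 y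

theorem unembed_mem (hc : ∀ x y, c x y = c y x)
    (hk : HasReproducingKernel H (gibbsKernel ε c)) {b : H} (hb : b ∈ embSet hu) :
    unembed hu b ∈ stdSimplex ℝ X := by
  refine ⟨fun x => mul_nonneg (hb.2 x) (apply_pos_of_mem_embSet hc hk hb x).le, ?_⟩
  have h := inner_eq_sum_weights hu b b
  rw [real_inner_self_eq_norm_sq, hb.1] at h
  simpa [unembed] using h.symm

/-- The function `-ε log b` is a fixed point of the Sinkhorn mapping of `b * weights b`, because `b`
is the kernel mean of its weights. -/
theorem selfPotential_unembed (hε : 0 < ε) (hc : ∀ x y, c x y = c y x)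
    (hk : HasReproducingKernel H (gibbsKernel ε c)) {b : H} (hb : b ∈ embSet hu) :
    selfPotential ε c (unembed hu b) = fun x => -ε * Real.log (b x) := by
  refine eq_selfPotential hε hc (unembed_mem hc hk hb) (funext fun y => ?_)
  unfold sinkhornMap
  congr 2
  conv_lhs => rw [← kernelMean_weights hu b, kernelMean_apply hc hk]
  refine Finset.sum_congr rfl fun x _ => ?_
  have hbx := apply_pos_of_mem_embSet hc hk hb x
  change _ = Real.exp ((-ε * Real.log (b x) - c x y) / ε) * _
  rw [show (-ε * Real.log (b x) - c x y) / ε = -Real.log (b x) + -c x y / ε by field_simp; ring,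
    unembed, Real.exp_add, Real.exp_neg, Real.exp_log hbx]
  field_simp

theorem embB_unembed (hε : 0 < ε) (hc : ∀ x y, c x y = c y x)
    (hk : HasReproducingKernel H (gibbsKernel ε c)) {b : H} (hb : b ∈ embSet hu) :
    embB H ε c (unembed hu b) = b := by
  rw [embB, selfPotential_unembed hε hc hk hb]
  conv_rhs => rw [← kernelMean_weights hu b]
  congr 1
  funext x
  have hbx := apply_pos_of_mem_embSet hc hk hb x
  change Real.exp (-ε * Real.log (b x) / ε) * _ = _
  rw [unembed, neg_mul, neg_div, mul_div_cancel_left₀ _ hε.ne', Real.exp_neg, Real.exp_log hbx]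
  field_simp

theorem embB_apply_eq (hε : 0 < ε) (hc : ∀ x y, c x y = c y x)
    (hk : HasReproducingKernel H (gibbsKernel ε c)) {μ : X → ℝ} (hμ : μ ∈ stdSimplex ℝ X) (y : X) :
    embB H ε c μ y = Real.exp (-selfPotential ε c μ y / ε) :=
  embB_apply H hε hc hk hμ (selfPotential_eq hε hc hμ) y

theorem weights_embB (μ : X → ℝ) :
    weights hu (embB H ε c μ) = fun x => Real.exp (selfPotential ε c μ x / ε) * μ x :=
  weights_kernelMean hu _

theorem unembed_embB (hε : 0 < ε) (hc : ∀ x y, c x y = c y x)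
    (hk : HasReproducingKernel H (gibbsKernel ε c)) {μ : X → ℝ} (hμ : μ ∈ stdSimplex ℝ X) :
    unembed hu (embB H ε c μ) = μ := by
  funext x
  rw [unembed, weights_embB, embB_apply_eq hε hc hk hμ, neg_div, Real.exp_neg]
  field_simp

theorem embB_mem (hε : 0 < ε) (hc : ∀ x y, c x y = c y x)
    (hk : HasReproducingKernel H (gibbsKernel ε c)) {μ : X → ℝ} (hμ : μ ∈ stdSimplex ℝ X) :
    embB H ε c μ ∈ embSet hu := by
  refine ⟨?_, fun x => ?_⟩
  · have h := inner_eq_sum_weights hu (embB H ε c μ) (embB H ε c μ)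
    rw [real_inner_self_eq_norm_sq] at h
    have h2 : ∑ x, weights hu (embB H ε c μ) x * embB H ε c μ x = ∑ x, μ x :=
      Finset.sum_congr rfl fun x _ => congrFun (unembed_embB hε hc hk hμ) x
    rw [h2, hμ.2] at h
    nlinarith [norm_nonneg (embB H ε c μ)]
  · rw [weights_embB]
    exact mul_nonneg (Real.exp_pos _).le (hμ.1 x)

variable (hu) in
/-- Uniform bounds for the evaluations, the weights, and the elements of the embedded simplex. -/
theorem exists_embSet_bound (hc : ∀ x y, c x y = c y x)
    (hk : HasReproducingKernel H (gibbsKernel ε c)) : ∃ M : ℝ, 1 ≤ M ∧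
      (∀ (h : H) x, |h x| ≤ M * ‖h‖) ∧ (∀ (h : H) x, |weights hu h x| ≤ M * ‖h‖) ∧
      ∀ b ∈ embSet hu, ∀ x, 1 ≤ M * b x := by
  set M₁ := ‖RKHS.coeCLM (𝕜 := ℝ) (H := H) (X := X) (V := ℝ)‖
  set M₂ := ‖weights hu‖
  obtain ⟨M₃, hM₃⟩ : ∃ M₃ : ℝ, ∀ b ∈ embSet hu, ∀ x, 1 ≤ M₃ * b x := by
    have hx : ∀ x : X, ∃ K : ℝ, 0 ≤ K ∧ ∀ b ∈ embSet hu, 1 ≤ K * b x := by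
      intro x
      rcases (embSet hu).eq_empty_or_nonempty with he | hne
      · exact ⟨0, le_rfl, by simp [he]⟩
      obtain ⟨b₀, hb₀, hmin⟩ := (isCompact_embSet hu).exists_isMinOn hne
        (f := fun b : H => b x) (RKHS.continuous_eval x).continuousOn
      have hpos := apply_pos_of_mem_embSet hc hk hb₀ x
      refine ⟨(b₀ x)⁻¹, by positivity, fun b hb => ?_⟩
      rw [inv_mul_eq_div, one_le_div hpos]
      exact hmin hb
    choose K hK0 hK using hx
    refine ⟨∑ x, K x, fun b hb x => (hK x b hb).trans ?_⟩
    exact mul_le_mul_of_nonneg_right (Finset.single_le_sum (fun y _ => hK0 y) (Finset.mem_univ x))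
      (apply_pos_of_mem_embSet hc hk hb x).le
  have h1 : ∀ r ≤ max (max M₁ M₂) (max M₃ 1), ∀ s : ℝ, 0 ≤ s →
      r * s ≤ max (max M₁ M₂) (max M₃ 1) * s := fun r hr s hs => mul_le_mul_of_nonneg_right hr hs
  refine ⟨max (max M₁ M₂) (max M₃ 1), by simp, fun h x => ?_, fun h x => ?_, fun b hb x => ?_⟩
  · refine le_trans ?_ (h1 M₁ (by simp) _ (norm_nonneg h))
    refine le_trans ?_ ((RKHS.coeCLM (𝕜 := ℝ) (H := H) (X := X) (V := ℝ)).le_opNorm h)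
    exact norm_le_pi_norm (f := fun x => h x) x
  · refine le_trans ?_ (h1 M₂ (by simp) _ (norm_nonneg h))
    exact (norm_le_pi_norm (weights hu h) x).trans ((weights hu).le_opNorm h)
  · exact (hM₃ b hb x).trans (h1 M₃ (by simp) _ (apply_pos_of_mem_embSet hc hk hb x).le)

theorem inner_embB (hc : ∀ x y, c x y = c y x)
    (hk : HasReproducingKernel H (gibbsKernel ε c)) (μ ν : X → ℝ) :
    inner ℝ (embB H ε c μ) (embB H ε c ν) =
      ∑ x, ∑ y, Real.exp ((selfPotential ε c μ x + selfPotential ε c ν y - c x y) / ε)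
        * (μ x * ν y) := by
  rw [embB, inner_kernelMean]
  refine Finset.sum_congr rfl fun x _ => ?_
  rw [embB, kernelMean_apply hc hk, Finset.mul_sum]
  refine Finset.sum_congr rfl fun y _ => ?_
  rw [hc y x, show (selfPotential ε c μ x + selfPotential ε c ν y - c x y) / ε
    = selfPotential ε c μ x / ε + (-c x y / ε + selfPotential ε c ν y / ε) by ring, Real.exp_add,
    Real.exp_add]
  ring

/-- The Sinkhorn divergence dominates the squared distance of the embeddings. -/
theorem norm_sq_le_sinkhornDivergence (hu : IsUniversal (X := X) H) (hε : 0 < ε)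
    (hc : ∀ x y, c x y = c y x)
    (hk : HasReproducingKernel H (gibbsKernel ε c)) {μ ν : X → ℝ} (hμ : μ ∈ stdSimplex ℝ X)
    (hν : ν ∈ stdSimplex ℝ X) :
    ε / 2 * ‖embB H ε c μ - embB H ε c ν‖ ^ 2 ≤ sinkhornDivergence ε c μ ν := by
  refine le_trans (le_of_eq ?_) (le_sinkhornDivergence hε hc hμ hν)
  rw [← inner_embB (H := H) hc hk, norm_sub_sq_real, (embB_mem (hu := hu) hε hc hk hμ).1,
    (embB_mem (hu := hu) hε hc hk hν).1]
  ring

variable (hu) in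
/-- The skew-symmetric form `(b, z) ↦ (2 / ε) ∑ V (b ζ - α z)`, where `α` and `ζ` are the weights of
`b` and `z`: it is, up to the factor, multiplication by `V` minus its adjoint. -/
noncomputable def skewForm (ε : ℝ) (V : X → ℝ) : H →L[ℝ] H →L[ℝ] ℝ :=
  ∑ x, (2 / ε * V x) •
    (((ContinuousLinearMap.proj x).comp (RKHS.coeCLM (𝕜 := ℝ) (H := H) (X := X) (V := ℝ))
      : H →L[ℝ] ℝ).smulRight
        (((ContinuousLinearMap.proj x).comp (weights hu) : H →L[ℝ] ℝ))
    - ((ContinuousLinearMap.proj x).comp (weights hu) : H →L[ℝ] ℝ).smulRight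
        ((ContinuousLinearMap.proj x).comp (RKHS.coeCLM (𝕜 := ℝ) (H := H) (X := X) (V := ℝ))
      : H →L[ℝ] ℝ))

theorem skewForm_apply (V : X → ℝ) (b z : H) :
    skewForm hu ε V b z = 2 / ε * ∑ x, V x * (b x * weights hu z x - weights hu b x * z x) := by
  simp [skewForm, Finset.mul_sum, mul_assoc]

theorem skewForm_self (V : X → ℝ) (b : H) : skewForm hu ε V b b = 0 := by
  rw [skewForm_apply, Finset.sum_eq_zero fun x _ => by ring, mul_zero]

end Embedded

/-! ### Expansion of the Schrödinger system near the diagonal -/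

section Expansion

variable {X : Type*} [Fintype X]

/-- The integral operator of a kernel on a finite set. -/
def intOp (k : X → X → ℝ) (σ : X → ℝ) (y : X) : ℝ := ∑ x, k x y * σ x

theorem intOp_add (k : X → X → ℝ) (σ₁ σ₂ : X → ℝ) (y : X) :
    intOp k (fun x => σ₁ x + σ₂ x) y = intOp k σ₁ y + intOp k σ₂ y := by
  simp [intOp, mul_add, Finset.sum_add_distrib]

theorem intOp_mono {k : X → X → ℝ} (hk0 : ∀ x y, 0 ≤ k x y) {σ₁ σ₂ : X → ℝ}
    (h : ∀ x, σ₁ x ≤ σ₂ x) (y : X) : intOp k σ₁ y ≤ intOp k σ₂ y :=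
  Finset.sum_le_sum fun x _ => mul_le_mul_of_nonneg_left (h x) (hk0 x y)

theorem intOp_const_mul (k : X → X → ℝ) (r : ℝ) (σ : X → ℝ) (y : X) :
    intOp k (fun x => r * σ x) y = r * intOp k σ y := by
  simp only [intOp, Finset.mul_sum]
  exact Finset.sum_congr rfl fun x _ => by ring

theorem abs_intOp_le_sum {k : X → X → ℝ} (hk0 : ∀ x y, 0 ≤ k x y) (hk1 : ∀ x y, k x y ≤ 1)
    (σ : X → ℝ) (y : X) : |intOp k σ y| ≤ ∑ x, |σ x| := by
  refine (Finset.abs_sum_le_sum_abs _ _).trans (Finset.sum_le_sum fun x _ => ?_)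
  rw [abs_mul, abs_of_nonneg (hk0 x y)]
  exact mul_le_of_le_one_left (abs_nonneg _) (hk1 x y)

theorem abs_intOp_le {k : X → X → ℝ} (hk0 : ∀ x y, 0 ≤ k x y) (hk1 : ∀ x y, k x y ≤ 1)
    {σ : X → ℝ} {s : ℝ} (h : ∀ x, |σ x| ≤ s) (y : X) :
    |intOp k σ y| ≤ Fintype.card X * s := by
  refine (abs_intOp_le_sum hk0 hk1 σ y).trans ?_
  refine (Finset.sum_le_sum fun x _ => h x).trans ?_
  simp

/-- If `m` solves `b m + K (α m) = r`, with `b = K α` bounded below and `K` positive semidefinite,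
then `m` is controlled by the right-hand side. This is the invertibility of `Id + K_μ`. -/
theorem abs_le_of_add_intOp_eq {k : X → X → ℝ} (hk0 : ∀ x y, 0 ≤ k x y) (hk1 : ∀ x y, k x y ≤ 1)
    (hpsd : ∀ σ : X → ℝ, 0 ≤ ∑ y, σ y * intOp k σ y) {M δ : ℝ} (hδ : 0 ≤ δ)
    {α b m r : X → ℝ} (hα0 : ∀ x, 0 ≤ α x) (hα : ∀ x, α x ≤ M) (hb : ∀ x, 1 ≤ M * b x)
    (hM : 1 ≤ M) (hr : ∀ x, |r x| ≤ δ)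
    (h : ∀ x, b x * m x + intOp k (fun y => α y * m y) x = r x) :
    (∀ x, |intOp k (fun y => α y * m y) x| ≤ Fintype.card X * M ^ 2 * δ) := by
  set S := ∑ x, α x * |m x| with hS
  set Q := ∑ x, α x * m x ^ 2 with hQ
  have hS0 : 0 ≤ S := Finset.sum_nonneg fun x _ => mul_nonneg (hα0 x) (abs_nonneg _)
  have hQ0 : 0 ≤ Q := Finset.sum_nonneg fun x _ => mul_nonneg (hα0 x) (sq_nonneg _)
  have h1 : Q ≤ M * (δ * S) := by
    have e1 : ∑ x, α x * m x * r x
        = ∑ x, b x * (α x * m x ^ 2) + ∑ x, (α x * m x) * intOp k (fun y => α y * m y) x := by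
      rw [← Finset.sum_add_distrib]
      exact Finset.sum_congr rfl fun x _ => by rw [← h x]; ring
    have e2 : ∑ x, α x * m x * r x ≤ δ * S := by
      rw [hS, Finset.mul_sum]
      refine Finset.sum_le_sum fun x _ => ?_
      calc α x * m x * r x ≤ |α x * m x * r x| := le_abs_self _
        _ = α x * |m x| * |r x| := by rw [abs_mul, abs_mul, abs_of_nonneg (hα0 x)]
        _ ≤ α x * |m x| * δ :=
          mul_le_mul_of_nonneg_left (hr x) (mul_nonneg (hα0 x) (abs_nonneg _))
        _ = _ := by ring
    have e3 : Q ≤ M * ∑ x, b x * (α x * m x ^ 2) := by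
      rw [hQ, Finset.mul_sum]
      refine Finset.sum_le_sum fun x _ => ?_
      rw [← mul_assoc]
      exact le_mul_of_one_le_left (mul_nonneg (hα0 x) (sq_nonneg _)) (hb x)
    have e4 := hpsd fun y => α y * m y
    refine e3.trans (mul_le_mul_of_nonneg_left ?_ (by linarith))
    linarith
  have h2 : S ^ 2 ≤ Fintype.card X * M * Q := by
    have e1 := Finset.sum_mul_sq_le_sq_mul_sq Finset.univ (fun x => √(α x))
      (fun x => √(α x) * |m x|)
    have e2 : ∀ x, √(α x) * (√(α x) * |m x|) = α x * |m x| := fun x => by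
      rw [← mul_assoc, Real.mul_self_sqrt (hα0 x)]
    have e3 : ∀ x, (√(α x) * |m x|) ^ 2 = α x * m x ^ 2 := fun x => by
      rw [mul_pow, Real.sq_sqrt (hα0 x), sq_abs]
    simp only [e2, e3, Real.sq_sqrt (hα0 _)] at e1
    refine e1.trans (mul_le_mul_of_nonneg_right ?_ hQ0)
    exact (Finset.sum_le_sum fun x _ => hα x).trans (by simp)
  have h3 : S ≤ Fintype.card X * M ^ 2 * δ := by
    rcases hS0.eq_or_lt with h0 | hpos
    · rw [← h0]; positivity
    · have : S * S ≤ (Fintype.card X * M ^ 2 * δ) * S := by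
        have := mul_le_mul_of_nonneg_left h1 (by positivity : (0 : ℝ) ≤ Fintype.card X * M)
        nlinarith
      exact le_of_mul_le_mul_right this hpos
  intro x
  refine (abs_intOp_le_sum hk0 hk1 _ x).trans (le_trans (le_of_eq ?_) h3)
  exact Finset.sum_congr rfl fun y _ => by rw [abs_mul, abs_of_nonneg (hα0 y)]

/-- Second-order expansion of the Schrödinger system `b = U K(W α')`, `b' = W K(U α)` around
`U = W = 1`, with constants that depend only on the uniform bound `M`. A priori, `U - 1` is only
known to be of order `τ` on the support of `α`. -/
theorem schrodinger_expansion {k : X → X → ℝ} (hk0 : ∀ x y, 0 ≤ k x y) (hk1 : ∀ x y, k x y ≤ 1)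
    (hpsd : ∀ σ : X → ℝ, 0 ≤ ∑ y, σ y * intOp k σ y) {M : ℝ} (hM : 1 ≤ M) :
    ∃ C : ℝ, 0 ≤ C ∧ ∀ (τ : ℝ) (α α' b b' U W : X → ℝ), 0 < τ → τ ≤ 1 →
      (∀ x, b x = intOp k α x) → (∀ x, b' x = intOp k α' x) →
      (∀ x, 0 ≤ α x) → (∀ x, 0 ≤ α' x) → (∀ x, α x ≤ M) → (∀ x, α' x ≤ M) →
      (∀ x, 1 ≤ M * b x) → (∀ x, 1 ≤ M * b' x) → (∀ x, b x ≤ M) → (∀ x, b' x ≤ M) →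
      (∀ x, |b x - b' x| ≤ M * τ) → (∀ x, |α x - α' x| ≤ M * τ) →
      (∀ x, 0 < U x) → (∀ x, 0 < W x) →
      (∀ x, b x = U x * intOp k (fun y => W y * α' y) x) →
      (∀ x, b' x = W x * intOp k (fun y => U y * α y) x) →
      (∀ x, α x ≠ 0 → |U x - 1| ≤ M * τ) → (∀ x, α x ≠ 0 → 1 ≤ M * U x) →
      ∀ x, |b x - b' x - (b x * (U x - 1) - intOp k (fun y => α y * (U y - 1)) x)| ≤ C * τ ^ 2 := by
  set N : ℝ := (Fintype.card X : ℝ) with hN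
  have hN0 : 0 ≤ N := Nat.cast_nonneg _
  have hM0 : 0 < M := by linarith
  obtain ⟨C₁, hC₁⟩ : ∃ C₁ : ℝ, C₁ = M ^ 2 * (M + N * M ^ 2) := ⟨_, rfl⟩
  obtain ⟨C₂, hC₂⟩ : ∃ C₂ : ℝ, C₂ = M * (N * ((1 + M) * M)) := ⟨_, rfl⟩
  obtain ⟨C₃, hC₃⟩ : ∃ C₃ : ℝ, C₃ = C₂ * M * (M + N * (C₁ * M)) := ⟨_, rfl⟩
  obtain ⟨C₄, hC₄⟩ : ∃ C₄ : ℝ, C₄ = M * (N * ((1 + C₁) * M)) := ⟨_, rfl⟩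
  obtain ⟨C₅, hC₅⟩ : ∃ C₅ : ℝ,
    C₅ = M * C₃ ^ 2 * C₄ + M * C₁ ^ 2 * C₂ + M * C₁ + N * (C₁ * M) := ⟨_, rfl⟩
  have p₁ : 0 ≤ C₁ := by rw [hC₁]; positivity
  have p₂ : 0 ≤ C₂ := by rw [hC₂]; positivity
  have p₃ : 0 ≤ C₃ := by rw [hC₃]; positivity
  have p₄ : 0 ≤ C₄ := by rw [hC₄]; positivity
  have p₅ : 0 ≤ C₅ := by rw [hC₅]; positivity
  refine ⟨N * (C₁ * M) + N * M ^ 2 * C₅ + M * C₃ ^ 2 * C₄, by positivity, ?_⟩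
  intro τ α α' b b' U W hτ hτ1 hb hb' hα0 hα0' hα hα' hbl hbl' hbu hbu' hbb hαα hU0 hW0 hUW hWU
    hU1 hUl
  have bpos : ∀ x, 0 < b x := fun x => pos_of_mul_pos_right (zero_lt_one.trans_le (hbl x)) hM0.le
  have bpos' : ∀ x, 0 < b' x := fun x =>
    pos_of_mul_pos_right (zero_lt_one.trans_le (hbl' x)) hM0.le
  set ξ : X → ℝ := fun x => U x - 1 with hξ
  set ω : X → ℝ := fun x => W x - 1 with hω
  -- the first bounds: `ω = O(τ)` and `W` is bounded below
  have hξα : ∀ x, |α x * ξ x| ≤ M * (M * τ) := by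
    intro x
    by_cases h0 : α x = 0
    · rw [h0, zero_mul, abs_zero]; positivity
    · rw [abs_mul, abs_of_nonneg (hα0 x)]
      exact mul_le_mul (hα x) (hU1 x h0) (abs_nonneg _) hM0.le
  have hKUα : ∀ x, intOp k (fun y => U y * α y) x = b x + intOp k (fun y => α y * ξ y) x := by
    intro x
    rw [hb, ← intOp_add]
    congr 1
    funext y
    simp only [hξ]; ring
  have hKUα_lb : ∀ x, 1 ≤ M ^ 2 * intOp k (fun y => U y * α y) x := by
    intro x
    have h1 : b x ≤ M * intOp k (fun y => U y * α y) x := by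
      rw [hb, ← intOp_const_mul]
      refine intOp_mono hk0 (fun y => ?_) x
      by_cases h0 : α y = 0
      · simp [h0]
      · rw [← mul_assoc]
        exact le_mul_of_one_le_left (hα0 y) (hUl y h0)
    have h2 := mul_le_mul_of_nonneg_left h1 hM0.le
    nlinarith [hbl x]
  have hKUα_pos : ∀ x, 0 < intOp k (fun y => U y * α y) x := fun x =>
    pos_of_mul_pos_right (zero_lt_one.trans_le (hKUα_lb x)) (by positivity)
  have hω1 : ∀ x, |ω x| ≤ C₁ * τ := by
    intro x
    have e1 : ω x * intOp k (fun y => U y * α y) x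
        = b' x - b x - intOp k (fun y => α y * ξ y) x := by
      have e0 : ω x * intOp k (fun y => U y * α y) x
          = W x * intOp k (fun y => U y * α y) x - intOp k (fun y => U y * α y) x := by
        simp only [hω]; ring
      rw [e0, ← hWU x, hKUα x]
      ring
    have e2 : |ω x| * intOp k (fun y => U y * α y) x ≤ M * τ + N * (M * (M * τ)) := by
      rw [← abs_of_pos (hKUα_pos x), ← abs_mul, e1]
      refine (abs_sub _ _).trans (add_le_add ?_ (abs_intOp_le hk0 hk1 hξα x))
      rw [abs_sub_comm]; exact hbb x
    have e3 : |ω x| ≤ M ^ 2 * (|ω x| * intOp k (fun y => U y * α y) x) := by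
      have := mul_le_mul_of_nonneg_left (hKUα_lb x) (abs_nonneg (ω x))
      linarith
    refine e3.trans ((mul_le_mul_of_nonneg_left e2 (by positivity)).trans (le_of_eq ?_))
    rw [hC₁]; ring
  have hWl : ∀ x, 1 ≤ C₂ * W x := by
    intro x
    have e1 : intOp k (fun y => U y * α y) x ≤ N * ((1 + M) * M) := by
      refine (le_abs_self _).trans (abs_intOp_le hk0 hk1 (fun y => ?_) x)
      by_cases h0 : α y = 0
      · rw [h0, mul_zero, abs_zero]; positivity
      · rw [abs_of_nonneg (mul_nonneg (hU0 y).le (hα0 y))]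
        refine mul_le_mul ?_ (hα y) (hα0 y) (by linarith)
        have := (abs_le.1 (hU1 y h0)).2
        nlinarith
    calc (1 : ℝ) ≤ M * b' x := hbl' x
      _ = M * W x * intOp k (fun y => U y * α y) x := by rw [hWU x]; ring
      _ ≤ M * W x * (N * ((1 + M) * M)) :=
        mul_le_mul_of_nonneg_left e1 (mul_nonneg hM0.le (hW0 x).le)
      _ = C₂ * W x := by rw [hC₂]; ring
  -- bootstrapping: `ξ = O(τ)` everywhere and `U` is bounded below
  have hωα' : ∀ x, |α' x * ω x| ≤ C₁ * M * τ := by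
    intro x
    rw [abs_mul, abs_of_nonneg (hα0' x)]
    refine (mul_le_mul (hα' x) (hω1 x) (abs_nonneg _) hM0.le).trans (le_of_eq (by ring))
  have hKWα : ∀ x, intOp k (fun y => W y * α' y) x = b' x + intOp k (fun y => α' y * ω y) x := by
    intro x
    rw [hb', ← intOp_add]
    congr 1
    funext y
    simp only [hω]; ring
  have hKWα_lb : ∀ x, 1 ≤ C₂ * M * intOp k (fun y => W y * α' y) x := by
    intro x
    have h1 : b' x ≤ C₂ * intOp k (fun y => W y * α' y) x := by
      rw [hb', ← intOp_const_mul]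
      refine intOp_mono hk0 (fun y => ?_) x
      rw [← mul_assoc]
      exact le_mul_of_one_le_left (hα0' y) (hWl y)
    have h2 := mul_le_mul_of_nonneg_left h1 hM0.le
    nlinarith [hbl' x]
  have hKWα_pos : ∀ x, 0 < intOp k (fun y => W y * α' y) x := fun x =>
    pos_of_mul_pos_right (zero_lt_one.trans_le (hKWα_lb x)) (by positivity)
  have hξ1 : ∀ x, |ξ x| ≤ C₃ * τ := by
    intro x
    have e1 : ξ x * intOp k (fun y => W y * α' y) x
        = b x - b' x - intOp k (fun y => α' y * ω y) x := by
      have e0 : ξ x * intOp k (fun y => W y * α' y) x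
          = U x * intOp k (fun y => W y * α' y) x - intOp k (fun y => W y * α' y) x := by
        simp only [hξ]; ring
      rw [e0, ← hUW x, hKWα x]
      ring
    have e2 : |ξ x| * intOp k (fun y => W y * α' y) x ≤ M * τ + N * (C₁ * M * τ) := by
      rw [← abs_of_pos (hKWα_pos x), ← abs_mul, e1]
      exact (abs_sub _ _).trans (add_le_add (hbb x) (abs_intOp_le hk0 hk1 hωα' x))
    have e3 : |ξ x| ≤ C₂ * M * (|ξ x| * intOp k (fun y => W y * α' y) x) := by
      have := mul_le_mul_of_nonneg_left (hKWα_lb x) (abs_nonneg (ξ x))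
      linarith
    refine e3.trans ((mul_le_mul_of_nonneg_left e2 (by positivity)).trans (le_of_eq ?_))
    rw [hC₃]; ring
  have hUl' : ∀ x, 1 ≤ C₄ * U x := by
    intro x
    have e1 : intOp k (fun y => W y * α' y) x ≤ N * ((1 + C₁) * M) := by
      refine (le_abs_self _).trans (abs_intOp_le hk0 hk1 (fun y => ?_) x)
      rw [abs_of_nonneg (mul_nonneg (hW0 y).le (hα0' y))]
      refine mul_le_mul ?_ (hα' y) (hα0' y) (by linarith)
      have := (abs_le.1 (hω1 y)).2
      simp only [hω] at this
      nlinarith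
    calc (1 : ℝ) ≤ M * b x := hbl x
      _ = M * U x * intOp k (fun y => W y * α' y) x := by rw [hUW x]; ring
      _ ≤ M * U x * (N * ((1 + C₁) * M)) :=
        mul_le_mul_of_nonneg_left e1 (mul_nonneg hM0.le (hU0 x).le)
      _ = C₄ * U x := by rw [hC₄]; ring
  -- the two expanded equations
  have hE1 : ∀ x, b x - b x * ξ x + b x * ξ x ^ 2 / U x
      = b' x + intOp k (fun y => α' y * ω y) x := by
    intro x
    rw [← hKWα x]
    have hne := (hU0 x).ne'
    have : b x - b x * ξ x + b x * ξ x ^ 2 / U x = b x / U x := by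
      simp only [hξ]; field_simp; ring
    rw [this, div_eq_iff hne, hUW x]; ring
  have hE2 : ∀ x, b' x - b' x * ω x + b' x * ω x ^ 2 / W x
      = b x + intOp k (fun y => α y * ξ y) x := by
    intro x
    rw [← hKUα x]
    have hne := (hW0 x).ne'
    have : b' x - b' x * ω x + b' x * ω x ^ 2 / W x = b' x / W x := by
      simp only [hω]; field_simp; ring
    rw [this, div_eq_iff hne, hWU x]; ring
  have q1 : ∀ x, |b x * ξ x ^ 2 / U x| ≤ M * C₃ ^ 2 * C₄ * τ ^ 2 := by
    intro x
    rw [abs_of_nonneg (div_nonneg (mul_nonneg (bpos x).le (sq_nonneg _)) (hU0 x).le),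
      div_le_iff₀ (hU0 x)]
    have e1 : ξ x ^ 2 ≤ (C₃ * τ) ^ 2 := sq_le_sq' (abs_le.1 (hξ1 x)).1 (abs_le.1 (hξ1 x)).2
    calc b x * ξ x ^ 2 ≤ M * (C₃ * τ) ^ 2 := mul_le_mul (hbu x) e1 (sq_nonneg _) hM0.le
      _ ≤ M * (C₃ * τ) ^ 2 * (C₄ * U x) := le_mul_of_one_le_right (by positivity) (hUl' x)
      _ = _ := by ring
  have q2 : ∀ x, |b' x * ω x ^ 2 / W x| ≤ M * C₁ ^ 2 * C₂ * τ ^ 2 := by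
    intro x
    rw [abs_of_nonneg (div_nonneg (mul_nonneg (bpos' x).le (sq_nonneg _)) (hW0 x).le),
      div_le_iff₀ (hW0 x)]
    have e1 : ω x ^ 2 ≤ (C₁ * τ) ^ 2 := sq_le_sq' (abs_le.1 (hω1 x)).1 (abs_le.1 (hω1 x)).2
    calc b' x * ω x ^ 2 ≤ M * (C₁ * τ) ^ 2 := mul_le_mul (hbu' x) e1 (sq_nonneg _) hM0.le
      _ ≤ M * (C₁ * τ) ^ 2 * (C₂ * W x) := le_mul_of_one_le_right (by positivity) (hWl x)
      _ = _ := by ring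
  have q3 : ∀ x, |(b x - b' x) * ω x| ≤ M * C₁ * τ ^ 2 := by
    intro x
    rw [abs_mul]
    exact (mul_le_mul (hbb x) (hω1 x) (abs_nonneg _) (by positivity)).trans (le_of_eq (by ring))
  have q4 : ∀ x, |intOp k (fun y => (α y - α' y) * ω y) x| ≤ N * (C₁ * M) * τ ^ 2 := by
    intro x
    refine (abs_intOp_le (s := M * C₁ * τ ^ 2) hk0 hk1 (fun y => ?_) x).trans (le_of_eq (by ring))
    rw [abs_mul]
    exact (mul_le_mul (hαα y) (hω1 y) (abs_nonneg _) (by positivity)).trans (le_of_eq (by ring))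
  have hKsplit : ∀ x, intOp k (fun y => α y * ω y) x
      = intOp k (fun y => α' y * ω y) x + intOp k (fun y => (α y - α' y) * ω y) x := by
    intro x
    rw [← intOp_add]
    congr 1
    funext y
    ring
  have hKm : ∀ x, intOp k (fun y => α y * (ξ y + ω y)) x
      = intOp k (fun y => α y * ξ y) x + intOp k (fun y => α y * ω y) x := by
    intro x
    rw [← intOp_add]
    congr 1
    funext y
    ring
  -- `ξ + ω` is of second order
  have hm := abs_le_of_add_intOp_eq hk0 hk1 hpsd (δ := C₅ * τ ^ 2) (by positivity)
    (m := fun x => ξ x + ω x)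
    (r := fun x => b x * ξ x ^ 2 / U x + b' x * ω x ^ 2 / W x + (b x - b' x) * ω x
      + intOp k (fun y => (α y - α' y) * ω y) x) hα0 hα hbl hM
    (fun x => by
      refine (abs_add_le _ _).trans ?_
      refine (add_le_add ((abs_add_le _ _).trans (add_le_add ((abs_add_le _ _).trans
        (add_le_add (q1 x) (q2 x))) (q3 x))) (q4 x)).trans (le_of_eq ?_)
      rw [hC₅]; ring)
    (fun x => by
      rw [hKm x, hKsplit x]
      linarith [hE1 x, hE2 x])
  intro x
  have hfinal : b x - b' x - (b x * ξ x - intOp k (fun y => α y * ξ y) x)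
      = intOp k (fun y => α y * (ξ y + ω y)) x - intOp k (fun y => (α y - α' y) * ω y) x
        - b x * ξ x ^ 2 / U x := by
    rw [hKm x, hKsplit x]
    linarith [hE1 x]
  change |b x - b' x - (b x * ξ x - intOp k (fun y => α y * ξ y) x)| ≤ _
  rw [hfinal]
  refine (abs_sub _ _).trans ?_
  refine (add_le_add ((abs_sub _ _).trans (add_le_add (hm x) (q4 x))) (q1 x)).trans (le_of_eq ?_)
  ring

end Expansion

/-! ### One step of the scheme as an evolution variational inequality -/

section Step

variable {X : Type*} [Fintype X] {H : Type*} [NormedAddCommGroup H] [InnerProductSpace ℝ H]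
  [CompleteSpace H] [RKHS ℝ H X ℝ] {ε : ℝ} {c : X → X → ℝ} {hu : IsUniversal (X := X) H}

theorem exp_sub_one_bounds {h : ℝ} :
    |Real.exp h - 1| ≤ |h| * Real.exp |h| ∧ Real.exp h - 1 - h ≤ |h| ^ 2 * Real.exp |h| := by
  have h1 := Real.add_one_le_exp h
  have h2 : Real.exp h - 1 ≤ h * Real.exp h := by
    have := Real.add_one_le_exp (-h)
    have h3 := mul_le_mul_of_nonneg_right this (Real.exp_pos h).le
    rw [← Real.exp_add] at h3
    simp at h3
    linarith
  have key : |Real.exp h - 1| ≤ |h| * Real.exp |h| := by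
    rcases le_total 0 h with h0 | h0
    · rw [abs_of_nonneg h0, abs_of_nonneg (by linarith)]
      exact h2
    · have h4 : Real.exp h ≤ 1 := Real.exp_le_one_iff.2 h0
      rw [abs_of_nonpos (by linarith)]
      have h5 : |h| ≤ |h| * Real.exp |h| :=
        le_mul_of_one_le_right (abs_nonneg h) (Real.one_le_exp (abs_nonneg h))
      rw [abs_of_nonpos h0] at h5 ⊢
      linarith
  refine ⟨key, ?_⟩
  calc Real.exp h - 1 - h ≤ h * (Real.exp h - 1) := by linarith
    _ ≤ |h| * |Real.exp h - 1| := by rw [← abs_mul]; exact le_abs_self _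
    _ ≤ |h| * (|h| * Real.exp |h|) := mul_le_mul_of_nonneg_left key (abs_nonneg h)
    _ = _ := by ring

/-- A step of the scheme moves by `O(τ)`, since the Sinkhorn divergence controls the
squared distance and the potential energy is Lipschitz. -/
theorem exists_sjko_dist_le (hu : IsUniversal (X := X) H) (hε : 0 < ε) (hc : ∀ x y, c x y = c y x)
    (hk : HasReproducingKernel H (gibbsKernel ε c)) (V : X → ℝ) :
    ∃ C : ℝ, 0 ≤ C ∧ ∀ τ : ℝ, 0 < τ → ∀ μ ∈ stdSimplex ℝ X, ∀ ν ∈ stdSimplex ℝ X,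
      IsMinOn (fun ρ => potentialEnergy V ρ + 1 / (2 * τ) * sinkhornDivergence ε c ρ ν)
        (stdSimplex ℝ X) μ → ‖embB H ε c μ - embB H ε c ν‖ ≤ C * τ := by
  obtain ⟨M, hM, hev, hw, -⟩ := exists_embSet_bound hu hc hk
  refine ⟨8 * M ^ 2 * (∑ x, |V x|) / ε, by positivity, fun τ hτ μ hμ ν hν hmin => ?_⟩
  have hbμ := embB_mem (hu := hu) hε hc hk hμ
  have hbν := embB_mem (hu := hu) hε hc hk hν
  set b := embB H ε c μ with hb
  set b' := embB H ε c ν with hb'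
  have h1 := hmin hν
  simp only [Set.mem_ofPred_eq, sinkhornDivergence_self, mul_zero, add_zero] at h1
  have h2 := norm_sq_le_sinkhornDivergence hu hε hc hk hμ hν
  rw [← hb, ← hb'] at h2
  have h3 : potentialEnergy V ν - potentialEnergy V μ
      ≤ (∑ x, |V x|) * (2 * M ^ 2 * ‖b - b'‖) := by
    rw [potentialEnergy, potentialEnergy, ← Finset.sum_sub_distrib, Finset.sum_mul]
    refine Finset.sum_le_sum fun x _ => ?_
    have e1 : ν x = weights hu b' x * b' x := (congrFun (unembed_embB hε hc hk hν) x).symm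
    have e2 : μ x = weights hu b x * b x := (congrFun (unembed_embB hε hc hk hμ) x).symm
    have e3 : ν x - μ x = weights hu b' x * (b' - b) x + weights hu (b' - b) x * b x := by
      rw [e1, e2, map_sub, RKHS.coe_sub, Pi.sub_apply, Pi.sub_apply]; ring
    have e4 : |ν x - μ x| ≤ 2 * M ^ 2 * ‖b - b'‖ := by
      have a1 := hw b' x
      have a2 := hev b x
      rw [hbν.1] at a1
      rw [hbμ.1] at a2
      have a3 := hw (b' - b) x
      have a4 := hev (b' - b) x
      rw [norm_sub_rev] at a3 a4
      rw [e3]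
      refine (abs_add_le _ _).trans ?_
      rw [abs_mul, abs_mul]
      have m1 := mul_le_mul a1 a4 (abs_nonneg _) (by positivity)
      have m2 := mul_le_mul a3 a2 (abs_nonneg _) (by positivity)
      linarith
    calc ν x * V x - μ x * V x = V x * (ν x - μ x) := by ring
      _ ≤ |V x| * |ν x - μ x| := by rw [← abs_mul]; exact le_abs_self _
      _ ≤ _ := mul_le_mul_of_nonneg_left e4 (abs_nonneg _)
  have h4 : sinkhornDivergence ε c μ ν ≤ 2 * τ * ((∑ x, |V x|) * (2 * M ^ 2 * ‖b - b'‖)) := by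
    have e1 : 1 / (2 * τ) * sinkhornDivergence ε c μ ν
        ≤ (∑ x, |V x|) * (2 * M ^ 2 * ‖b - b'‖) := by linarith
    rw [one_div, inv_mul_le_iff₀ (by positivity)] at e1
    exact e1
  rcases (norm_nonneg (b - b')).eq_or_lt with h0 | hpos
  · rw [← h0]; positivity
  · have h5 : ‖b - b'‖ * ‖b - b'‖ ≤ 8 * M ^ 2 * (∑ x, |V x|) / ε * τ * ‖b - b'‖ := by
      have h6 := h2.trans h4
      rw [show 8 * M ^ 2 * (∑ x, |V x|) / ε * τ * ‖b - b'‖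
        = 2 / ε * (2 * τ * ((∑ x, |V x|) * (2 * M ^ 2 * ‖b - b'‖))) by ring]
      calc ‖b - b'‖ * ‖b - b'‖ = 2 / ε * (ε / 2 * ‖b - b'‖ ^ 2) := by field_simp
        _ ≤ _ := mul_le_mul_of_nonneg_left h6 (by positivity)
    exact le_of_mul_le_mul_right h5 hpos

/-- The Schrödinger system of `(μ, ν)` relates the embeddings of `μ` and `ν` through the differences
between `f`, `g` and the self-transport potentials. The constant `κ` reflects that the system is
invariant under `(f - κ, g + κ)`. -/
theorem IsSchrodingerPair.embB_eq (hε : 0 < ε) (hc : ∀ x y, c x y = c y x)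
    (hk : HasReproducingKernel H (gibbsKernel ε c)) {μ ν f g : X → ℝ} (hμ : μ ∈ stdSimplex ℝ X)
    (hν : ν ∈ stdSimplex ℝ X) (h : IsSchrodingerPair ε c μ ν f g) (κ : ℝ) (x : X) :
    embB H ε c μ x = Real.exp ((f x - selfPotential ε c μ x - κ) / ε) *
      intOp (gibbsKernel ε c) (fun y => Real.exp ((g y - selfPotential ε c ν y + κ) / ε) *
        (Real.exp (selfPotential ε c ν y / ε) * ν y)) x := by
  have h1 := (eq_sinkhornMap_iff hε hc hν).1 h.fst_eq x
  rw [embB_apply_eq hε hc hk hμ, intOp, ← mul_one (Real.exp (-selfPotential ε c μ x / ε)), ← h1,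
    Finset.mul_sum, Finset.mul_sum]
  refine Finset.sum_congr rfl fun y _ => ?_
  simp only [gibbsKernel, ← mul_assoc, ← Real.exp_add]
  rw [hc y x]
  congr 2
  ring

/-- One step of the scheme is an implicit Euler step for the evolution variational inequality of
`skewForm`, up to an error of order `τ²`. -/
theorem exists_sjko_step_inner_le (hu : IsUniversal (X := X) H) (hε : 0 < ε)
    (hc : ∀ x y, c x y = c y x) (hc0 : ∀ x y, 0 ≤ c x y)
    (hk : HasReproducingKernel H (gibbsKernel ε c)) (V : X → ℝ) :
    ∃ C : ℝ, 0 ≤ C ∧ ∀ τ : ℝ, 0 < τ → τ ≤ 1 → ∀ μ ∈ stdSimplex ℝ X, ∀ ν ∈ stdSimplex ℝ X,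
      IsMinOn (fun ρ => potentialEnergy V ρ + 1 / (2 * τ) * sinkhornDivergence ε c ρ ν)
        (stdSimplex ℝ X) μ → ∀ z ∈ embSet hu,
      inner ℝ (embB H ε c μ - embB H ε c ν) (embB H ε c μ - z)
        ≤ τ * skewForm hu ε V (embB H ε c μ) z + C * τ ^ 2 := by
  obtain ⟨M, hM, hev, hw, hlb⟩ := exists_embSet_bound hu hc hk
  obtain ⟨Cd, hCd0, hCd⟩ := exists_sjko_dist_le hu hε hc hk V
  have hM0 : 0 < M := by linarith
  obtain ⟨v, hv⟩ : ∃ v : ℝ, v = 2 / ε * ∑ x, |V x| := ⟨_, rfl⟩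
  have hv0 : 0 ≤ v := by rw [hv]; positivity
  obtain ⟨M', hM'⟩ : ∃ M' : ℝ, M' = M + M * Cd + v * Real.exp v + Real.exp v := ⟨_, rfl⟩
  have hve := mul_nonneg hv0 (Real.exp_pos v).le
  have hMCd := mul_nonneg hM0.le hCd0
  have hev0 := Real.exp_pos v
  have l1 : M ≤ M' := by linarith
  have l2 : M * Cd ≤ M' := by linarith
  have l3 : v * Real.exp v ≤ M' := by linarith
  have l4 : Real.exp v ≤ M' := by linarith
  have hk0 : ∀ x y, 0 ≤ gibbsKernel ε c x y := fun x y => (Real.exp_pos _).le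
  have hk1 : ∀ x y, gibbsKernel ε c x y ≤ 1 := fun x y =>
    Real.exp_le_one_iff.2 (div_nonpos_of_nonpos_of_nonneg (neg_nonpos.2 (hc0 x y)) hε.le)
  have hK : ∀ (σ : X → ℝ) y, kernelMean H σ y = intOp (gibbsKernel ε c) σ y :=
    fun σ y => kernelMean_apply hc hk σ y
  have hpsd : ∀ σ : X → ℝ, 0 ≤ ∑ y, σ y * intOp (gibbsKernel ε c) σ y := by
    intro σ
    simp_rw [← hK]
    rw [← inner_kernelMean]
    exact real_inner_self_nonneg
  obtain ⟨C, hC0, hC⟩ := schrodinger_expansion hk0 hk1 hpsd (hM.trans l1)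
  set N : ℝ := (Fintype.card X : ℝ) with hN
  refine ⟨N * (2 * M * C + M ^ 2 * (v ^ 2 * Real.exp v)), by positivity, ?_⟩
  intro τ hτ hτ1 μ hμ ν hν hmin z hz
  have hbμ := embB_mem (hu := hu) hε hc hk hμ
  have hbν := embB_mem (hu := hu) hε hc hk hν
  have hdist := hCd τ hτ μ hμ ν hν hmin
  obtain ⟨κ₀, hκle, hκeq⟩ := sjko_complementarity hε hc hτ hμ hν hmin
  have hpair := isSchrodingerPair_schrodingerPotential hε hc hμ hν
  set f := schrodingerPotential ε c μ ν with hf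
  set g := schrodingerPotential ε c ν μ with hg
  set κ : ℝ := 2 * τ * κ₀ with hκ
  -- the potentials are normalized so that `h = -(2 τ / ε) V` on the support of `μ`
  set h : X → ℝ := fun x => (f x - selfPotential ε c μ x - κ) / ε with hh
  set hV : X → ℝ := fun x => -(2 * τ / ε) * V x with hhV
  have hhle : ∀ x, hV x ≤ h x := by
    intro x
    have e1 := mul_le_mul_of_nonneg_left (hκle x) (by positivity : (0 : ℝ) ≤ 2 * τ)
    have e2 : 2 * τ * (V x + 1 / (2 * τ) * (f x - selfPotential ε c μ x))
        = 2 * τ * V x + (f x - selfPotential ε c μ x) := by field_simp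
    rw [e2] at e1
    simp only [hh, hhV]
    rw [le_div_iff₀ hε, show -(2 * τ / ε) * V x * ε = -(2 * τ * V x) by field_simp]
    linarith
  have hheq : ∀ x, μ x ≠ 0 → h x = hV x := by
    intro x hx
    have e1 := congrArg (fun r => 2 * τ * r) (hκeq x hx)
    have e2 : 2 * τ * (V x + 1 / (2 * τ) * (f x - selfPotential ε c μ x))
        = 2 * τ * V x + (f x - selfPotential ε c μ x) := by field_simp
    simp only [e2] at e1
    simp only [hh, hhV]
    rw [div_eq_iff hε.ne', show -(2 * τ / ε) * V x * ε = -(2 * τ * V x) by field_simp]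
    linarith
  have hVabs : ∀ x, |hV x| ≤ v * τ := by
    intro x
    simp only [hhV, abs_mul, abs_neg]
    rw [abs_of_pos (by positivity : 0 < 2 * τ / ε), hv]
    have := Finset.single_le_sum (f := fun x => |V x|) (fun y _ => abs_nonneg _) (Finset.mem_univ x)
    calc 2 * τ / ε * |V x| ≤ 2 * τ / ε * ∑ x, |V x| :=
          mul_le_mul_of_nonneg_left this (by positivity)
      _ = _ := by ring
  have hvτ : v * τ ≤ v := mul_le_of_le_one_right hv0 hτ1
  have hexpV : ∀ x, Real.exp |hV x| ≤ Real.exp v := fun x =>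
    Real.exp_le_exp.2 ((hVabs x).trans hvτ)
  set b := embB H ε c μ with hb
  set b' := embB H ε c ν with hb'
  set α := weights hu b with hα
  set α' := weights hu b' with hα'
  set ζ := weights hu z with hζ
  have hαeq : α = fun x => Real.exp (selfPotential ε c μ x / ε) * μ x := weights_embB μ
  have hαeq' : α' = fun x => Real.exp (selfPotential ε c ν x / ε) * ν x := weights_embB ν
  have hαμ : ∀ x, α x ≠ 0 → μ x ≠ 0 := fun x hx h0 => hx (by rw [hαeq]; simp [h0])
  set U : X → ℝ := fun x => Real.exp (h x) with hU
  set W : X → ℝ := fun x => Real.exp ((g x - selfPotential ε c ν x + κ) / ε) with hW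
  have hbK : ∀ x, b x = intOp (gibbsKernel ε c) α x := fun x => by
    rw [← hK, hα, kernelMean_weights]
  have hbK' : ∀ x, b' x = intOp (gibbsKernel ε c) α' x := fun x => by
    rw [← hK, hα', kernelMean_weights]
  have bpos := apply_pos_of_mem_embSet hc hk hbμ
  have bpos' := apply_pos_of_mem_embSet hc hk hbν
  have zpos := apply_pos_of_mem_embSet hc hk hz
  have ub : ∀ w ∈ embSet hu, ∀ x, w x ≤ M := fun w hw' x => by
    have := hev w x; rw [hw'.1, mul_one] at this; exact (abs_le.1 this).2
  have ubw : ∀ w ∈ embSet hu, ∀ x, weights hu w x ≤ M := fun w hw' x => by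
    have := hw w x; rw [hw'.1, mul_one] at this; exact (abs_le.1 this).2
  have hexp := hC τ α α' b b' U W hτ hτ1 hbK hbK' hbμ.2 hbν.2
    (fun x => (ubw b hbμ x).trans l1) (fun x => (ubw b' hbν x).trans l1)
    (fun x => (hlb b hbμ x).trans (mul_le_mul_of_nonneg_right l1 (bpos x).le))
    (fun x => (hlb b' hbν x).trans (mul_le_mul_of_nonneg_right l1 (bpos' x).le))
    (fun x => (ub b hbμ x).trans l1) (fun x => (ub b' hbν x).trans l1)
    (fun x => by
      have := hev (b - b') x
      rw [RKHS.coe_sub, Pi.sub_apply] at this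
      refine this.trans ((mul_le_mul_of_nonneg_left hdist hM0.le).trans ?_)
      rw [← mul_assoc]
      exact mul_le_mul_of_nonneg_right l2 hτ.le)
    (fun x => by
      have := hw (b - b') x
      rw [map_sub, Pi.sub_apply] at this
      refine this.trans ((mul_le_mul_of_nonneg_left hdist hM0.le).trans ?_)
      rw [← mul_assoc]
      exact mul_le_mul_of_nonneg_right l2 hτ.le)
    (fun x => Real.exp_pos _) (fun x => Real.exp_pos _)
    (fun x => by
      have := hpair.embB_eq (H := H) hε hc hk hμ hν κ x
      rw [hαeq']; exact this)
    (fun x => by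
      have := hpair.swap.embB_eq (H := H) hε hc hk hν hμ (-κ) x
      simp only [sub_neg_eq_add] at this
      rw [hαeq]
      exact this)
    (fun x hx => by
      simp only [hU]
      rw [hheq x (hαμ x hx)]
      refine (exp_sub_one_bounds (h := hV x)).1.trans ?_
      calc |hV x| * Real.exp |hV x| ≤ (v * τ) * Real.exp v :=
            mul_le_mul (hVabs x) (hexpV x) (Real.exp_pos _).le (by positivity)
        _ = (v * Real.exp v) * τ := by ring
        _ ≤ _ := mul_le_mul_of_nonneg_right l3 hτ.le)
    (fun x hx => by
      simp only [hU]
      rw [hheq x (hαμ x hx)]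
      have e1 : Real.exp (-v) ≤ Real.exp (hV x) :=
        Real.exp_le_exp.2 (by linarith [(abs_le.1 (hVabs x)).1])
      calc (1 : ℝ) = Real.exp v * Real.exp (-v) := by rw [← Real.exp_add]; simp
        _ ≤ _ := mul_le_mul l4 e1 (Real.exp_pos _).le (by linarith))
  set ξ : X → ℝ := fun x => U x - 1 with hξ
  -- the main term of the expansion, paired with `b - z`
  have hdual : ∑ x, (α x - ζ x) * (b x * ξ x - intOp (gibbsKernel ε c) (fun y => α y * ξ y) x)
      = ∑ x, ξ x * (α x * z x - b x * ζ x) := by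
    have e1 : ∑ x, (α x - ζ x) * intOp (gibbsKernel ε c) (fun y => α y * ξ y) x
        = ∑ x, α x * ξ x * (b x - z x) := by
      have := inner_kernelMean (H := H) (fun y => α y * ξ y) (b - z)
      rw [real_inner_comm, inner_eq_sum_weights hu] at this
      simp only [map_sub, RKHS.coe_sub, Pi.sub_apply, hK] at this
      exact this
    simp only [mul_sub, Finset.sum_sub_distrib (f := fun x => (α x - ζ x) * (b x * ξ x))]
    rw [e1, ← Finset.sum_sub_distrib]
    exact Finset.sum_congr rfl fun x _ => by ring
  have hinner : inner ℝ (b - b') (b - z) = ∑ x, ξ x * (α x * z x - b x * ζ x)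
      + ∑ x, (α x - ζ x) * (b x - b' x
        - (b x * ξ x - intOp (gibbsKernel ε c) (fun y => α y * ξ y) x)) := by
    rw [← hdual, real_inner_comm, inner_eq_sum_weights hu, ← Finset.sum_add_distrib]
    refine Finset.sum_congr rfl fun x _ => ?_
    rw [map_sub, RKHS.coe_sub, Pi.sub_apply, Pi.sub_apply]
    ring
  have herr : ∑ x, (α x - ζ x) * (b x - b' x
        - (b x * ξ x - intOp (gibbsKernel ε c) (fun y => α y * ξ y) x))
        ≤ N * (2 * M * C) * τ ^ 2 := by
    have : ∀ x ∈ Finset.univ, (α x - ζ x) * (b x - b' x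
        - (b x * ξ x - intOp (gibbsKernel ε c) (fun y => α y * ξ y) x))
        ≤ 2 * M * (C * τ ^ 2) := by
      intro x _
      refine (le_abs_self _).trans ?_
      rw [abs_mul]
      refine mul_le_mul ?_ (hexp x) (abs_nonneg _) (by positivity)
      have a1 := ubw b hbμ x
      have a2 := ubw z hz x
      have a3 := hbμ.2 x
      have a4 := hz.2 x
      rw [abs_le]; constructor <;> linarith
    refine (Finset.sum_le_sum this).trans (le_of_eq ?_)
    simp only [Finset.sum_const, Finset.card_univ, nsmul_eq_mul]
    rw [hN]; ring
  -- off the support only the sign of `ξ - hV` is known, and it is the right one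
  have hmain : ∑ x, ξ x * (α x * z x - b x * ζ x)
      ≤ τ * skewForm hu ε V b z + N * (M ^ 2 * (v ^ 2 * Real.exp v)) * τ ^ 2 := by
    have e1 : τ * skewForm hu ε V b z = ∑ x, hV x * (α x * z x - b x * ζ x) := by
      rw [skewForm_apply, Finset.mul_sum, Finset.mul_sum]
      exact Finset.sum_congr rfl fun x _ => by simp only [hhV]; ring
    have e2 : ∀ x ∈ Finset.univ, ξ x * (α x * z x - b x * ζ x)
        ≤ hV x * (α x * z x - b x * ζ x) + M ^ 2 * (v ^ 2 * Real.exp v) * τ ^ 2 := by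
      intro x _
      have g1 : hV x ≤ ξ x := by
        have := Real.add_one_le_exp (h x)
        simp only [hξ, hU]
        linarith [hhle x]
      have g2 : 0 ≤ (ξ x - hV x) * (b x * ζ x) :=
        mul_nonneg (sub_nonneg.2 g1) (mul_nonneg (bpos x).le (hz.2 x))
      have g3 : (ξ x - hV x) * (α x * z x) ≤ M ^ 2 * (v ^ 2 * Real.exp v) * τ ^ 2 := by
        by_cases h0 : α x = 0
        · rw [h0, zero_mul, mul_zero]; positivity
        · have g4 : ξ x - hV x ≤ (v * τ) ^ 2 * Real.exp v := by
            simp only [hξ, hU]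
            rw [hheq x (hαμ x h0)]
            refine (exp_sub_one_bounds (h := hV x)).2.trans ?_
            exact mul_le_mul (pow_le_pow_left₀ (abs_nonneg _) (hVabs x) 2) (hexpV x)
              (Real.exp_pos _).le (by positivity)
          calc (ξ x - hV x) * (α x * z x) ≤ (v * τ) ^ 2 * Real.exp v * (M * M) :=
                mul_le_mul g4 (mul_le_mul (ubw b hbμ x) (ub z hz x) (zpos x).le hM0.le)
                  (mul_nonneg (hbμ.2 x) (zpos x).le) (by positivity)
            _ = _ := by ring
      linarith
    refine (Finset.sum_le_sum e2).trans (le_of_eq ?_)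
    rw [Finset.sum_add_distrib, e1]
    simp only [Finset.sum_const, Finset.card_univ, nsmul_eq_mul]
    rw [hN]; ring
  rw [hinner]
  linarith

/-- Sequences of the scheme satisfy the discrete evolution variational inequality, uniformly in
the step. -/
theorem exists_isStepEVI_of_isSJKO (hu : IsUniversal (X := X) H) (hε : 0 < ε)
    (hc : ∀ x y, c x y = c y x) (hc0 : ∀ x y, 0 ≤ c x y)
    (hk : HasReproducingKernel H (gibbsKernel ε c)) (V : X → ℝ) {μ₀ : X → ℝ}
    (hμ₀ : μ₀ ∈ stdSimplex ℝ X) :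
    ∃ C : ℝ, 0 ≤ C ∧ ∀ τ : ℝ, 0 < τ → τ ≤ 1 → ∀ μ : ℕ → X → ℝ, IsSJKO ε c V τ μ₀ μ →
      IsStepEVI (skewForm hu ε V) (embSet hu) τ C fun k => embB H ε c (μ k) := by
  obtain ⟨C₁, hC₁, h₁⟩ := exists_sjko_dist_le hu hε hc hk V
  obtain ⟨C₂, hC₂, h₂⟩ := exists_sjko_step_inner_le hu hε hc hc0 hk V
  set A := ‖skewForm hu ε V‖ with hA
  have hA0 : 0 ≤ A := norm_nonneg (skewForm hu ε V)
  refine ⟨C₁ + 2 * C₂ + 2 * (A * C₁), by positivity, fun τ hτ hτ1 μ hμ => ?_⟩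
  have hmem := hμ.mem hμ₀
  have hd : ∀ k, ‖embB H ε c (μ (k + 1)) - embB H ε c (μ k)‖ ≤ C₁ * τ := fun k =>
    h₁ τ hτ _ (hmem (k + 1)) _ (hmem k) (hμ.2 k).2
  refine ⟨fun k => embB_mem hε hc hk (hmem k), fun k z hz => ?_, fun k => (hd k).trans ?_⟩
  · have e1 := h₂ τ hτ hτ1 _ (hmem (k + 1)) _ (hmem k) (hμ.2 k).2 z hz
    set b := embB H ε c (μ (k + 1))
    set b' := embB H ε c (μ k)
    have e2 : ‖b' - z‖ ^ 2 = ‖b - z‖ ^ 2 - 2 * inner ℝ (b - b') (b - z) + ‖b - b'‖ ^ 2 := by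
      rw [real_inner_comm, ← norm_sub_sq_real, sub_sub_sub_cancel_left, norm_sub_rev]
    have e3 : skewForm hu ε V b z ≤ skewForm hu ε V b' z + A * (C₁ * τ) := by
      have : skewForm hu ε V b z = skewForm hu ε V b' z + skewForm hu ε V (b - b') z := by simp
      rw [this]
      refine add_le_add_right ?_ _
      refine (le_abs_self _).trans ((abs_bilin_le _ hz.1.le).trans ?_)
      exact mul_le_mul_of_nonneg_left (hd k) hA0
    have e4 := mul_le_mul_of_nonneg_left e3 hτ.le
    have e5 : 0 ≤ C₁ * τ ^ 2 := by positivity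
    nlinarith [sq_nonneg ‖b - b'‖]
  · refine mul_le_mul_of_nonneg_right ?_ hτ.le
    have : 0 ≤ A * C₁ := by positivity
    linarith

end Step

/-! ### The metric tensor in the embedded coordinates -/

section Metric

variable {X : Type*} [Fintype X] {H : Type*} [NormedAddCommGroup H] [InnerProductSpace ℝ H]
  [CompleteSpace H] [RKHS ℝ H X ℝ] {ε : ℝ} {c : X → X → ℝ} {hu : IsUniversal (X := X) H}

theorem selfKernel_unembed (hε : 0 < ε) (hc : ∀ x y, c x y = c y x)
    (hk : HasReproducingKernel H (gibbsKernel ε c)) {b : H} (hb : b ∈ embSet hu) (x y : X) :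
    selfKernel ε c (unembed hu b) x y = Real.exp (-c x y / ε) / (b x * b y) := by
  have hx := apply_pos_of_mem_embSet hc hk hb x
  have hy := apply_pos_of_mem_embSet hc hk hb y
  rw [selfKernel, selfPotential_unembed hε hc hk hb]
  rw [show (-ε * Real.log (b x) + -ε * Real.log (b y) - c x y) / ε
    = -c x y / ε + (-Real.log (b x) + -Real.log (b y)) by field_simp; ring, Real.exp_add,
    Real.exp_add, Real.exp_neg, Real.exp_neg, Real.exp_log hx, Real.exp_log hy, ← mul_inv,
    ← div_eq_mul_inv]

theorem opH_unembed (hε : 0 < ε) (hc : ∀ x y, c x y = c y x)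
    (hk : HasReproducingKernel H (gibbsKernel ε c)) {b : H} (hb : b ∈ embSet hu) (σ : X → ℝ)
    (y : X) :
    opH ε c (unembed hu b) σ y = kernelMean H (fun x => σ x / b x) y / b y := by
  rw [opH, kernelMean_apply hc hk, Finset.sum_div]
  refine Finset.sum_congr rfl fun x _ => ?_
  have hx := apply_pos_of_mem_embSet hc hk hb x
  have hy := apply_pos_of_mem_embSet hc hk hb y
  rw [selfKernel_unembed hε hc hk hb]
  field_simp

theorem opK_unembed (hε : 0 < ε) (hc : ∀ x y, c x y = c y x)
    (hk : HasReproducingKernel H (gibbsKernel ε c)) {b : H} (hb : b ∈ embSet hu) (φ : X → ℝ)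
    (y : X) :
    opK ε c (unembed hu b) φ y = kernelMean H (fun x => weights hu b x * φ x) y / b y := by
  rw [opK, opH_unembed hε hc hk hb]
  congr 3
  funext x
  have hx := apply_pos_of_mem_embSet hc hk hb x
  rw [unembed]
  field_simp

section Markov

variable {μ : X → ℝ}

theorem sum_selfKernel_mul (hε : 0 < ε) (hc : ∀ x y, c x y = c y x) (hμ : μ ∈ stdSimplex ℝ X)
    (y : X) : ∑ x, selfKernel ε c μ x y * μ x = 1 := by
  have h := (eq_sinkhornMap_iff hε hc hμ).1 (selfPotential_eq hε hc hμ) y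
  rw [← h]
  refine Finset.sum_congr rfl fun x _ => ?_
  rw [selfKernel, hc x y, add_comm (selfPotential ε c μ x)]

theorem selfKernel_symm (hc : ∀ x y, c x y = c y x) (x y : X) :
    selfKernel ε c μ x y = selfKernel ε c μ y x := by
  rw [selfKernel, selfKernel, hc x y, add_comm (selfPotential ε c μ x)]

theorem opK_add (φ ψ : X → ℝ) (y : X) :
    opK ε c μ (fun x => φ x + ψ x) y = opK ε c μ φ y + opK ε c μ ψ y := by
  simp [opK, opH, add_mul, mul_add, Finset.sum_add_distrib]

theorem opK_smul (r : ℝ) (φ : X → ℝ) (y : X) :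
    opK ε c μ (fun x => r * φ x) y = r * opK ε c μ φ y := by
  simp only [opK, opH, Finset.mul_sum]
  exact Finset.sum_congr rfl fun x _ => by ring

theorem opK_sub (φ ψ : X → ℝ) (y : X) :
    opK ε c μ (fun x => φ x - ψ x) y = opK ε c μ φ y - opK ε c μ ψ y := by
  simp [opK, opH, sub_mul, mul_sub, Finset.sum_sub_distrib]

theorem opK_const (hε : 0 < ε) (hc : ∀ x y, c x y = c y x) (hμ : μ ∈ stdSimplex ℝ X) (r : ℝ)
    (y : X) : opK ε c μ (fun _ => r) y = r := by
  have h := sum_selfKernel_mul hε hc hμ y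
  calc _ = ∑ x, r * (selfKernel ε c μ x y * μ x) :=
        Finset.sum_congr rfl fun x _ => by ring
    _ = r := by rw [← Finset.mul_sum, h, mul_one]

theorem sum_mul_opK_comm (hc : ∀ x y, c x y = c y x) (φ ψ : X → ℝ) :
    ∑ y, μ y * ψ y * opK ε c μ φ y = ∑ y, μ y * φ y * opK ε c μ ψ y := by
  simp only [opK, opH, Finset.mul_sum]
  rw [Finset.sum_comm]
  refine Finset.sum_congr rfl fun x _ => Finset.sum_congr rfl fun y _ => ?_
  rw [selfKernel_symm hc x y]
  ring

theorem sum_mul_opK (hε : 0 < ε) (hc : ∀ x y, c x y = c y x) (hμ : μ ∈ stdSimplex ℝ X)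
    (φ : X → ℝ) : ∑ y, μ y * opK ε c μ φ y = ∑ y, μ y * φ y := by
  have h := sum_mul_opK_comm (ε := ε) (μ := μ) hc φ fun _ => 1
  simpa [opK_const hε hc hμ] using h

/-- The Dirichlet form of the Markov operator `K_μ`. -/
theorem dirichlet_eq (hε : 0 < ε) (hc : ∀ x y, c x y = c y x) (hμ : μ ∈ stdSimplex ℝ X)
    (φ : X → ℝ) :
    ∑ y, μ y * φ y * (φ y - opK ε c μ φ y) =
      1 / 2 * ∑ y, ∑ x, selfKernel ε c μ x y * (μ x * μ y) * (φ x - φ y) ^ 2 := by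
  have h1 : ∀ y, ∑ x, selfKernel ε c μ x y * (μ x * μ y) * (φ x - φ y) ^ 2
      = μ y * opK ε c μ (fun x => φ x ^ 2) y - 2 * (μ y * φ y * opK ε c μ φ y)
        + μ y * φ y ^ 2 := by
    intro y
    have h2 := sum_selfKernel_mul hε hc hμ y
    calc _ = ∑ x, (μ y * (selfKernel ε c μ x y * (φ x ^ 2 * μ x))
          - 2 * (μ y * φ y * (selfKernel ε c μ x y * (φ x * μ x)))
          + μ y * φ y ^ 2 * (selfKernel ε c μ x y * μ x)) :=
          Finset.sum_congr rfl fun x _ => by ring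
      _ = _ := by
        rw [Finset.sum_add_distrib, Finset.sum_sub_distrib, ← Finset.mul_sum, ← Finset.mul_sum,
          ← Finset.mul_sum, ← Finset.mul_sum, h2, mul_one]
        rfl
  simp only [h1, Finset.sum_add_distrib, Finset.sum_sub_distrib, sum_mul_opK hε hc hμ,
    ← Finset.mul_sum, mul_sub]
  have h3 : ∑ y, μ y * φ y * φ y = ∑ y, μ y * φ y ^ 2 :=
    Finset.sum_congr rfl fun y _ => by ring
  rw [h3]
  ring

theorem dirichlet_nonneg (hε : 0 < ε) (hc : ∀ x y, c x y = c y x) (hμ : μ ∈ stdSimplex ℝ X)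
    (φ : X → ℝ) : 0 ≤ ∑ y, μ y * φ y * (φ y - opK ε c μ φ y) := by
  rw [dirichlet_eq hε hc hμ]
  refine mul_nonneg (by norm_num) (Finset.sum_nonneg fun y _ => Finset.sum_nonneg fun x _ => ?_)
  exact mul_nonneg (mul_nonneg (Real.exp_pos _).le (mul_nonneg (hμ.1 x) (hμ.1 y))) (sq_nonneg _)

/-- Functions that are harmonic for `K_μ` are constant. -/
theorem exists_eq_const_of_eq_opK (hε : 0 < ε) (hc : ∀ x y, c x y = c y x)
    (hμ : μ ∈ stdSimplex ℝ X) {φ : X → ℝ} (h : ∀ y, φ y = opK ε c μ φ y) :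
    ∃ r, ∀ y, φ y = r := by
  have h0 : ∑ y, μ y * φ y * (φ y - opK ε c μ φ y) = 0 :=
    Finset.sum_eq_zero fun y _ => by rw [← h y, sub_self, mul_zero]
  rw [dirichlet_eq hε hc hμ] at h0
  have hnn : ∀ y x, 0 ≤ selfKernel ε c μ x y * (μ x * μ y) * (φ x - φ y) ^ 2 := fun y x =>
    mul_nonneg (mul_nonneg (Real.exp_pos _).le (mul_nonneg (hμ.1 x) (hμ.1 y))) (sq_nonneg _)
  have h1 := (mul_eq_zero.1 h0).resolve_left (by norm_num)
  rw [Finset.sum_eq_zero_iff_of_nonneg fun y _ => Finset.sum_nonneg fun x _ => hnn y x] at h1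
  obtain ⟨x₀, hx₀⟩ := exists_pos_of_mem_stdSimplex hμ
  refine ⟨φ x₀, fun y => ?_⟩
  have h2 := h1 x₀ (Finset.mem_univ _)
  rw [Finset.sum_eq_zero_iff_of_nonneg fun x _ => hnn x₀ x] at h2
  have h3 : ∀ x, φ x * μ x = φ x₀ * μ x := by
    intro x
    by_cases hx : μ x = 0
    · simp [hx]
    have h4 := h2 x (Finset.mem_univ x)
    rw [mul_eq_zero, mul_eq_zero, mul_eq_zero] at h4
    rcases h4 with (h4 | h4 | h4) | h4
    · exact absurd h4 (Real.exp_pos _).ne'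
    · exact absurd h4 hx
    · exact absurd h4 hx₀.ne'
    · have : φ x = φ x₀ := by
        have := pow_eq_zero_iff two_ne_zero |>.1 h4
        linarith
      rw [this]
  rw [h y, ← opK_const hε hc hμ (φ x₀) y]
  unfold opK
  simp_rw [h3]

end Markov

/-- `Id + K_μ` is injective, since `K_μ` is positive semidefinite in `L²(μ)`. -/
theorem eq_zero_of_add_opK_eq_zero (hε : 0 < ε) (hc : ∀ x y, c x y = c y x)
    (hk : HasReproducingKernel H (gibbsKernel ε c)) {b : H} (hb : b ∈ embSet hu) {r : X → ℝ}
    (h : ∀ y, r y + opK ε c (unembed hu b) r y = 0) (y : X) : r y = 0 := by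
  set w := kernelMean H (fun x => weights hu b x * r x) with hw
  have hK : ∀ y, opK ε c (unembed hu b) r y * b y = w y := fun y => by
    rw [opK_unembed hε hc hk hb]
    exact div_mul_cancel₀ _ (apply_pos_of_mem_embSet hc hk hb y).ne'
  have h1 : ∑ y, weights hu b y * r y * (r y * b y + w y) = 0 :=
    Finset.sum_eq_zero fun y _ => by rw [← hK, ← add_mul, h y]; simp
  have h2 : ∑ y, weights hu b y * r y * w y = inner ℝ w w := by
    conv_rhs => rw [hw, inner_kernelMean]
  have h3 : 0 ≤ inner ℝ w w := real_inner_self_nonneg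
  have hnn : ∀ y, 0 ≤ weights hu b y * r y * (r y * b y) := fun y => by
    have := mul_nonneg (mul_nonneg (hb.2 y) (apply_pos_of_mem_embSet hc hk hb y).le)
      (sq_nonneg (r y))
    nlinarith
  simp only [mul_add, Finset.sum_add_distrib] at h1
  rw [h2] at h1
  have h4 : ∑ y, weights hu b y * r y * (r y * b y) = 0 :=
    le_antisymm (by linarith) (Finset.sum_nonneg fun y _ => hnn y)
  rw [Finset.sum_eq_zero_iff_of_nonneg fun y _ => hnn y] at h4
  have h5 : ∀ x, weights hu b x * r x = 0 := by
    intro x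
    rcases mul_eq_zero.1 (h4 x (Finset.mem_univ x)) with h6 | h6
    · exact h6
    · rw [(mul_eq_zero.1 h6).resolve_right (apply_pos_of_mem_embSet hc hk hb x).ne', mul_zero]
  have h6 := h y
  rw [opK_unembed hε hc hk hb] at h6
  simp_rw [h5] at h6
  simpa [kernelMean] using h6

variable (hu) in
/-- The operator `Id - K_μ + ⟨μ, ·⟩`, for `μ` the measure embedded as `b`: an invertible operator
that coincides with `Id - K_μ` on functions of zero mean. -/
noncomputable def markovOp (ε : ℝ) (c : X → X → ℝ) (b : H) : (X → ℝ) →L[ℝ] (X → ℝ) :=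
  open Classical in
  1 + ∑ x, ∑ y, (weights hu b x * b x - (b y)⁻¹ * (Real.exp (-c x y / ε) * weights hu b x)) •
    (ContinuousLinearMap.proj (R := ℝ) (φ := fun _ : X => ℝ) x).smulRight (Pi.single y (1 : ℝ))

theorem markovOp_apply (hε : 0 < ε) (hc : ∀ x y, c x y = c y x)
    (hk : HasReproducingKernel H (gibbsKernel ε c)) {b : H} (hb : b ∈ embSet hu) (φ : X → ℝ)
    (y : X) : markovOp hu ε c b φ y =
      φ y - opK ε c (unembed hu b) φ y + ∑ x, unembed hu b x * φ x := by
  classical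
  have h1 : markovOp hu ε c b φ y = φ y + ∑ x, (weights hu b x * b x
      - (b y)⁻¹ * (Real.exp (-c x y / ε) * weights hu b x)) * φ x := by
    simp [markovOp, Finset.sum_apply, Pi.single_apply]
  rw [h1, opK_unembed hε hc hk hb, kernelMean_apply hc hk, Finset.sum_div]
  simp only [sub_mul, Finset.sum_sub_distrib]
  have h2 : ∀ x, (b y)⁻¹ * (Real.exp (-c x y / ε) * weights hu b x) * φ x
      = Real.exp (-c x y / ε) * (weights hu b x * φ x) / b y := fun x => by
    rw [div_eq_mul_inv]; ring
  simp only [h2]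
  unfold unembed
  ring

theorem sum_mul_markovOp (hε : 0 < ε) (hc : ∀ x y, c x y = c y x)
    (hk : HasReproducingKernel H (gibbsKernel ε c)) {b : H} (hb : b ∈ embSet hu) (φ : X → ℝ) :
    ∑ y, unembed hu b y * markovOp hu ε c b φ y = ∑ y, unembed hu b y * φ y := by
  have hμ := unembed_mem hc hk hb
  simp only [markovOp_apply hε hc hk hb, mul_add, mul_sub, Finset.sum_add_distrib,
    Finset.sum_sub_distrib, sum_mul_opK hε hc hμ, ← Finset.sum_mul, hμ.2]
  ring

theorem isUnit_markovOp (hε : 0 < ε) (hc : ∀ x y, c x y = c y x)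
    (hk : HasReproducingKernel H (gibbsKernel ε c)) {b : H} (hb : b ∈ embSet hu) :
    IsUnit (markovOp hu ε c b) := by
  rw [ContinuousLinearMap.isUnit_iff_bijective]
  have hinj : Function.Injective (markovOp hu ε c b) := by
    rw [injective_iff_map_eq_zero]
    intro φ hφ
    have hμ := unembed_mem hc hk hb
    have h1 := sum_mul_markovOp hε hc hk hb φ
    rw [hφ] at h1
    simp only [Pi.zero_apply, mul_zero, Finset.sum_const_zero] at h1
    have h2 : ∀ y, φ y = opK ε c (unembed hu b) φ y := fun y => by
      have := markovOp_apply hε hc hk hb φ y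
      rw [hφ, ← h1] at this
      simp only [Pi.zero_apply] at this
      linarith
    obtain ⟨r, hr⟩ := exists_eq_const_of_eq_opK hε hc hμ h2
    simp only [hr, ← Finset.sum_mul, hμ.2, one_mul] at h1
    funext y
    rw [hr, ← h1, Pi.zero_apply]
  exact ⟨hinj, (LinearMap.injective_iff_surjective
    (f := (markovOp hu ε c b : (X → ℝ) →ₗ[ℝ] (X → ℝ)))).1 hinj⟩

theorem markovOp_inverse_apply (hε : 0 < ε) (hc : ∀ x y, c x y = c y x)
    (hk : HasReproducingKernel H (gibbsKernel ε c)) {b : H} (hb : b ∈ embSet hu) (φ : X → ℝ) :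
    markovOp hu ε c b (Ring.inverse (markovOp hu ε c b) φ) = φ := by
  have := Ring.mul_inverse_cancel _ (isUnit_markovOp hε hc hk hb)
  exact congrArg (fun T : (X → ℝ) →L[ℝ] (X → ℝ) => T φ) this

theorem continuousOn_inverse_markovOp (hε : 0 < ε) (hc : ∀ x y, c x y = c y x)
    (hk : HasReproducingKernel H (gibbsKernel ε c)) :
    ContinuousOn (fun b : H => Ring.inverse (markovOp hu ε c b)) (embSet hu) := by
  have h1 : ContinuousOn (fun b : H => markovOp hu ε c b) (embSet hu) := by
    unfold markovOp
    refine continuousOn_const.add (continuousOn_finsetSum _ fun x _ =>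
      continuousOn_finsetSum _ fun y _ => ContinuousOn.fun_smul (ContinuousOn.fun_sub ?_ ?_)
        continuousOn_const)
    · exact (((continuous_apply x).comp (weights hu).continuous).mul
        (RKHS.continuous_eval x)).continuousOn
    · refine ContinuousOn.mul (ContinuousOn.inv₀ (RKHS.continuous_eval y).continuousOn
        fun b hb => (apply_pos_of_mem_embSet hc hk hb y).ne') ?_
      exact (((continuous_apply x).comp (weights hu).continuous).const_mul _).continuousOn
  intro b hb
  obtain ⟨u, hu'⟩ := isUnit_markovOp hε hc hk hb
  have h2 := NormedRing.inverse_continuousAt u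
  rw [hu'] at h2
  exact ContinuousAt.comp_continuousWithinAt h2 (h1 b hb)

/-- The resolvent applied to `H_μ[σ] = φ + K_μ φ` inverts `Id - K_μ` on functions of zero mean. -/
theorem resolvent_sub_opK (hε : 0 < ε) (hc : ∀ x y, c x y = c y x)
    (hk : HasReproducingKernel H (gibbsKernel ε c)) {b : H} (hb : b ∈ embSet hu) {φ η : X → ℝ}
    (hφ : ∑ x, unembed hu b x * φ x = 0)
    (hη : ∀ y, η y = φ y + opK ε c (unembed hu b) φ y) (y : X) :
    resolvent ε c (unembed hu b) η y
      - opK ε c (unembed hu b) (resolvent ε c (unembed hu b) η) y = φ y := by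
  set μ := unembed hu b with hμdef
  have hμ : μ ∈ stdSimplex ℝ X := unembed_mem hc hk hb
  have hex : ∃ ψ : X → ℝ, ∃ C : ℝ, ∀ x, ψ x - opK ε c μ (opK ε c μ ψ) x = η x + C := by
    refine ⟨Ring.inverse (markovOp hu ε c b) φ, 0, fun x => ?_⟩
    set ψ := Ring.inverse (markovOp hu ε c b) φ
    have e1 := markovOp_inverse_apply hε hc hk hb φ
    have e2 := sum_mul_markovOp hε hc hk hb ψ
    rw [e1, hφ] at e2
    have e3 : ∀ x, φ x = ψ x - opK ε c μ ψ x := fun x => by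
      rw [← congrFun e1 x, markovOp_apply hε hc hk hb, ← e2, add_zero]
    rw [hη, funext e3, opK_sub]
    ring
  obtain ⟨C, hC⟩ : ∃ C : ℝ, ∀ x, resolvent ε c μ η x
      - opK ε c μ (opK ε c μ (resolvent ε c μ η)) x = η x + C := Classical.epsilon_spec hex
  set ψ := resolvent ε c μ η
  have h1 := eq_zero_of_add_opK_eq_zero hε hc hk hb
    (r := fun y => (ψ y - opK ε c μ ψ y) - (φ y + C / 2)) (fun y => by
      rw [← hμdef, opK_sub, opK_sub, opK_add, opK_const hε hc hμ]
      have := hC y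
      rw [hη] at this
      linarith)
  have h2 : ∑ y, μ y * (ψ y - opK ε c μ ψ y) = 0 := by
    simp only [mul_sub, Finset.sum_sub_distrib, sum_mul_opK hε hc hμ, sub_self]
  have h3 : ∑ y, μ y * (φ y + C / 2) = C / 2 := by
    simp only [mul_add, Finset.sum_add_distrib, ← Finset.sum_mul, hμ.2]
    rw [hφ]; ring
  have h4 : ∑ y, μ y * (ψ y - opK ε c μ ψ y) = ∑ y, μ y * (φ y + C / 2) :=
    Finset.sum_congr rfl fun y _ => by
      have := h1 y
      rw [sub_eq_zero.1 this]
  have h5 := h1 y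
  rw [h2, h3] at h4
  linarith

variable (hu) in
/-- The derivative of `unembed` at `b` in the direction `v`: the velocity of the measure when the
embedded curve has velocity `v`. -/
noncomputable def unembedDeriv (b v : H) (x : X) : ℝ := weights hu v x * b x + weights hu b x * v x

theorem hasDerivAt_unembed {b : ℝ → H} {v : H} {t : ℝ} (hb : HasDerivAt b v t) :
    HasDerivAt (fun s => unembed hu (b s)) (unembedDeriv hu (b t) v) t := by
  rw [hasDerivAt_pi]
  intro x
  have h1 : HasDerivAt (fun s => weights hu (b s) x) (weights hu v x) t :=
    ((ContinuousLinearMap.proj (R := ℝ) (φ := fun _ : X => ℝ) x).comp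
      (weights hu)).hasFDerivAt.comp_hasDerivAt t hb
  have h2 : HasDerivAt (fun s => b s x) (v x) t :=
    ((ContinuousLinearMap.proj (R := ℝ) (φ := fun _ : X => ℝ) x).comp
      (RKHS.coeCLM (𝕜 := ℝ) (H := H) (X := X) (V := ℝ))).hasFDerivAt.comp_hasDerivAt t hb
  exact h1.mul h2

theorem sum_unembed_mul_div (hc : ∀ x y, c x y = c y x)
    (hk : HasReproducingKernel H (gibbsKernel ε c)) {b : H} (hb : b ∈ embSet hu) (v : H)
    (ψ : X → ℝ) :
    ∑ x, unembed hu b x * (v x / b x) * ψ x = ∑ x, weights hu b x * v x * ψ x := by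
  refine Finset.sum_congr rfl fun x _ => ?_
  have := apply_pos_of_mem_embSet hc hk hb x
  rw [unembed]
  field_simp

/-- The velocity `v` of the embedded curve enters the metric tensor through `(Id + K_μ)[v / b]`, so
one factor of `Id - K_μ² = (Id - K_μ) (Id + K_μ)` cancels in the resolvent. -/
theorem opH_unembedDeriv (hε : 0 < ε) (hc : ∀ x y, c x y = c y x)
    (hk : HasReproducingKernel H (gibbsKernel ε c)) {b : H} (hb : b ∈ embSet hu) (v : H) (y : X) :
    opH ε c (unembed hu b) (unembedDeriv hu b v) y =
      v y / b y + opK ε c (unembed hu b) (fun x => v x / b x) y := by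
  rw [opH_unembed hε hc hk hb, opK_unembed hε hc hk hb, ← add_div]
  congr 1
  have : (fun x => unembedDeriv hu b v x / b x)
      = weights hu v + fun x => weights hu b x * (v x / b x) := by
    funext x
    have := apply_pos_of_mem_embSet hc hk hb x
    simp only [unembedDeriv, Pi.add_apply]
    field_simp
  rw [this, kernelMean_add, kernelMean_weights, RKHS.coe_add, Pi.add_apply]

/-- The resolvent in the definition of the metric tensor, in the embedded coordinates. -/
theorem resolvent_opH_unembedDeriv (hε : 0 < ε) (hc : ∀ x y, c x y = c y x)
    (hk : HasReproducingKernel H (gibbsKernel ε c)) {b v : H} (hb : b ∈ embSet hu)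
    (hbv : inner ℝ b v = 0) (y : X) :
    resolvent ε c (unembed hu b) (opH ε c (unembed hu b) (unembedDeriv hu b v)) y
      - opK ε c (unembed hu b)
        (resolvent ε c (unembed hu b) (opH ε c (unembed hu b) (unembedDeriv hu b v))) y
      = v y / b y := by
  refine resolvent_sub_opK hε hc hk hb ?_ (opH_unembedDeriv hε hc hk hb v) y
  rw [inner_eq_sum_weights hu] at hbv
  rw [← hbv]
  simpa using sum_unembed_mul_div hc hk hb v fun _ => 1

variable (hu) in
/-- The metric tensor in the embedded coordinates,
`(ε / 2) (‖v‖² + 2 ⟨v / b, (Id - K_μ)⁻¹ (v / b)⟩_μ)`. -/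
noncomputable def embCost (ε : ℝ) (c : X → X → ℝ) (b v : H) : ℝ :=
  ε / 2 * (‖v‖ ^ 2 + 2 * ∑ x, weights hu b x * v x *
    Ring.inverse (markovOp hu ε c b) (fun y => v y / b y) x)

theorem metricTensor_unembedDeriv (hε : 0 < ε) (hc : ∀ x y, c x y = c y x)
    (hk : HasReproducingKernel H (gibbsKernel ε c)) {b v : H} (hb : b ∈ embSet hu)
    (hbv : inner ℝ b v = 0) :
    metricTensor ε c (unembed hu b) (unembedDeriv hu b v) (unembedDeriv hu b v)
      = embCost hu ε c b v := by
  have hμ := unembed_mem hc hk hb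
  rw [metricTensor, embCost]
  congr 1
  have hψ := resolvent_opH_unembedDeriv hε hc hk hb hbv
  set ψ := resolvent ε c (unembed hu b) (opH ε c (unembed hu b) (unembedDeriv hu b v))
  set ψ' := Ring.inverse (markovOp hu ε c b) (fun y => v y / b y) with hψ'
  have hsum : ∑ x, weights hu b x * v x = 0 := by rwa [inner_eq_sum_weights hu] at hbv
  -- `v = b ψ - K(α ψ)`, paired with `v` itself
  have h1 : ∀ y, v y = b y * ψ y - kernelMean H (fun x => weights hu b x * ψ x) y := by
    intro y
    have hy := apply_pos_of_mem_embSet hc hk hb y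
    have := hψ y
    rw [opK_unembed hε hc hk hb, eq_div_iff hy.ne'] at this
    rw [← this]
    field_simp
  have h2 : ‖v‖ ^ 2 = ∑ x, weights hu v x * b x * ψ x - ∑ x, weights hu b x * v x * ψ x := by
    have e1 : inner ℝ v (kernelMean H (fun x => weights hu b x * ψ x))
        = ∑ x, weights hu b x * v x * ψ x := by
      rw [real_inner_comm, inner_kernelMean]
      exact Finset.sum_congr rfl fun x _ => by ring
    rw [inner_eq_sum_weights hu] at e1
    rw [← real_inner_self_eq_norm_sq, inner_eq_sum_weights hu, ← e1, ← Finset.sum_sub_distrib]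
    refine Finset.sum_congr rfl fun x _ => ?_
    conv_lhs => rw [h1 x]
    ring
  -- the two solutions of `ψ - K_μ ψ = v / b` differ by a constant
  have h3 : ∃ r, ∀ y, ψ y - ψ' y = r := by
    refine exists_eq_const_of_eq_opK hε hc hμ (φ := fun y => ψ y - ψ' y) fun y => ?_
    have e1 := markovOp_inverse_apply hε hc hk hb fun y => v y / b y
    rw [← hψ'] at e1
    have e2 := sum_mul_markovOp hε hc hk hb ψ'
    rw [e1] at e2
    have e3 : ∑ x, unembed hu b x * (v x / b x) = 0 := by
      rw [← hsum]
      simpa using sum_unembed_mul_div hc hk hb v fun _ => 1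
    have e4 := congrFun e1 y
    rw [markovOp_apply hε hc hk hb, ← e2, e3, add_zero] at e4
    rw [opK_sub]
    linarith [hψ y]
  obtain ⟨r, hr⟩ := h3
  have h4 : ∑ x, weights hu b x * v x * ψ' x = ∑ x, weights hu b x * v x * ψ x := by
    have : ∀ x, weights hu b x * v x * ψ' x
        = weights hu b x * v x * ψ x - weights hu b x * v x * r := fun x => by
      rw [← hr x]; ring
    simp only [this, Finset.sum_sub_distrib, ← Finset.sum_mul, hsum]
    ring
  rw [h4, h2]
  simp only [unembedDeriv, add_mul, Finset.sum_add_distrib]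
  ring

theorem continuousOn_embCost (hε : 0 < ε) (hc : ∀ x y, c x y = c y x)
    (hk : HasReproducingKernel H (gibbsKernel ε c)) :
    ContinuousOn (fun p : H × H => embCost hu ε c p.1 p.2) (embSet hu ×ˢ univ) := by
  have ev : ∀ x : X, Continuous fun p : H × H => p.2 x := fun x =>
    (RKHS.continuous_eval x).comp continuous_snd
  unfold embCost
  refine continuousOn_const.mul (ContinuousOn.add (by fun_prop) (continuousOn_const.mul
    (continuousOn_finsetSum _ fun x _ => ContinuousOn.mul ?_ ?_)))
  · exact ((((continuous_apply x).comp (weights hu).continuous).comp continuous_fst).mul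
      (ev x)).continuousOn
  · have h1 : ContinuousOn (fun p : H × H => Ring.inverse (markovOp hu ε c p.1))
        (embSet hu ×ˢ univ) :=
      (continuousOn_inverse_markovOp hε hc hk).comp continuousOn_fst fun p hp => hp.1
    have h2 : ContinuousOn (fun p : H × H => fun y => p.2 y / p.1 y) (embSet hu ×ˢ univ) :=
      continuousOn_pi.2 fun y => (ev y).continuousOn.div
        ((RKHS.continuous_eval y).comp continuous_fst).continuousOn
        fun p hp => (apply_pos_of_mem_embSet hc hk hp.1 y).ne'
    exact (continuous_apply x).comp_continuousOn (h1.clm_apply h2)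

theorem embCost_smul (b v : H) (s : ℝ) :
    embCost hu ε c b (s • v) = s ^ 2 * embCost hu ε c b v := by
  have h1 : (fun y => (s • v) y / b y) = s • fun y => v y / b y := by
    funext y
    rw [RKHS.coe_smul]
    simp [mul_div_assoc]
  rw [embCost, embCost, h1, map_smul]
  simp only [RKHS.coe_smul, Pi.smul_apply, smul_eq_mul, norm_smul, mul_pow, Real.norm_eq_abs, sq_abs]
  have h2 : ∀ x, weights hu b x * (s * v x) *
      (s * Ring.inverse (markovOp hu ε c b) (fun y => v y / b y) x) = s ^ 2 * (weights hu b x * v x *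
      Ring.inverse (markovOp hu ε c b) (fun y => v y / b y) x) := fun x => by ring
  simp only [h2, ← Finset.mul_sum]
  ring

theorem le_embCost (hε : 0 < ε) (hc : ∀ x y, c x y = c y x)
    (hk : HasReproducingKernel H (gibbsKernel ε c)) {b : H} (hb : b ∈ embSet hu) (v : H) :
    ε / 2 * ‖v‖ ^ 2 ≤ embCost hu ε c b v := by
  have hμ := unembed_mem hc hk hb
  rw [embCost, mul_add]
  refine le_add_of_nonneg_right (mul_nonneg (by positivity) (mul_nonneg zero_le_two ?_))
  set ψ := Ring.inverse (markovOp hu ε c b) (fun y => v y / b y) with hψ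
  have e1 := markovOp_inverse_apply hε hc hk hb fun y => v y / b y
  rw [← hψ] at e1
  rw [← sum_unembed_mul_div hc hk hb]
  have e2 : ∀ x, unembed hu b x * (v x / b x) * ψ x
      = unembed hu b x * ψ x * (ψ x - opK ε c (unembed hu b) ψ x)
        + unembed hu b x * ψ x * ∑ y, unembed hu b y * ψ y := fun x => by
    have := congrFun e1 x
    rw [markovOp_apply hε hc hk hb] at this
    rw [← this]
    ring
  simp only [e2, Finset.sum_add_distrib, ← Finset.sum_mul]
  exact add_nonneg (dirichlet_nonneg hε hc hμ ψ) (mul_self_nonneg _)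

theorem exists_embCost_le (hε : 0 < ε) (hc : ∀ x y, c x y = c y x)
    (hk : HasReproducingKernel H (gibbsKernel ε c)) :
    ∃ M : ℝ, 0 ≤ M ∧ ∀ b ∈ embSet hu, ∀ v, embCost hu ε c b v ≤ M * ‖v‖ ^ 2 := by
  have := finiteDimensional_of_rkhs X H
  have := FiniteDimensional.proper ℝ H
  have hcpt : IsCompact (embSet hu ×ˢ Metric.sphere (0 : H) 1) :=
    (isCompact_embSet hu).prod (isCompact_sphere 0 1)
  obtain ⟨M, hM⟩ := (hcpt.image_of_continuousOn ((continuousOn_embCost (hu := hu) hε hc hk).mono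
    (prod_mono_right (subset_univ _)))).bddAbove
  refine ⟨max M 0, le_max_right _ _, fun b hb v => ?_⟩
  rcases eq_or_ne v 0 with rfl | hv
  · have := embCost_smul (hu := hu) (ε := ε) (c := c) b 0 0
    simp at this
    simp [this]
  · have hn : ‖v‖ ≠ 0 := norm_ne_zero_iff.2 hv
    have h1 : embCost hu ε c b (‖v‖⁻¹ • v) ≤ M := hM ⟨(b, ‖v‖⁻¹ • v), ⟨hb, by
      simp [norm_smul, hn]⟩, rfl⟩
    have h2 := embCost_smul (hu := hu) (ε := ε) (c := c) b (‖v‖⁻¹ • v) ‖v‖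
    rw [smul_inv_smul₀ hn] at h2
    rw [h2, mul_comm]
    exact mul_le_mul_of_nonneg_right (h1.trans (le_max_left _ _)) (sq_nonneg _)

/-- Points of the embedded simplex are at an angle of at most `π / 2`, so the segment between them
stays away from the origin. -/
theorem inner_nonneg_of_mem_embSet (hc : ∀ x y, c x y = c y x)
    (hk : HasReproducingKernel H (gibbsKernel ε c)) {x y : H} (hx : x ∈ embSet hu)
    (hy : y ∈ embSet hu) : 0 ≤ inner ℝ x y := by
  rw [inner_eq_sum_weights hu]
  exact Finset.sum_nonneg fun z _ =>
    mul_nonneg (hx.2 z) (apply_pos_of_mem_embSet hc hk hy z).le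

/-- Two points of the embedded simplex are joined by the projection of the segment onto the unit
sphere. -/
theorem exists_path_embSet (hc : ∀ x y, c x y = c y x)
    (hk : HasReproducingKernel H (gibbsKernel ε c)) {x y : H} (hx : x ∈ embSet hu)
    (hy : y ∈ embSet hu) : ∃ b v, IsPathOn (embSet hu) 0 1 b v ∧ b 0 = x ∧ b 1 = y ∧
      ∀ t ∈ Icc (0 : ℝ) 1, ‖v t‖ ≤ 4 * ‖x - y‖ := by
  set p : ℝ → H := fun t => (1 - t) • x + t • y with hp
  have hpn : ∀ t ∈ Icc (0 : ℝ) 1, 1 / 2 ≤ ‖p t‖ := by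
    intro t ht
    refine le_of_sq_le_sq ?_ (norm_nonneg _)
    have h1 := inner_nonneg_of_mem_embSet hc hk hx hy
    have h2 : ‖p t‖ ^ 2 = (1 - t) ^ 2 + 2 * ((1 - t) * t * inner ℝ x y) + t ^ 2 := by
      simp only [hp]
      rw [norm_add_sq_real, norm_smul, norm_smul, hx.1, hy.1, inner_smul_left, inner_smul_right]
      simp
      ring
    rw [h2]
    have h3 := mul_nonneg (mul_nonneg (sub_nonneg.2 ht.2) ht.1) h1
    nlinarith [sq_nonneg (2 * t - 1)]
  have hpd : ∀ t, HasDerivAt p (y - x) t := by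
    intro t
    have h1 : HasDerivAt (fun s : ℝ => (1 - s) • x) (-x) t := by
      have := ((hasDerivAt_id t).const_sub 1).smul_const x
      simpa using this
    have h2 : HasDerivAt (fun s : ℝ => s • y) y t := by
      simpa using (hasDerivAt_id t).smul_const y
    have := h1.add h2
    rwa [neg_add_eq_sub] at this
  have hpc : Continuous p := by simp only [hp]; fun_prop
  set v : ℝ → H := fun t => ‖p t‖⁻¹ • (y - x)
    + (-(inner ℝ (p t) (y - x) / ‖p t‖) / ‖p t‖ ^ 2) • p t with hv
  have hnd : ∀ t ∈ Icc (0 : ℝ) 1, HasDerivAt (fun s => ‖p s‖⁻¹ • p s) (v t) t := by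
    intro t ht
    have hpos : 0 < ‖p t‖ := by linarith [hpn t ht]
    have h1 : HasDerivAt (fun s => ‖p s‖) (inner ℝ (p t) (y - x) / ‖p t‖) t := by
      have h2 := ((hpd t).norm_sq).sqrt (by positivity)
      simp only [Real.sqrt_sq (norm_nonneg _)] at h2
      convert! h2 using 1
      field_simp
    exact (h1.inv hpos.ne').smul (hpd t)
  have hvc : ContinuousOn v (Icc 0 1) := by
    have hne : ∀ t ∈ Icc (0 : ℝ) 1, ‖p t‖ ≠ 0 := fun t ht => by
      have := hpn t ht
      linarith
    have hn : ContinuousOn (fun t => ‖p t‖) (Icc 0 1) := hpc.norm.continuousOn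
    refine ContinuousOn.add ((hn.inv₀ hne).smul continuousOn_const) (ContinuousOn.smul ?_
      hpc.continuousOn)
    refine ContinuousOn.div (ContinuousOn.neg (ContinuousOn.div ?_ hn hne)) (hn.pow 2)
      fun t ht => pow_ne_zero 2 (hne t ht)
    exact (hpc.inner continuous_const).continuousOn
  have hvc' : ContinuousOn v (uIcc 0 1) := by rwa [uIcc_of_le zero_le_one]
  refine ⟨fun t => ‖p t‖⁻¹ • p t, v, ⟨fun t ht => ⟨?_, fun z => ?_⟩, hvc'.intervalIntegrable,
    (hvc'.norm.pow 2).intervalIntegrable, fun t ht => ?_⟩, ?_, ?_, fun t ht => ?_⟩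
  · have hpos : 0 < ‖p t‖ := by linarith [hpn t ht]
    rw [norm_smul, norm_inv, norm_norm, inv_mul_cancel₀ hpos.ne']
  · simp only [hp, map_smul, map_add, Pi.smul_apply, Pi.add_apply, smul_eq_mul]
    exact mul_nonneg (inv_nonneg.2 (norm_nonneg _)) (add_nonneg
      (mul_nonneg (sub_nonneg.2 ht.2) (hx.2 z)) (mul_nonneg ht.1 (hy.2 z)))
  · have hsub : uIcc 0 t ⊆ Icc 0 1 := by
      rw [uIcc_of_le ht.1]; exact Icc_subset_Icc_right ht.2
    rw [intervalIntegral.integral_eq_sub_of_hasDerivAt (fun s hs => hnd s (hsub hs))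
      ((hvc.mono hsub).intervalIntegrable)]
    abel
  · simp [hp, hx.1]
  · simp [hp, hy.1]
  · have hpos : 0 < ‖p t‖ := by linarith [hpn t ht]
    have hinv : ‖p t‖⁻¹ ≤ 2 := by
      rw [inv_le_comm₀ hpos two_pos]; linarith [hpn t ht]
    have h1 : ‖v t‖ ≤ ‖p t‖⁻¹ * ‖y - x‖ + ‖p t‖⁻¹ * ‖y - x‖ := by
      refine (norm_add_le _ _).trans (add_le_add ?_ ?_)
      · rw [norm_smul, norm_inv, norm_norm]
      · rw [norm_smul, norm_div, norm_neg, norm_div, norm_norm, norm_pow, norm_norm]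
        have h2 := norm_inner_le_norm (𝕜 := ℝ) (p t) (y - x)
        rw [div_mul_eq_mul_div, div_le_iff₀ (by positivity), div_mul_eq_mul_div,
          div_le_iff₀ hpos]
        have h3 : ‖p t‖⁻¹ * ‖y - x‖ * ‖p t‖ ^ 2 * ‖p t‖ = (‖p t‖ * ‖y - x‖) * ‖p t‖ := by
          field_simp
        rw [h3]
        exact mul_le_mul_of_nonneg_right h2 hpos.le
    rw [norm_sub_rev x y]
    have h2 := mul_le_mul_of_nonneg_right hinv (norm_nonneg (y - x))
    linarith

/-- The metric tensor makes the embedded simplex a compact length space. -/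
theorem exists_isLengthCost (hu : IsUniversal (X := X) H) (hε : 0 < ε) (hc : ∀ x y, c x y = c y x)
    (hk : HasReproducingKernel H (gibbsKernel ε c)) :
    ∃ M : ℝ, IsLengthCost (embSet hu) (embCost hu ε c) (ε / 2) M 4 := by
  obtain ⟨M, hM0, hM⟩ := exists_embCost_le (hu := hu) hε hc hk
  exact ⟨M, half_pos hε, hM0, by norm_num, isClosed_embSet hu, continuousOn_embCost hε hc hk,
    fun b hb v => le_embCost hε hc hk hb v, hM, embCost_smul,
    fun x hx y hy => exists_path_embSet hc hk hx hy⟩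

end Metric

/-! ### The distance `d_S` as a length distance in the Hilbert space -/

section Distance

variable {X : Type*} [Fintype X] {H : Type*} [NormedAddCommGroup H] [InnerProductSpace ℝ H]
  [CompleteSpace H] [RKHS ℝ H X ℝ] {ε : ℝ} {c : X → X → ℝ} {hu : IsUniversal (X := X) H}

theorem IsPathOn.ae_hasDerivAt {E : Type*} [NormedAddCommGroup E] [NormedSpace ℝ E]
    [CompleteSpace E] {D : Set E} {b v : ℝ → E} (hb : IsPathOn D 0 1 b v) :
    ∀ᵐ t, t ∈ Ioo (0 : ℝ) 1 → HasDerivAt b (v t) t := by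
  filter_upwards [hb.int.ae_hasDerivAt_integral] with t ht hmem
  have h1 := ht (by rw [uIcc_of_le zero_le_one]; exact Ioo_subset_Icc_self hmem) 0 (by simp)
  refine (h1.const_add (b 0)).congr_of_eventuallyEq ?_
  filter_upwards [isOpen_Ioo.mem_nhds hmem] with s hs
  exact hb.eq_add s (Ioo_subset_Icc_self hs)

/-- The velocity of a curve on the unit sphere is tangent to the sphere. -/
theorem inner_eq_zero_of_hasDerivAt {b : ℝ → H} {v : H} {t : ℝ} (hb : HasDerivAt b v t)
    (hmem : ∀ᶠ s in 𝓝 t, b s ∈ embSet hu) : inner ℝ (b t) v = 0 := by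
  have h1 := hb.norm_sq
  have h2 : HasDerivAt (fun s => ‖b s‖ ^ 2) 0 t := by
    refine (hasDerivAt_const t (1 : ℝ)).congr_of_eventuallyEq ?_
    filter_upwards [hmem] with s hs
    rw [hs.1, one_pow]
  have := h1.unique h2
  linarith

/-- The energies of a curve of measures and of its embedding coincide: almost everywhere, the curve
of measures is differentiable with the derivative given by `unembedDeriv`. -/
theorem integral_metricTensor_eq (hε : 0 < ε) (hc : ∀ x y, c x y = c y x)
    (hk : HasReproducingKernel H (gibbsKernel ε c)) {b v : ℝ → H}
    (hb : IsPathOn (embSet hu) 0 1 b v) {γ : ℝ → X → ℝ}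
    (hγ : ∀ t ∈ Icc (0 : ℝ) 1, γ t = unembed hu (b t)) :
    ∫ t in (0 : ℝ)..1, metricTensor ε c (γ t) (deriv γ t) (deriv γ t)
      = ∫ t in (0 : ℝ)..1, embCost hu ε c (b t) (v t) := by
  refine intervalIntegral.integral_congr_ae ?_
  have h1 : ∀ᵐ t : ℝ, t ≠ 1 := by simp [ae_iff]
  filter_upwards [hb.ae_hasDerivAt, h1] with t ht ht1 hmem
  rw [uIoc_of_le zero_le_one] at hmem
  have hm : t ∈ Ioo (0 : ℝ) 1 := ⟨hmem.1, lt_of_le_of_ne hmem.2 ht1⟩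
  have hd := ht hm
  have hnhds := isOpen_Ioo.mem_nhds hm
  have h2 : HasDerivAt γ (unembedDeriv hu (b t) (v t)) t := by
    refine (hasDerivAt_unembed hd).congr_of_eventuallyEq ?_
    filter_upwards [hnhds] with s hs
    exact hγ s (Ioo_subset_Icc_self hs)
  rw [h2.deriv, hγ t (Ioo_subset_Icc_self hm)]
  refine metricTensor_unembedDeriv hε hc hk (hb.mem t (Ioo_subset_Icc_self hm)) ?_
  refine inner_eq_zero_of_hasDerivAt (hu := hu) hd ?_
  filter_upwards [hnhds] with s hs
  exact hb.mem s (Ioo_subset_Icc_self hs)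

theorem memLp_two_iff_intervalIntegrable {E : Type*} [NormedAddCommGroup E] {v : ℝ → E} :
    MemLp v 2 (volume.restrict (Icc (0 : ℝ) 1)) ↔ IntervalIntegrable v volume 0 1 ∧
      IntervalIntegrable (fun t => ‖v t‖ ^ 2) volume 0 1 := by
  rw [intervalIntegrable_iff_integrableOn_Icc_of_le zero_le_one,
    intervalIntegrable_iff_integrableOn_Icc_of_le zero_le_one]
  constructor
  · intro h
    exact ⟨h.integrable one_le_two, (memLp_two_iff_integrable_sq_norm h.1).1 h⟩
  · rintro ⟨h1, h2⟩
    exact (memLp_two_iff_integrable_sq_norm h1.aestronglyMeasurable).2 h2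

/-- In the embedded coordinates `d_S` is the length distance of `embCost`. -/
theorem dS_eq_lengthDist (hu : IsUniversal (X := X) H) (hε : 0 < ε) (hc : ∀ x y, c x y = c y x)
    (hk : HasReproducingKernel H (gibbsKernel ε c)) {μ ν : X → ℝ} (hμ : μ ∈ stdSimplex ℝ X)
    (hν : ν ∈ stdSimplex ℝ X) :
    dS H ε c μ ν = lengthDist (embSet hu) (embCost hu ε c) (embB H ε c μ) (embB H ε c ν) := by
  rw [dS, lengthDist]
  congr 2
  ext e
  constructor
  · rintro ⟨γ, ⟨hγ, rfl, rfl, v, hv, hv'⟩, rfl⟩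
    obtain ⟨h1, h2⟩ := memLp_two_iff_intervalIntegrable.1 hv
    have hb : IsPathOn (embSet hu) 0 1 (fun t => embB H ε c (γ t)) v :=
      ⟨fun t ht => embB_mem hε hc hk (hγ t ht), h1, h2, hv'⟩
    exact ⟨_, v, hb, rfl, rfl, integral_metricTensor_eq hε hc hk hb fun t ht =>
      (unembed_embB hε hc hk (hγ t ht)).symm⟩
  · rintro ⟨b, v, hb, h0, h1, rfl⟩
    have hB : ∀ t ∈ Icc (0 : ℝ) 1, embB H ε c (unembed hu (b t)) = b t := fun t ht =>
      embB_unembed hε hc hk (hb.mem t ht)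
    refine ⟨fun t => unembed hu (b t), ⟨fun t ht => unembed_mem hc hk (hb.mem t ht), ?_, ?_, v,
      memLp_two_iff_intervalIntegrable.2 ⟨hb.int, hb.int_sq⟩, fun t ht => ?_⟩,
      integral_metricTensor_eq hε hc hk hb fun t _ => rfl⟩
    · simp only [h0, unembed_embB hε hc hk hμ]
    · simp only [h1, unembed_embB hε hc hk hν]
    · beta_reduce
      rw [hB t ht, hB 0 (by simp)]
      exact hb.eq_add t ht

/-- The distance `d_S` is equivalent to the distance of the Hilbert space. -/
theorem exists_dS_bounds (hu : IsUniversal (X := X) H) (hε : 0 < ε) (hc : ∀ x y, c x y = c y x)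
    (hk : HasReproducingKernel H (gibbsKernel ε c)) : ∃ L : ℝ, 0 ≤ L ∧
      ∀ μ ∈ stdSimplex ℝ X, ∀ ν ∈ stdSimplex ℝ X,
        √(ε / 2) * ‖embB H ε c μ - embB H ε c ν‖ ≤ dS H ε c μ ν ∧
        dS H ε c μ ν ≤ L * ‖embB H ε c μ - embB H ε c ν‖ := by
  obtain ⟨M, hG⟩ := exists_isLengthCost hu hε hc hk
  refine ⟨√M * 4, by positivity, fun μ hμ ν hν => ?_⟩
  rw [dS_eq_lengthDist hu hε hc hk hμ hν]
  have h1 := embB_mem (hu := hu) hε hc hk hμ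
  have h2 := embB_mem (hu := hu) hε hc hk hν
  exact ⟨hG.le_lengthDist h1 h2, hG.lengthDist_le h1 h2⟩

theorem exists_geodesic_dS (hu : IsUniversal (X := X) H) (hε : 0 < ε) (hc : ∀ x y, c x y = c y x)
    (hk : HasReproducingKernel H (gibbsKernel ε c)) {μ ν : X → ℝ} (hμ : μ ∈ stdSimplex ℝ X)
    (hν : ν ∈ stdSimplex ℝ X) : ∃ γ : ℝ → X → ℝ, (∀ t ∈ Icc (0 : ℝ) 1, γ t ∈ stdSimplex ℝ X) ∧
      γ 0 = μ ∧ γ 1 = ν ∧ ∀ s ∈ Icc (0 : ℝ) 1, ∀ t ∈ Icc (0 : ℝ) 1,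
        dS H ε c (γ s) (γ t) = |t - s| * dS H ε c μ ν := by
  obtain ⟨M, hG⟩ := exists_isLengthCost hu hε hc hk
  obtain ⟨b, hb, h0, h1, hd⟩ := hG.exists_geodesic (isCompact_embSet hu)
    (embB_mem (hu := hu) hε hc hk hμ) (embB_mem (hu := hu) hε hc hk hν)
  refine ⟨fun t => unembed hu (b t), fun t ht => unembed_mem hc hk (hb t ht), ?_, ?_,
    fun s hs t ht => ?_⟩
  · simp only [h0, unembed_embB hε hc hk hμ]
  · simp only [h1, unembed_embB hε hc hk hν]
  · rw [dS_eq_lengthDist hu hε hc hk (unembed_mem hc hk (hb s hs)) (unembed_mem hc hk (hb t ht)),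
      embB_unembed hε hc hk (hb s hs), embB_unembed hε hc hk (hb t ht), hd s hs t ht,
      dS_eq_lengthDist hu hε hc hk hμ hν]

/-- Geodesics between consecutive points of a sequence are glued to a piecewise geodesic
interpolation. -/
theorem exists_isGeodesicInterp (hu : IsUniversal (X := X) H) (hε : 0 < ε)
    (hc : ∀ x y, c x y = c y x) (hk : HasReproducingKernel H (gibbsKernel ε c)) {τ : ℝ}
    (hτ : 0 < τ) {μ : ℕ → X → ℝ} (hμ : ∀ k, μ k ∈ stdSimplex ℝ X) :
    ∃ b : ℝ → H, IsGeodesicInterp H ε c τ μ b := by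
  choose g hg g0 g1 hd using fun k => exists_geodesic_dS hu hε hc hk (hμ k) (hμ (k + 1))
  set γ : ℝ → X → ℝ := fun t => g ⌊t / τ⌋₊ (t / τ - ⌊t / τ⌋₊) with hγ
  have hγk : ∀ k : ℕ, γ (k * τ) = μ k := fun k => by
    simp only [hγ, mul_div_cancel_right₀ _ hτ.ne', Nat.floor_natCast, sub_self, g0]
  -- on the closed interval `[k τ, (k + 1) τ]` the curve is the `k`-th geodesic
  have hpiece : ∀ (k : ℕ), ∀ t ∈ Icc (k * τ) ((k + 1) * τ), γ t = g k (t / τ - k) := by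
    intro k t ht
    rcases ht.2.eq_or_lt with h | h
    · have := hγk (k + 1)
      push_cast at this
      rw [h, this, mul_div_cancel_right₀ _ hτ.ne', add_sub_cancel_left, g1]
    · have : ⌊t / τ⌋₊ = k := by
        rw [Nat.floor_eq_iff (div_nonneg ((by positivity : (0 : ℝ) ≤ k * τ).trans ht.1) hτ.le)]
        exact ⟨(le_div_iff₀ hτ).2 ht.1, (div_lt_iff₀ hτ).2 h⟩
      simp only [hγ, this]
  have hunit : ∀ (k : ℕ), ∀ t ∈ Icc (k * τ) ((k + 1) * τ), t / τ - k ∈ Icc (0 : ℝ) 1 :=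
    fun k t ht => ⟨sub_nonneg.2 ((le_div_iff₀ hτ).2 ht.1),
      sub_le_iff_le_add'.2 ((div_le_iff₀ hτ).2 ht.2)⟩
  refine ⟨fun t => embB H ε c (γ t), γ, fun t ht => ⟨?_, rfl⟩, fun k => ⟨hγk k, ?_⟩⟩
  · have ht' : 0 ≤ t / τ := div_nonneg ht hτ.le
    refine hg _ _ ⟨sub_nonneg.2 (Nat.floor_le ht'), ?_⟩
    linarith [Nat.lt_floor_add_one (t / τ)]
  · intro s hs t ht
    have h1 := hγk (k + 1)
    push_cast at h1
    rw [hγk k, h1, hpiece k s hs, hpiece k t ht, hd k _ (hunit k s hs) _ (hunit k t ht)]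
    congr 1
    rw [sub_sub_sub_cancel_right, ← sub_div, abs_div, abs_of_pos hτ]
    congr 1
    ring

/-- A piecewise geodesic interpolation stays close to the piecewise constant one when the steps of
the sequence are small. -/
theorem IsGeodesicInterp.norm_sub_constInterp_le (hε : 0 < ε) {L δ τ : ℝ} (hτ : 0 < τ)
    (hL : 0 ≤ L) {μ : ℕ → X → ℝ} {b : ℝ → H} (hb : IsGeodesicInterp H ε c τ μ b)
    (hd : ∀ μ ∈ stdSimplex ℝ X, ∀ ν ∈ stdSimplex ℝ X,
      √(ε / 2) * ‖embB H ε c μ - embB H ε c ν‖ ≤ dS H ε c μ ν ∧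
      dS H ε c μ ν ≤ L * ‖embB H ε c μ - embB H ε c ν‖)
    (hμ : ∀ k, μ k ∈ stdSimplex ℝ X)
    (hδ : ∀ k, ‖embB H ε c (μ (k + 1)) - embB H ε c (μ k)‖ ≤ δ) {t : ℝ} (ht : 0 ≤ t) :
    ‖b t - constInterp H ε c τ μ t‖ ≤ L / √(ε / 2) * δ := by
  obtain ⟨γ, hγ, hgeo⟩ := hb
  have hs : 0 < √(ε / 2) := Real.sqrt_pos.2 (half_pos hε)
  set k := ⌊t / τ⌋₊ with hkdef
  have h1 : (k : ℝ) * τ ≤ t := floor_div_mul_le ht hτ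
  have h2 : t < (k + 1) * τ := (div_lt_iff₀ hτ).1 (Nat.lt_floor_add_one _)
  have h3 := (hgeo k).2 (k * τ) ⟨le_rfl, h1.trans h2.le⟩ t ⟨h1, h2.le⟩
  have h4 := (hgeo (k + 1)).1
  push_cast at h4
  rw [(hgeo k).1, h4] at h3
  have h5 := (hd _ (hμ k) _ (hγ t ht).1).1
  have h6 := (hd _ (hμ k) _ (hμ (k + 1))).2
  rw [norm_sub_rev] at h6
  have h7 : |t - k * τ| / ((k + 1) * τ - k * τ) ≤ 1 := by
    rw [abs_of_nonneg (sub_nonneg.2 h1), show ((k : ℝ) + 1) * τ - k * τ = τ by ring,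
      div_le_one hτ]
    linarith
  have h8 : dS H ε c (μ k) (μ (k + 1)) ≤ L * δ := h6.trans (mul_le_mul_of_nonneg_left (hδ k) hL)
  have h9 : dS H ε c (μ k) (γ t) ≤ L * δ := by
    rw [h3]
    exact (mul_le_of_le_one_left (Real.sqrt_nonneg _) h7).trans h8
  rw [(hγ t ht).2, constInterp, norm_sub_rev, div_mul_eq_mul_div, le_div_iff₀' hs]
  exact h5.trans h9

end Distance

/-! ### The flow equation as a variational inequality -/

section Inclusion

variable {X : Type*} [Fintype X] {H : Type*} [NormedAddCommGroup H] [InnerProductSpace ℝ H]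
  [CompleteSpace H] [RKHS ℝ H X ℝ] {ε : ℝ} {c : X → X → ℝ} {hu : IsUniversal (X := X) H}

/-- `Id - K_μ`, multiplied by `b`, turns `ε / 2 ψ + V + p` into local terms and the adjoint of the
multiplication by `V`; here `ψ` is the potential of the velocity `v`, and `p` vanishes on the support
of `μ`. -/
theorem sub_opK_flow (hε : 0 < ε) (hc : ∀ x y, c x y = c y x)
    (hk : HasReproducingKernel H (gibbsKernel ε c)) (V : X → ℝ) {b v : H} (hb : b ∈ embSet hu)
    (hbv : inner ℝ b v = 0) {p : X → ℝ} (hp : ∀ x, weights hu b x * p x = 0) {φ : X → ℝ}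
    (hφ : ∀ x, φ x = ε / 2 * resolvent ε c (unembed hu b)
      (opH ε c (unembed hu b) (unembedDeriv hu b v)) x + V x + p x) (y : X) :
    b y * (φ y - opK ε c (unembed hu b) φ y) =
      ε / 2 * v y + (V y * b y - kernelMean H (fun x => weights hu b x * V x) y) + p y * b y := by
  have hy := apply_pos_of_mem_embSet hc hk hb y
  have h1 := resolvent_opH_unembedDeriv hε hc hk hb hbv y
  set ψ := resolvent ε c (unembed hu b) (opH ε c (unembed hu b) (unembedDeriv hu b v))
  have h2 : opK ε c (unembed hu b) φ y = ε / 2 * opK ε c (unembed hu b) ψ y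
      + opK ε c (unembed hu b) V y + opK ε c (unembed hu b) p y := by
    rw [← opK_smul, ← opK_add, ← opK_add, ← funext hφ]
  have h3 : opK ε c (unembed hu b) p y = 0 := by
    rw [opK_unembed hε hc hk hb]
    simp [hp, kernelMean]
  rw [h2, h3, hφ, opK_unembed hε hc hk hb V]
  rw [sub_eq_iff_eq_add] at h1
  rw [h1]
  field_simp
  ring

theorem sum_weights_mul_kernelMean (V : X → ℝ) (b z : H) :
    ∑ x, weights hu z x * kernelMean H (fun x => weights hu b x * V x) x
      = ∑ x, V x * (weights hu b x * z x) := by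
  rw [← inner_eq_sum_weights hu, real_inner_comm, inner_kernelMean]
  exact Finset.sum_congr rfl fun x _ => by ring

/-- A velocity that solves the flow equation lies, up to the skew-symmetric force, in the normal
cone of the embedded simplex. -/
theorem inner_le_of_pressure (hε : 0 < ε) (hc : ∀ x y, c x y = c y x)
    (hk : HasReproducingKernel H (gibbsKernel ε c)) {V : X → ℝ} {b v : H} (hb : b ∈ embSet hu)
    (hbv : inner ℝ b v = 0) {p : X → ℝ} (hp : p ∈ pressures (unembed hu b)) {C : ℝ}
    (hC : ∀ x, ε / 2 * resolvent ε c (unembed hu b)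
      (opH ε c (unembed hu b) (unembedDeriv hu b v)) x + V x + p x = C) {z : H}
    (hz : z ∈ embSet hu) : inner ℝ v (b - z) ≤ skewForm hu ε V b z := by
  have hpos := apply_pos_of_mem_embSet hc hk hb
  have hp0 : ∀ x, weights hu b x * p x = 0 := fun x => by
    rcases eq_or_ne (weights hu b x) 0 with h | h
    · rw [h, zero_mul]
    · rw [hp.2 x (mul_ne_zero h (hpos x).ne'), mul_zero]
  have h1 : ∀ y, v y = -(2 / ε) * (V y * b y - kernelMean H (fun x => weights hu b x * V x) y
      + p y * b y) := fun y => by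
    have := sub_opK_flow hε hc hk V hb hbv hp0 (φ := fun _ => C) (fun x => (hC x).symm) y
    rw [opK_const hε hc (unembed_mem hc hk hb), sub_self, mul_zero] at this
    field_simp
    linarith
  have h2 : inner ℝ v (b - z) = 2 / ε * (∑ x, V x * (b x * weights hu z x)
      - ∑ x, V x * (weights hu b x * z x) + ∑ x, weights hu z x * (p x * b x)) := by
    rw [inner_sub_right, real_inner_comm, hbv, zero_sub, real_inner_comm, inner_eq_sum_weights hu,
      ← sum_weights_mul_kernelMean, ← Finset.sum_sub_distrib, ← Finset.sum_add_distrib,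
      Finset.mul_sum, ← Finset.sum_neg_distrib]
    refine Finset.sum_congr rfl fun x _ => ?_
    rw [h1]
    ring
  have h3 : ∑ x, weights hu z x * (p x * b x) ≤ 0 := Finset.sum_nonpos fun x _ =>
    mul_nonpos_of_nonneg_of_nonpos (hz.2 x) (mul_nonpos_of_nonpos_of_nonneg (hp.1 x) (hpos x).le)
  rw [h2, skewForm_apply]
  simp only [mul_sub, Finset.sum_sub_distrib]
  have : 2 / ε * ∑ x, weights hu z x * (p x * b x) ≤ 0 :=
    mul_nonpos_of_nonneg_of_nonpos (by positivity) h3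
  linarith

/-- Conversely, the variational inequality produces a pressure: test it with the normalized kernel
functions, which span the extreme rays of the cone over the embedded simplex. -/
theorem exists_pressure_of_inner_le (hε : 0 < ε) (hc : ∀ x y, c x y = c y x)
    (hk : HasReproducingKernel H (gibbsKernel ε c)) {V : X → ℝ} {b v : H} (hb : b ∈ embSet hu)
    (hbv : inner ℝ b v = 0)
    (h : ∀ z ∈ embSet hu, inner ℝ v (b - z) ≤ skewForm hu ε V b z) :
    ∃ p ∈ pressures (unembed hu b), ∃ C : ℝ, ∀ x, ε / 2 * resolvent ε c (unembed hu b)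
      (opH ε c (unembed hu b) (unembedDeriv hu b v)) x + V x + p x = C := by
  classical
  have hpos := apply_pos_of_mem_embSet hc hk hb
  set κ := kernelMean H (fun x => weights hu b x * V x) with hκ
  set q : X → ℝ := fun x => v x + 2 / ε * (V x * b x - κ x) with hq
  have hq0 : ∀ x, 0 ≤ q x := by
    intro x
    set e : H := kernelMean H (Pi.single x (1 : ℝ)) with he
    have hwe : weights hu e = Pi.single x (1 : ℝ) := weights_kernelMean hu _
    have he0 : e ≠ 0 := by
      intro h0
      have := congrFun hwe x
      rw [h0, map_zero, Pi.single_eq_same] at this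
      exact zero_ne_one this
    have hn : 0 < ‖e‖ := norm_pos_iff.2 he0
    have hmem : ‖e‖⁻¹ • e ∈ embSet hu := by
      refine ⟨by rw [norm_smul, norm_inv, norm_norm, inv_mul_cancel₀ hn.ne'], fun y => ?_⟩
      rw [map_smul, hwe, Pi.smul_apply, smul_eq_mul]
      exact mul_nonneg (inv_nonneg.2 hn.le)
        ((Pi.single_nonneg (i := x) (α := fun _ : X => ℝ)).2 zero_le_one y)
    have hev : ∀ w : H, inner ℝ w e = w x := fun w => by
      rw [real_inner_comm, he, inner_kernelMean]
      simp [Pi.single_apply]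
    have h1 := h _ hmem
    rw [inner_sub_right, real_inner_comm, hbv, zero_sub, inner_smul_right, hev, map_smul,
      skewForm_apply] at h1
    simp only [mul_sub, Finset.sum_sub_distrib] at h1
    rw [← sum_weights_mul_kernelMean (hu := hu), ← hκ, hwe, smul_eq_mul] at h1
    simp only [Pi.single_apply, mul_ite, mul_one, mul_zero, ite_mul, one_mul, zero_mul,
      Finset.sum_ite_eq', Finset.mem_univ, if_true] at h1
    have h2 : 0 ≤ ‖e‖⁻¹ * q x := by
      rw [hq]
      beta_reduce
      linarith
    exact nonneg_of_mul_nonneg_right h2 (inv_pos.2 hn)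
  have hsum : ∑ x, weights hu b x * q x = 0 := by
    have h1 : ∀ x, weights hu b x * q x = weights hu b x * v x
        + 2 / ε * (V x * (weights hu b x * b x) - weights hu b x * κ x) := fun x => by
      rw [hq]; ring
    simp only [h1, Finset.sum_add_distrib, ← Finset.mul_sum, Finset.sum_sub_distrib]
    rw [hκ, sum_weights_mul_kernelMean, sub_self, mul_zero, add_zero, ← inner_eq_sum_weights, hbv]
  have hzero : ∀ x, weights hu b x * q x = 0 := fun x =>
    (Finset.sum_eq_zero_iff_of_nonneg fun y _ => mul_nonneg (hb.2 y) (hq0 y)).1 hsum x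
      (Finset.mem_univ x)
  set p : X → ℝ := fun x => -(ε / 2) * q x / b x with hp
  have hp0 : ∀ x, weights hu b x * p x = 0 := fun x => by
    have : weights hu b x * p x = -(ε / 2) / b x * (weights hu b x * q x) := by
      rw [hp]; ring
    rw [this, hzero, mul_zero]
  refine ⟨p, ⟨fun x => ?_, fun x hx => ?_⟩, ?_⟩
  · refine div_nonpos_of_nonpos_of_nonneg ?_ (hpos x).le
    rw [neg_mul]
    exact neg_nonpos.2 (mul_nonneg (half_pos hε).le (hq0 x))
  · exact (mul_eq_zero.1 (hp0 x)).resolve_left (left_ne_zero_of_mul hx)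
  · refine exists_eq_const_of_eq_opK hε hc (unembed_mem hc hk hb) fun y => ?_
    have h1 := sub_opK_flow hε hc hk V hb hbv hp0 (fun _ => rfl) y
    have h2 : ε / 2 * v y + (V y * b y - κ y) + p y * b y = 0 := by
      have := (hpos y).ne'
      rw [hp, hq]
      field_simp
      ring
    rw [← hκ, h2] at h1
    exact sub_eq_zero.1 ((mul_eq_zero.1 h1).resolve_left (hpos y).ne')

end Inclusion

/-! ### Existence, uniqueness and approximation of the flow -/

theorem absolutelyContinuousOnInterval_of_dist_le {Y Z : Type*} [PseudoMetricSpace Y]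
    [PseudoMetricSpace Z] {f : ℝ → Y} {g : ℝ → Z} {a b K : ℝ}
    (hg : AbsolutelyContinuousOnInterval g a b)
    (h : ∀ s ∈ uIcc a b, ∀ t ∈ uIcc a b, dist (f s) (f t) ≤ K * dist (g s) (g t)) :
    AbsolutelyContinuousOnInterval f a b := by
  have h1 := Filter.Tendsto.const_mul K hg
  rw [mul_zero] at h1
  refine squeeze_zero' (Eventually.of_forall fun E => Finset.sum_nonneg fun _ _ => dist_nonneg)
    ?_ h1
  filter_upwards [mem_inf_of_right (mem_principal_self _)] with E hE
  rw [Finset.mul_sum]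
  exact Finset.sum_le_sum fun i hi => h _ (hE.1 i hi).1 _ (hE.1 i hi).2

section Flow

variable {X : Type*} [Fintype X] {H : Type*} [NormedAddCommGroup H] [InnerProductSpace ℝ H]
  [CompleteSpace H] [RKHS ℝ H X ℝ] {ε : ℝ} {c : X → X → ℝ} {V : X → ℝ} {μ₀ : X → ℝ}
  {μ : ℝ → X → ℝ}

theorem IsSinkhornFlow.absolutelyContinuousOnInterval (hu : IsUniversal (X := X) H) (hε : 0 < ε)
    (hc : ∀ x y, c x y = c y x) (hk : HasReproducingKernel H (gibbsKernel ε c))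
    (h : IsSinkhornFlow H ε c V μ₀ μ) {T : ℝ} (hT : 0 < T) :
    AbsolutelyContinuousOnInterval (fun t => embB H ε c (μ t)) 0 T := by
  obtain ⟨L, -, hL⟩ := exists_dS_bounds hu hε hc hk
  obtain ⟨m, hm, hd⟩ := h.ac T hT
  have hs : 0 < √(ε / 2) := Real.sqrt_pos.2 (half_pos hε)
  have hint : IntervalIntegrable m volume 0 T :=
    (intervalIntegrable_iff_integrableOn_Icc_of_le hT.le).2 (hm.integrable one_le_two)
  have hsub : ∀ t ∈ Icc 0 T, IntervalIntegrable m volume 0 t := fun t ht =>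
    hint.mono_set (uIcc_subset_uIcc left_mem_uIcc (by rwa [uIcc_of_le hT.le]))
  refine absolutelyContinuousOnInterval_of_dist_le (K := (√(ε / 2))⁻¹)
    (hint.absolutelyContinuousOnInterval_intervalIntegral left_mem_uIcc) ?_
  rw [uIcc_of_le hT.le]
  have key : ∀ s ∈ Icc 0 T, ∀ t ∈ Icc 0 T, s ≤ t → dist (embB H ε c (μ s)) (embB H ε c (μ t))
      ≤ (√(ε / 2))⁻¹ * dist (∫ r in (0 : ℝ)..s, m r) (∫ r in (0 : ℝ)..t, m r) := by
    intro s hs' t ht hst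
    rw [dist_eq_norm, inv_mul_eq_div, le_div_iff₀' hs]
    refine (hL _ (h.mem_simplex s hs'.1) _ (h.mem_simplex t ht.1)).1.trans
      ((hd s t hs'.1 hst ht.2).trans ?_)
    rw [dist_comm, Real.dist_eq, intervalIntegral.integral_interval_sub_left (hsub t ht)
      (hsub s hs')]
    exact le_abs_self _
  intro s hs' t ht
  rcases le_total s t with hst | hst
  · exact key s hs' t ht hst
  · rw [dist_comm, dist_comm (∫ r in (0 : ℝ)..s, m r)]
    exact key t ht s hs' hst

/-- A Sinkhorn potential flow solves, for almost every time, the differential inclusion driven by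
the skew-symmetric form and the normal cone of the embedded simplex. -/
theorem IsSinkhornFlow.ae_inner_le (hu : IsUniversal (X := X) H) (hε : 0 < ε)
    (hc : ∀ x y, c x y = c y x) (hk : HasReproducingKernel H (gibbsKernel ε c))
    (h : IsSinkhornFlow H ε c V μ₀ μ) {T : ℝ} (hT : 0 < T) :
    ∀ᵐ t, t ∈ Ioo 0 T → ∃ v, HasDerivAt (fun t => embB H ε c (μ t)) v t ∧
      ∀ z ∈ embSet hu, inner ℝ v (embB H ε c (μ t) - z) ≤
        skewForm hu ε V (embB H ε c (μ t)) z := by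
  have := finiteDimensional_of_rkhs X H
  have h1 := (h.absolutelyContinuousOnInterval hu hε hc hk
    hT).boundedVariationOn.ae_differentiableAt_of_mem_uIcc
  have h2 := (ae_restrict_iff' measurableSet_Ici).1 h.inclusion
  filter_upwards [h1, h2] with t ht1 ht2 ht
  have hd := (ht1 (by rw [uIcc_of_le hT.le]; exact Ioo_subset_Icc_self ht)).hasDerivAt
  obtain ⟨μ', hμ', p, hp, C, hC⟩ := ht2 ht.1.le
  have hnhds : ∀ᶠ s in 𝓝 t, 0 ≤ s := by
    filter_upwards [lt_mem_nhds ht.1] with s hs using hs.le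
  have hmem : ∀ s, 0 ≤ s → embB H ε c (μ s) ∈ embSet hu := fun s hs =>
    embB_mem hε hc hk (h.mem_simplex s hs)
  have hun : ∀ s, 0 ≤ s → unembed hu (embB H ε c (μ s)) = μ s := fun s hs =>
    unembed_embB hε hc hk (h.mem_simplex s hs)
  set v := deriv (fun t => embB H ε c (μ t)) t
  have hμ'v : μ' = unembedDeriv hu (embB H ε c (μ t)) v := by
    refine hμ'.unique ((hasDerivAt_unembed (hu := hu) hd).congr_of_eventuallyEq ?_)
    filter_upwards [hnhds] with s hs using (hun s hs).symm
  exact ⟨v, hd, fun z hz => inner_le_of_pressure hε hc hk (hmem t ht.1.le)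
    (inner_eq_zero_of_hasDerivAt (hu := hu) hd (hnhds.mono hmem)) (p := p) (C := C)
    (by rwa [hun t ht.1.le]) (by rw [hun t ht.1.le, ← hμ'v]; exact hC) hz⟩

/-- The flow is a contraction in the Hilbert space; in particular it is unique. -/
theorem IsSinkhornFlow.embB_eq (hu : IsUniversal (X := X) H) (hε : 0 < ε)
    (hc : ∀ x y, c x y = c y x) (hk : HasReproducingKernel H (gibbsKernel ε c)) {ν₀ : X → ℝ}
    {ν : ℝ → X → ℝ} (h : IsSinkhornFlow H ε c V μ₀ μ) (h' : IsSinkhornFlow H ε c V ν₀ ν)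
    (h0 : embB H ε c μ₀ = embB H ε c ν₀) {T : ℝ} (hT : 0 ≤ T) :
    embB H ε c (μ T) = embB H ε c (ν T) := by
  rcases hT.eq_or_lt with rfl | hT
  · rw [h.initial, h'.initial, h0]
  set β : ℝ → H := fun t => embB H ε c (μ t) with hβ
  set β' : ℝ → H := fun t => embB H ε c (ν t) with hβ'
  have hβm : ∀ t, 0 ≤ t → β t ∈ embSet hu := fun t ht => embB_mem hε hc hk (h.mem_simplex t ht)
  have hβm' : ∀ t, 0 ≤ t → β' t ∈ embSet hu := fun t ht =>
    embB_mem hε hc hk (h'.mem_simplex t ht)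
  have hac : AbsolutelyContinuousOnInterval (β - β') 0 T :=
    (h.absolutelyContinuousOnInterval hu hε hc hk hT).sub
      (h'.absolutelyContinuousOnInterval hu hε hc hk hT)
  have hbd : ∀ t ∈ uIcc 0 T, ‖(β - β') t‖ ≤ 2 := fun t ht => by
    rw [uIcc_of_le hT.le] at ht
    refine (norm_sub_le _ _).trans ?_
    rw [(hβm t ht.1).1, (hβm' t ht.1).1]
    norm_num
  set φ : ℝ → ℝ := fun t => ‖(β - β') t‖ ^ 2 with hφ
  have hφac : AbsolutelyContinuousOnInterval φ 0 T := by
    refine absolutelyContinuousOnInterval_of_dist_le (K := 4) hac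
      fun s hs t ht => ?_
    rw [Real.dist_eq, hφ, dist_eq_norm, sq_sub_sq, abs_mul]
    refine mul_le_mul ?_ (abs_norm_sub_norm_le _ _) (abs_nonneg _) (by norm_num)
    rw [abs_of_nonneg (by positivity)]
    linarith [hbd s hs, hbd t ht]
  have hle : ∀ᵐ t, t ∈ Ioo 0 T → deriv φ t ≤ 0 := by
    filter_upwards [h.ae_inner_le hu hε hc hk hT, h'.ae_inner_le hu hε hc hk hT] with t h1 h2 ht
    obtain ⟨v, hv, hv'⟩ := h1 ht
    obtain ⟨w, hw, hw'⟩ := h2 ht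
    have h3 : HasDerivAt φ (2 * inner ℝ ((β - β') t) (v - w)) t := (hv.sub hw).norm_sq
    rw [h3.deriv]
    have h4 := hv' _ (hβm' t ht.1.le)
    have h5 := hw' _ (hβm t ht.1.le)
    -- the skew-symmetric terms cancel
    have h6 : skewForm hu ε V (β t) (β' t) = -skewForm hu ε V (β' t) (β t) := by
      rw [skewForm_apply, skewForm_apply, ← mul_neg, ← Finset.sum_neg_distrib]
      congr 1
      exact Finset.sum_congr rfl fun x _ => by ring
    have h7 : inner ℝ ((β - β') t) (v - w)
        = inner ℝ v (β t - β' t) + inner ℝ w (β' t - β t) := by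
      rw [Pi.sub_apply, inner_sub_right, real_inner_comm v, real_inner_comm w,
        ← neg_sub (β t) (β' t), inner_neg_right]
      ring
    rw [h7]
    linarith
  have hint := hφac.integral_deriv_eq_sub
  have hnonpos : ∫ t in (0 : ℝ)..T, deriv φ t ≤ 0 := by
    rw [intervalIntegral.integral_of_le hT.le, integral_Ioc_eq_integral_Ioo]
    exact setIntegral_nonpos_ae measurableSet_Ioo hle
  have h0' : φ 0 = 0 := by
    have : β 0 = β' 0 := by rw [hβ, hβ']; beta_reduce; rw [h.initial, h'.initial, h0]
    rw [hφ]
    simp [this]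
  have h8 : φ T ≤ 0 := by linarith
  have h9 : ‖(β - β') T‖ = 0 := pow_eq_zero_iff two_ne_zero |>.1 (le_antisymm h8 (sq_nonneg _))
  exact sub_eq_zero.1 (norm_eq_zero.1 h9)

/-- Solutions of the evolution variational inequality in the Hilbert space are Sinkhorn potential
flows. -/
theorem IsEVICurve.isSinkhornFlow {hu : IsUniversal (X := X) H} (hε : 0 < ε)
    (hc : ∀ x y, c x y = c y x) (hk : HasReproducingKernel H (gibbsKernel ε c)) {C : ℝ}
    (hC : 0 ≤ C) (hμ₀ : μ₀ ∈ stdSimplex ℝ X) {b : ℝ → H}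
    (hb : IsEVICurve (skewForm hu ε V) (embSet hu) C b) (h0 : b 0 = embB H ε c μ₀) :
    IsSinkhornFlow H ε c V μ₀ fun t => unembed hu (b t) := by
  have hmem : ∀ t, 0 ≤ t → unembed hu (b t) ∈ stdSimplex ℝ X := fun t ht =>
    unembed_mem hc hk (hb.mem t ht)
  refine ⟨hmem, by simp only [h0, unembed_embB hε hc hk hμ₀], fun T _ => ?_, ?_⟩
  · obtain ⟨L, hL0, hL⟩ := exists_dS_bounds hu hε hc hk
    refine ⟨fun _ => L * C, memLp_const _, fun s t hs hst _ => ?_⟩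
    have h1 := (hL _ (hmem s hs) _ (hmem t (hs.trans hst))).2
    rw [embB_unembed hε hc hk (hb.mem s hs), embB_unembed hε hc hk (hb.mem t (hs.trans hst)),
      norm_sub_rev] at h1
    rw [intervalIntegral.integral_const, smul_eq_mul]
    have h2 := mul_le_mul_of_nonneg_left (hb.dist_le s t hs hst) hL0
    linarith
  · have := finiteDimensional_of_rkhs X H
    have hlip : LipschitzOnWith C.toNNReal b (Ici 0) := by
      refine LipschitzOnWith.of_dist_le_mul fun s hs t ht => ?_
      rw [Real.coe_toNNReal _ hC, Real.dist_eq]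
      rcases le_total s t with hst | hst
      · rw [dist_comm, dist_eq_norm, abs_sub_comm, abs_of_nonneg (sub_nonneg.2 hst)]
        exact hb.dist_le s t hs hst
      · rw [dist_eq_norm, abs_of_nonneg (sub_nonneg.2 hst)]
        exact hb.dist_le t s ht hst
    rw [ae_restrict_iff' measurableSet_Ici]
    have hne : ∀ᵐ t : ℝ, t ≠ 0 := by simp [ae_iff]
    filter_upwards [hlip.ae_differentiableWithinAt_of_mem, hne] with t ht ht0 htm
    have hpos : 0 < t := lt_of_le_of_ne htm ht0.symm
    have hd := ((ht htm).differentiableAt (Ici_mem_nhds hpos)).hasDerivAt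
    refine ⟨_, hasDerivAt_unembed hd, exists_pressure_of_inner_le hε hc hk (hb.mem t htm)
      (inner_eq_zero_of_hasDerivAt (hu := hu) hd ?_) fun z hz => hb.inner_deriv_le htm hd hz⟩
    filter_upwards [lt_mem_nhds hpos] with s hs using hb.mem s hs.le

end Flow

end SinkhornFlow

theorem mainTheorem2 {X : Type*} [Fintype X]
    {H : Type*} [NormedAddCommGroup H] [InnerProductSpace ℝ H] [CompleteSpace H] [RKHS ℝ H X ℝ]
    (ε : ℝ) (hε : 0 < ε)
    (c : X → X → ℝ) (hc_symm : ∀ x y, c x y = c y x) (hc_nonneg : ∀ x y, 0 ≤ c x y)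
    (hk_pd : SinkhornFlow.IsPDKernel (SinkhornFlow.gibbsKernel ε c))
    (hk : SinkhornFlow.HasReproducingKernel H (SinkhornFlow.gibbsKernel ε c))
    (hk_univ : SinkhornFlow.IsUniversal (X := X) H)
    (V : X → ℝ) (μ₀ : X → ℝ) (hμ₀ : μ₀ ∈ stdSimplex ℝ X) :
    -- the objects of the scheme exist
    (∀ τ : ℝ, 0 < τ → ∃ μ : ℕ → X → ℝ, SinkhornFlow.IsSJKO ε c V τ μ₀ μ) ∧
    (∀ τ : ℝ, 0 < τ → ∀ μ : ℕ → X → ℝ, SinkhornFlow.IsSJKO ε c V τ μ₀ μ →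
      ∃ b : ℝ → H, SinkhornFlow.IsGeodesicInterp H ε c τ μ b) ∧
    -- there is a unique flow, and both interpolations converge to it
    ∃ b : ℝ → H,
      SinkhornFlow.IsEmbeddedSinkhornFlow H ε c V (SinkhornFlow.embB H ε c μ₀) b ∧
      (∀ b' : ℝ → H,
        SinkhornFlow.IsEmbeddedSinkhornFlow H ε c V (SinkhornFlow.embB H ε c μ₀) b' →
        ∀ t : ℝ, 0 ≤ t → b' t = b t) ∧
      ∀ μ : ℝ → ℕ → X → ℝ, (∀ τ : ℝ, 0 < τ → SinkhornFlow.IsSJKO ε c V τ μ₀ (μ τ)) →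
        (∀ T : ℝ, 0 < T →
          TendstoUniformlyOn (fun τ => SinkhornFlow.constInterp H ε c τ (μ τ)) b
            (𝓝[>] 0) (Icc 0 T)) ∧
        (∀ bhat : ℝ → ℝ → H,
          (∀ τ : ℝ, 0 < τ → SinkhornFlow.IsGeodesicInterp H ε c τ (μ τ) (bhat τ)) →
          ∀ T : ℝ, 0 < T → TendstoUniformlyOn bhat b (𝓝[>] 0) (Icc 0 T)) := by
  open SinkhornFlow in
  have hex : ∀ τ : ℝ, 0 < τ → ∃ μ : ℕ → X → ℝ, IsSJKO ε c V τ μ₀ μ := fun τ _ =>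
    exists_isSJKO hε hc_symm V τ hμ₀
  obtain ⟨C, hC0, hC⟩ := exists_isStepEVI_of_isSJKO hk_univ hε hc_symm hc_nonneg hk V hμ₀
  set a := skewForm hk_univ ε V with ha
  have hself : ∀ u, a u u = 0 := skewForm_self V
  have hD : ∀ z ∈ embSet hk_univ, ‖z‖ ≤ 1 := fun z hz => hz.1.le
  obtain ⟨b, hb0, hb⟩ := exists_isEVICurve (C := C) (x₀ := embB H ε c μ₀) hself
    (isClosed_embSet hk_univ) hD hC0 (fun j => by
      obtain ⟨μ, hμ⟩ := hex ((1 / 2) ^ j) (by positivity)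
      exact ⟨_, by simp only [hμ.1],
        hC _ (by positivity) (pow_le_one₀ (by norm_num) (by norm_num)) μ hμ⟩)
  set C' := C + 2 * (‖a‖ * C) with hC'
  have hC'0 : 0 ≤ C' := by positivity
  have hflow := hb.isSinkhornFlow hε hc_symm hk hC'0 hμ₀ hb0
  have hbB : ∀ t, 0 ≤ t → b t = embB H ε c (unembed hk_univ (b t)) := fun t ht =>
    (embB_unembed hε hc_symm hk (hb.mem t ht)).symm
  refine ⟨hex, fun τ hτ μ hμ => exists_isGeodesicInterp hk_univ hε hc_symm hk hτ
    fun k => hμ.mem hμ₀ k, b, ⟨μ₀, _, hμ₀, rfl, hflow, hbB⟩, ?_, fun μ hμ => ?_⟩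
  · rintro b' ⟨ν₀, ν, hν₀, h0, hν, hb'⟩ t ht
    rw [hb' t ht, hbB t ht]
    exact hν.embB_eq hk_univ hε hc_symm hk hflow h0 ht
  -- for small steps both interpolations are within `O(√τ)` of the flow
  obtain ⟨L, hL0, hL⟩ := exists_dS_bounds hk_univ hε hc_symm hk
  have hsmall : ∀ᶠ τ : ℝ in 𝓝[>] 0, 0 < τ ∧ τ ≤ 1 := by
    filter_upwards [Ioc_mem_nhdsGT zero_lt_one] with τ hτ using hτ
  have hrate : ∀ T A r : ℝ, Tendsto (fun τ : ℝ => √(T * (A * τ)) + C' * τ + r * (C * τ))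
      (𝓝[>] 0) (𝓝 0) := fun T A r => by
    have : Continuous fun τ : ℝ => √(T * (A * τ)) + C' * τ + r * (C * τ) := by fun_prop
    simpa using (this.tendsto 0).mono_left nhdsWithin_le_nhds
  have hconst : ∀ T τ : ℝ, 0 < τ → τ ≤ 1 → ∀ t ∈ Icc 0 T,
      ‖b t - constInterp H ε c τ (μ τ) t‖
        ≤ √(T * ((C + C' + 2 * (‖a‖ * C)) * τ)) + C' * τ := fun T τ hτ hτ1 t ht =>
    hb.norm_sub_interp_le hself hD hτ hC0 hC'0 (hC τ hτ hτ1 _ (hμ τ hτ))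
      (by simp only [(hμ τ hτ).1, hb0]) ht.1 ht.2
  refine ⟨fun T hT => ?_, fun bhat hbhat T hT => ?_⟩
  · rw [Metric.tendstoUniformlyOn_iff]
    intro δ hδ
    filter_upwards [hsmall, (hrate T (C + C' + 2 * (‖a‖ * C)) 0).eventually_lt_const hδ]
      with τ hτ hlt t ht
    rw [zero_mul, add_zero] at hlt
    rw [dist_eq_norm]
    exact (hconst T τ hτ.1 hτ.2 t ht).trans_lt hlt
  · rw [Metric.tendstoUniformlyOn_iff]
    intro δ hδ
    filter_upwards [hsmall,
      (hrate T (C + C' + 2 * (‖a‖ * C)) (L / √(ε / 2))).eventually_lt_const hδ] with τ hτ hlt t ht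
    have h1 := hconst T τ hτ.1 hτ.2 t ht
    have h2 := (hbhat τ hτ.1).norm_sub_constInterp_le hε hτ.1 hL0 hL
      (fun k => (hμ τ hτ.1).mem hμ₀ k) (hC τ hτ.1 hτ.2 _ (hμ τ hτ.1)).dist_le ht.1
    rw [dist_eq_norm]
    calc ‖b t - bhat τ t‖ = ‖(b t - constInterp H ε c τ (μ τ) t)
          - (bhat τ t - constInterp H ε c τ (μ τ) t)‖ := by rw [sub_sub_sub_cancel_right]
      _ ≤ _ := (norm_sub_le _ _).trans (add_le_add h1 h2)
      _ < δ := hlt
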